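/- **Soundness of the dependently typed WAM (TWAM).** Fix an LF signature $\Sigma$ that is well formed, i.e. declares type families $p : K$, a distinguished collection of simple types $a : \mathsf{type}$ called *Prolog types*, and term constants $c : A$, each declared once and classified in the earlier part of $\Sigma$. A *constructor* is a constant $c : a_1 \to \cdots \to a_n \to a$ with all $a_i, a$ Prolog types; *Prolog terms* are built from variables of Prolog type and constructors. *Machine.* A state has a trail $T$, an LF context $\Delta$, a store $S = (C, H)$ of code $C$ and heap $H$, a register file $R$, and the remaining instructions $I$; besides normal states $(T, \Delta, S, R, I)$ there are states that are reading or writing the arguments of a structure, or writing the components of a tuple. Heap values are structures $c\langle \ell_1, \dots, \ell_n\rangle$, free variables of a Prolog type, pointers, closures and tuples. The instructions are $\mathtt{succeed}[M{:}A]$, $\mathtt{put\_var}$, $\mathtt{get\_val}$, $\mathtt{put\_str}$, $\mathtt{get\_str}$, $\mathtt{unify\_var}$, $\mathtt{unify\_val}$, $\mathtt{jmp}$, $\mathtt{mov}$, $\mathtt{push\_bt}$, $\mathtt{close}$, $\mathtt{put\_tuple}$, $\mathtt{set\_val}$ and $\mathtt{proj}$. The relation $m \mapsto m'$ is the WAM's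 small-step semantics: unification on the heap (with occurs check) binds free variables, records the bindings on the trail, and instantiates $\Delta$ and the remaining instructions; failure backtracks to the latest trail frame and undoes its bindings. At every time the variables declared in $\Delta$ stand for the free variables on the heap. *Types.* Words and heap values have singleton types $S(M{:}a)$ (the Prolog term $M$ of Prolog type $a$), dependent types $\Pi x{:}A.\,\tau$, continuation types $\neg\Gamma$ for register file types $\Gamma$, and tuple types. The judgement $\Delta;\Gamma \vdash I\ \mathsf{ok}$ types instructions, executing first-order unification statically: after $\mathtt{get\_val}$ of registers of types $S(M_1{:}a), S(M_2{:}a)$, and at the end of a structure, the remaining instructions are typed under the most general unifier and need no typing when there is none; $\mathtt{succeed}[M{:}A]$ requires $\Delta \vdash_\Sigma M : A$. The judgement $\vdash m\ \mathsf{ok}$ says that the code has its declared types; that the declarations in $\Delta$ correspond exactly to the free variables on the heap; that there are a heap type $\Psi$ (acyclic) and a register file type $\Gamma$ for which the heap and the registers are well typed; that every frame of the trail holds a well-typed failure continuation once the bindings are undone down to that frame; and that the remaining instructions are well typed. A state is *done* if it is a normal state whose next instruction is a $\mathtt{succeed}$. **Theorem.** Let $m$, $m'$ be TWAM states with $\vdash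 m\ \mathsf{ok}$ and $m \mapsto^* m'$, and let $m'$ be done. Then $$m' = (T, \Delta, S, R, (\mathtt{succeed}[M{:}A];\, I))$$ for some $T, \Delta, S, R, M, A, I$ such that every variable declared in $\Delta$ has a Prolog type, and $$\Delta \vdash_\Sigma M : A$$ is derivable in LF. Thus a successful query yields an LF proof $M$ of the queried goal $A$, relative only to the logic variables that are still free: well-typed TWAM programs are partially correct. -/

import Mathlib

/-!
The dependently typed Warren Abstract Machine: LF, the instruction set, its type system, and its
operational semantics.
-/

namespace TWAM

/-! ## The logical framework LF -/

/-- Raw expressions of LF: terms, type families and kinds share one raw syntax and are separated by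
the judgements below.  The representation is locally nameless: variables bound inside an expression
are de Bruijn indices `bv`, variables declared in a context are names `fv`.
`fam` are type family constants, `cst` are term constants. -/
inductive LF : Type
  | typ : LF
  | fam (a : ℕ) : LF
  | cst (c : ℕ) : LF
  | bv (i : ℕ) : LF
  | fv (x : ℕ) : LF
  | app (M N : LF) : LF
  | lam (A M : LF) : LF
  | pi (A B : LF) : LF

namespace LF

/-- `M.inst d u` puts `u` for the variable bound `d` binders further out. -/
def inst : LF → ℕ → LF → LF
  | typ, _, _ => typ
  | fam a, _, _ => fam a
  | cst c, _, _ => cst c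
  | bv i, d, u => if i = d then u else bv i
  | fv x, _, _ => fv x
  | app M N, d, u => app (M.inst d u) (N.inst d u)
  | lam A M, d, u => lam (A.inst d u) (M.inst (d + 1) u)
  | pi A B, d, u => pi (A.inst d u) (B.inst (d + 1) u)

/-- Simultaneous substitution for names. -/
def msubst (θ : ℕ → LF) : LF → LF
  | typ => typ
  | fam a => fam a
  | cst c => cst c
  | bv i => bv i
  | fv x => θ x
  | app M N => app (M.msubst θ) (N.msubst θ)
  | lam A M => lam (A.msubst θ) (M.msubst θ)
  | pi A B => pi (A.msubst θ) (B.msubst θ)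

/-- No dangling index. -/
def LC (M : LF) : Prop := ∀ d u, M.inst d u = M

/-- `M N₁ … Nₙ` -/
def apps (M : LF) (Ns : List LF) : LF := Ns.foldl app M

/-- `a₁ → … → aₙ → a` for type constants -/
def arrows (as : List ℕ) (a : ℕ) : LF := as.foldr (fun b B => pi (fam b) B) (fam a)

/-- Definitional equality (β-conversion). -/
inductive BetaEq : LF → LF → Prop
  | beta {A M N} : LC (lam A M) → LC N → BetaEq (app (lam A M) N) (M.inst 0 N)
  | refl {M} : BetaEq M M
  | symm {M N} : BetaEq M N → BetaEq N M
  | trans {M N P} : BetaEq M N → BetaEq N P → BetaEq M P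
  | app {M M₁ N N₁} : BetaEq M M₁ → BetaEq N N₁ → BetaEq (app M N) (app M₁ N₁)
  | lam {A A₁ M M₁} (L : Finset ℕ) : BetaEq A A₁ →
      (∀ x ∉ L, BetaEq (M.inst 0 (fv x)) (M₁.inst 0 (fv x))) → BetaEq (lam A M) (lam A₁ M₁)
  | pi {A A₁ B B₁} (L : Finset ℕ) : BetaEq A A₁ →
      (∀ x ∉ L, BetaEq (B.inst 0 (fv x)) (B₁.inst 0 (fv x))) → BetaEq (pi A B) (pi A₁ B₁)

end LF

/-- Declarations of an LF signature.  `ptype a` declares `a : type` and marks it as a type of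
Prolog terms; `fam p K` declares any other type family (such as a predicate);
`cst c A` declares a term constant (a constructor, or a clause of the logic program). -/
inductive Decl : Type
  | ptype (a : ℕ) : Decl
  | fam (p : ℕ) (K : LF) : Decl
  | cst (c : ℕ) (A : LF) : Decl

abbrev Sig := List Decl

/-- LF contexts: names with their types. -/
abbrev Ctx := List (ℕ × LF)

/-- `c` is a constructor of Prolog terms, of type `a₁ → … → aₙ → a` with Prolog types. -/
def Sig.Ctor (sg : Sig) (c : ℕ) (as : List ℕ) (a : ℕ) : Prop :=
  Decl.cst c (LF.arrows as a) ∈ sg ∧ (∀ b ∈ as, Decl.ptype b ∈ sg) ∧ Decl.ptype a ∈ sg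

mutual
  /-- `Δ ⊢ M : A` -/
  inductive HasType (sg : Sig) : Ctx → LF → LF → Prop
    | var {Δ x A} : (x, A) ∈ Δ → HasType sg Δ (.fv x) A
    | cst {Δ c A} : Decl.cst c A ∈ sg → HasType sg Δ (.cst c) A
    | app {Δ M N A B} : HasType sg Δ M (.pi A B) → HasType sg Δ N A →
        HasType sg Δ (.app M N) (B.inst 0 N)
    | lam {Δ A M B} (L : Finset ℕ) : HasKind sg Δ A .typ →
        (∀ x ∉ L, HasType sg ((x, A) :: Δ) (M.inst 0 (.fv x)) (B.inst 0 (.fv x))) →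
        HasType sg Δ (.lam A M) (.pi A B)
    | conv {Δ M A B} : HasType sg Δ M A → HasKind sg Δ B .typ → LF.BetaEq A B → HasType sg Δ M B
  /-- `Δ ⊢ A : K` -/
  inductive HasKind (sg : Sig) : Ctx → LF → LF → Prop
    | ptype {Δ a} : Decl.ptype a ∈ sg → HasKind sg Δ (.fam a) .typ
    | fam {Δ p K} : Decl.fam p K ∈ sg → HasKind sg Δ (.fam p) K
    | pi {Δ A B} (L : Finset ℕ) : HasKind sg Δ A .typ →
        (∀ x ∉ L, HasKind sg ((x, A) :: Δ) (B.inst 0 (.fv x)) .typ) →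
        HasKind sg Δ (.pi A B) .typ
    | app {Δ A M B K} : HasKind sg Δ A (.pi B K) → HasType sg Δ M B →
        HasKind sg Δ (.app A M) (K.inst 0 M)
    | conv {Δ A K K₁} : HasKind sg Δ A K → IsKind sg Δ K₁ → LF.BetaEq K K₁ → HasKind sg Δ A K₁
  /-- `Δ ⊢ K kind` -/
  inductive IsKind (sg : Sig) : Ctx → LF → Prop
    | typ {Δ} : IsKind sg Δ .typ
    | pi {Δ A K} (L : Finset ℕ) : HasKind sg Δ A .typ →
        (∀ x ∉ L, IsKind sg ((x, A) :: Δ) (K.inst 0 (.fv x))) → IsKind sg Δ (.pi A K)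
end

/-- The signature declares the type family constant `p`. -/
def Sig.DeclaresFam (sg : Sig) (p : ℕ) : Prop := Decl.ptype p ∈ sg ∨ ∃ K, Decl.fam p K ∈ sg

/-- The signature declares the term constant `c`. -/
def Sig.DeclaresCst (sg : Sig) (c : ℕ) : Prop := ∃ A, Decl.cst c A ∈ sg

/-- Well-formed LF signatures (latest declaration first). -/
inductive Sig.Valid : Sig → Prop
  | nil : Sig.Valid []
  | ptype {sg : Sig} {a} : Sig.Valid sg → ¬ sg.DeclaresFam a → Sig.Valid (.ptype a :: sg)
  | fam {sg : Sig} {p K} : Sig.Valid sg → ¬ sg.DeclaresFam p → IsKind sg [] K →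
      Sig.Valid (.fam p K :: sg)
  | cst {sg : Sig} {c A} : Sig.Valid sg → ¬ sg.DeclaresCst c → HasKind sg [] A .typ →
      Sig.Valid (.cst c A :: sg)

/-! ## Substitutions and static unification -/

/-- `[(xₙ, Mₙ), …, (x₁, M₁)]` is the composite that first puts `M₁` for `x₁`, and last `Mₙ` for
`xₙ`. -/
abbrev Subst := List (ℕ × LF)

/-- The substitution of `N` for the single name `x`. -/
def single (x : ℕ) (N : LF) : ℕ → LF := fun y => if y = x then N else .fv y

/-- The simultaneous substitution that a composite amounts to. -/
def Subst.fn : Subst → ℕ → LF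
  | [] => .fv
  | (x, N) :: σ => fun y => (Subst.fn σ y).msubst (single x N)

/-- `[σ]Δ`: substitutes in the types of `Δ` and removes the substituted names from `Δ`. -/
def Subst.ctx : Subst → Ctx → Ctx
  | [], Δ => Δ
  | (x, N) :: σ, Δ =>
      ((Subst.ctx σ Δ).filter (fun p => p.1 ≠ x)).map (fun p => (p.1, p.2.msubst (single x N)))

/-- Static occurs check, `x ∈ M`. -/
inductive In (x : ℕ) : LF → Prop
  | var : In x (.fv x)
  | cst {c Ms M} : M ∈ Ms → In x M → In x ((LF.cst c).apps Ms)

/-- `x ∉ M` -/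
inductive NotIn (x : ℕ) : LF → Prop
  | var {y} : x ≠ y → NotIn x (.fv y)
  | cst {c Ms} : (∀ M ∈ Ms, NotIn x M) → NotIn x ((LF.cst c).apps Ms)

mutual
  /-- `Δ ⊢ M₁ ⊓ M₂ = σ` -/
  inductive SUnify : Ctx → LF → LF → Subst → Prop
    | refl {Δ x} : SUnify Δ (.fv x) (.fv x) []
    | varL {Δ : Ctx} {x M} : x ∈ Δ.map Prod.fst → NotIn x M → SUnify Δ (.fv x) M [(x, M)]
    | varR {Δ : Ctx} {x M} : x ∈ Δ.map Prod.fst → NotIn x M → SUnify Δ M (.fv x) [(x, M)]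
    | cst {Δ c Ms Ns σ} : SUnifyArgs Δ Ms Ns σ →
        SUnify Δ ((LF.cst c).apps Ms) ((LF.cst c).apps Ns) σ
  /-- Successive unification of two argument lists. -/
  inductive SUnifyArgs : Ctx → List LF → List LF → Subst → Prop
    | nil {Δ} : SUnifyArgs Δ [] [] []
    | cons {Δ M N Ms Ns σ₁ σ₂} : SUnify Δ M N σ₁ →
        SUnifyArgs (σ₁.ctx Δ) (Ms.map (LF.msubst σ₁.fn)) (Ns.map (LF.msubst σ₁.fn)) σ₂ →
        SUnifyArgs Δ (M :: Ms) (N :: Ns) (σ₂ ++ σ₁)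
end

mutual
  /-- `Δ ⊢ M₁ ⊓ M₂ = ⊥` -/
  inductive SFail : Ctx → LF → LF → Prop
    | varL {Δ x M} : M ≠ .fv x → In x M → SFail Δ (.fv x) M
    | varR {Δ x M} : M ≠ .fv x → In x M → SFail Δ M (.fv x)
    | clash {Δ c c₁ Ms Ns} : c ≠ c₁ → SFail Δ ((LF.cst c).apps Ms) ((LF.cst c₁).apps Ns)
    | cst {Δ c Ms Ns} : SFailArgs Δ Ms Ns → SFail Δ ((LF.cst c).apps Ms) ((LF.cst c).apps Ns)
  /-- Some argument fails to unify, after the arguments before it have unified. -/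
  inductive SFailArgs : Ctx → List LF → List LF → Prop
    | head {Δ M N Ms Ns} : SFail Δ M N → SFailArgs Δ (M :: Ms) (N :: Ns)
    | tail {Δ M N Ms Ns σ} : SUnify Δ M N σ →
        SFailArgs (σ.ctx Δ) (Ms.map (LF.msubst σ.fn)) (Ns.map (LF.msubst σ.fn)) →
        SFailArgs Δ (M :: Ms) (N :: Ns)
end

/-! ## Syntax of the machine

Code locations and heap locations are natural numbers.  All syntax is locally nameless; `map f d`
applies `f` to every LF expression in an object that lies under `d` binders, telling `f` under how
many binders the expression lies. -/

/-- Registers: `k` general registers, and `none`, which is the environment register `env`. -/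
abbrev Reg (k : ℕ) := Option (Fin k)

/-- The register `env`. -/
abbrev Reg.env {k : ℕ} : Reg k := none

/-- Types of words and heap values: the singleton type `S(M : a)`, with `a` a Prolog type;
`Π x:A. τ`; the continuation type `¬ Γ`, with `Γ` a register file type; and tuple types. -/
inductive Ty (k : ℕ) : Type
  | sing (M : LF) (a : ℕ) : Ty k
  | pi (A : LF) (τ : Ty k) : Ty k
  | neg (Γ : Reg k → Option (Ty k)) : Ty k
  | tup (τs : List (Ty k)) : Ty k

/-- Register file types. -/
abbrev RTy (k : ℕ) := Reg k → Option (Ty k)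

mutual
  def Ty.map {k : ℕ} (f : ℕ → LF → LF) : ℕ → Ty k → Ty k
    | d, .sing M a => .sing (f d M) a
    | d, .pi A τ => .pi (f d A) (Ty.map f (d + 1) τ)
    | d, .neg Γ => .neg (fun r => Ty.mapOption f d (Γ r))
    | d, .tup τs => .tup (Ty.mapList f d τs)
  def Ty.mapOption {k : ℕ} (f : ℕ → LF → LF) : ℕ → Option (Ty k) → Option (Ty k)
    | _, none => none
    | d, some τ => some (Ty.map f d τ)
  def Ty.mapList {k : ℕ} (f : ℕ → LF → LF) : ℕ → List (Ty k) → List (Ty k)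
    | _, [] => []
    | d, τ :: τs => Ty.map f d τ :: Ty.mapList f d τs
end

def RTy.map {k : ℕ} (f : ℕ → LF → LF) (d : ℕ) (Γ : RTy k) : RTy k :=
  fun r => Ty.mapOption f d (Γ r)

/-- `Π x₁:A₁. … Π xₙ:Aₙ. τ` -/
def Ty.pis {k : ℕ} (As : List LF) (τ : Ty k) : Ty k := As.foldr Ty.pi τ

/-- `Γ{r : τ}` -/
def RTy.set {k : ℕ} (Γ : RTy k) (r : Reg k) (τ : Ty k) : RTy k := Function.update Γ r (some τ)

/-- `Γ₁ ≤ Γ₂`: every type given by `Γ₁` is given by `Γ₂` as well. -/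
def RTy.Le {k : ℕ} (Γ₁ Γ₂ : RTy k) : Prop := ∀ r τ, Γ₁ r = some τ → Γ₂ r = some τ

/-- Operands: code locations, registers, application to and abstraction over LF terms. -/
inductive Op (k : ℕ) : Type
  | cloc (l : ℕ) : Op k
  | reg (r : Reg k) : Op k
  | app (op : Op k) (M : LF) : Op k
  | lam (A : LF) (op : Op k) : Op k

def Op.map {k : ℕ} (f : ℕ → LF → LF) : ℕ → Op k → Op k
  | _, .cloc l => .cloc l
  | _, .reg r => .reg r
  | d, .app op M => .app (op.map f d) (f d M)
  | d, .lam A op => .lam (f d A) (op.map f (d + 1))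

/-- `ℓ M₁ … Mₙ` for a code location `ℓ` -/
def Op.call {k : ℕ} (l : ℕ) (Ms : List LF) : Op k := Ms.foldl Op.app (.cloc l)

/-- Word values: code locations, heap locations, application to and abstraction over LF terms. -/
inductive Word : Type
  | cloc (l : ℕ) : Word
  | hloc (l : ℕ) : Word
  | app (w : Word) (M : LF) : Word
  | lam (A : LF) (w : Word) : Word

def Word.map (f : ℕ → LF → LF) : ℕ → Word → Word
  | _, .cloc l => .cloc l
  | _, .hloc l => .hloc l
  | d, .app w M => .app (w.map f d) (f d M)
  | d, .lam A w => .lam (f d A) (w.map f (d + 1))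

/-- `w M₁ … Mₙ` -/
def Word.apps (w : Word) (Ms : List LF) : Word := Ms.foldl Word.app w

/-- The heap location, if any, that a word refers to. -/
def Word.loc : Word → Option ℕ
  | .cloc _ => none
  | .hloc l => some l
  | .app w _ => w.loc
  | .lam _ w => w.loc

/-- Instruction sequences (basic blocks).  The instructions `putVar`, `unifyVar` and `unifyVal`
bind an LF variable of Prolog type `a` in the rest of the block. -/
inductive Instr (k : ℕ) : Type
  | nil : Instr k
  | succeed (M A : LF) (I : Instr k) : Instr k
  | putVar (r : Reg k) (a : ℕ) (I : Instr k) : Instr k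
  | getVal (r₁ r₂ : Reg k) (I : Instr k) : Instr k
  | jmp (op : Op k) (I : Instr k) : Instr k
  | mov (rd : Reg k) (op : Op k) (I : Instr k) : Instr k
  | pushBt (re : Reg k) (l : ℕ) (Ms : List LF) (I : Instr k) : Instr k
  | close (rd re : Reg k) (l : ℕ) (Ms : List LF) (I : Instr k) : Instr k
  | putTuple (rd : Reg k) (n : ℕ) (I : Instr k) : Instr k
  | setVal (rs : Reg k) (I : Instr k) : Instr k
  | proj (rd rs : Reg k) (i : ℕ) (I : Instr k) : Instr k
  | putStr (c : ℕ) (r : Reg k) (I : Instr k) : Instr k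
  | getStr (c : ℕ) (r : Reg k) (I : Instr k) : Instr k
  | unifyVar (r : Reg k) (a : ℕ) (I : Instr k) : Instr k
  | unifyVal (r : Reg k) (a : ℕ) (I : Instr k) : Instr k

def Instr.map {k : ℕ} (f : ℕ → LF → LF) : ℕ → Instr k → Instr k
  | _, .nil => .nil
  | d, .succeed M A I => .succeed (f d M) (f d A) (I.map f d)
  | d, .putVar r a I => .putVar r a (I.map f (d + 1))
  | d, .getVal r₁ r₂ I => .getVal r₁ r₂ (I.map f d)
  | d, .jmp op I => .jmp (op.map f d) (I.map f d)
  | d, .mov rd op I => .mov rd (op.map f d) (I.map f d)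
  | d, .pushBt re l Ms I => .pushBt re l (Ms.map (f d)) (I.map f d)
  | d, .close rd re l Ms I => .close rd re l (Ms.map (f d)) (I.map f d)
  | d, .putTuple rd n I => .putTuple rd n (I.map f d)
  | d, .setVal rs I => .setVal rs (I.map f d)
  | d, .proj rd rs i I => .proj rd rs i (I.map f d)
  | d, .putStr c r I => .putStr c r (I.map f d)
  | d, .getStr c r I => .getStr c r (I.map f d)
  | d, .unifyVar r a I => .unifyVar r a (I.map f (d + 1))
  | d, .unifyVal r a I => .unifyVal r a (I.map f (d + 1))

/-- Code values `code[x₁:A₁, …, xₙ:Aₙ. Γ](λ x₁:A₁, …, xₙ:Aₙ. I)`. -/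
inductive Code (k : ℕ) : Type
  | body (Γ : RTy k) (I : Instr k) : Code k
  | lam (A : LF) (v : Code k) : Code k

def Code.map {k : ℕ} (f : ℕ → LF → LF) : ℕ → Code k → Code k
  | d, .body Γ I => .body (Γ.map f d) (I.map f d)
  | d, .lam A v => .lam (f d A) (v.map f (d + 1))

/-- Types of Prolog spines, `Π x₁:a₁. … Π xₙ:aₙ. (M₁ ⊓ M₂)`. -/
inductive Spine : Type
  | unif (M₁ M₂ : LF) : Spine
  | pi (a : ℕ) (J : Spine) : Spine

def Spine.map (f : ℕ → LF → LF) : ℕ → Spine → Spine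
  | d, .unif M₁ M₂ => .unif (f d M₁) (f d M₂)
  | d, .pi a J => .pi a (J.map f (d + 1))

/-- `Π x⃗:a⃗. (M ⊓ c N⃗ x⃗)`, where the `x⃗` do not occur in `M` and `N⃗`. -/
def Spine.str (M : LF) (c : ℕ) (Ns : List LF) (as : List ℕ) : Spine :=
  as.foldr Spine.pi
    (.unif M ((LF.cst c).apps (Ns ++ ((List.range as.length).reverse.map LF.bv))))

/-- Heap values: structures `c⟨ℓ₁, …, ℓₙ⟩`, free variables, pointers, closures, and tuples.
The LF variable that stands for a free variable on the heap is named by its heap location: the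
value `free[x:a]` at location `l` is `free a`, with `x` the name `l`. -/
inductive HVal : Type
  | str (c : ℕ) (ls : List ℕ) : HVal
  | free (a : ℕ) : HVal
  | bound (l : ℕ) : HVal
  | clos (w : Word) (l : ℕ) (Ms : List LF) : HVal
  | tup (ws : List Word) : HVal

def HVal.map (f : ℕ → LF → LF) (d : ℕ) : HVal → HVal
  | .str c ls => .str c ls
  | .free a => .free a
  | .bound l => .bound l
  | .clos w l Ms => .clos (w.map f d) l (Ms.map (f d))
  | .tup ws => .tup (ws.map (Word.map f d))

def Ty.inst {k : ℕ} (τ : Ty k) (d : ℕ) (u : LF) : Ty k := τ.map (fun i M => M.inst i u) d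
def Ty.msubst {k : ℕ} (τ : Ty k) (θ : ℕ → LF) : Ty k := τ.map (fun _ M => M.msubst θ) 0
def RTy.msubst {k : ℕ} (Γ : RTy k) (θ : ℕ → LF) : RTy k := Γ.map (fun _ M => M.msubst θ) 0
def Op.inst {k : ℕ} (op : Op k) (d : ℕ) (u : LF) : Op k := op.map (fun i M => M.inst i u) d
def Word.inst (w : Word) (d : ℕ) (u : LF) : Word := w.map (fun i M => M.inst i u) d
def Word.msubst (w : Word) (θ : ℕ → LF) : Word := w.map (fun _ M => M.msubst θ) 0
def Instr.inst {k : ℕ} (I : Instr k) (d : ℕ) (u : LF) : Instr k := I.map (fun i M => M.inst i u) d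
def Instr.msubst {k : ℕ} (I : Instr k) (θ : ℕ → LF) : Instr k := I.map (fun _ M => M.msubst θ) 0
def Code.inst {k : ℕ} (v : Code k) (d : ℕ) (u : LF) : Code k := v.map (fun i M => M.inst i u) d
def Code.msubst {k : ℕ} (v : Code k) (θ : ℕ → LF) : Code k := v.map (fun _ M => M.msubst θ) 0
def Spine.inst (J : Spine) (d : ℕ) (u : LF) : Spine := J.map (fun i M => M.inst i u) d
def HVal.msubst (v : HVal) (θ : ℕ → LF) : HVal := v.map (fun _ M => M.msubst θ) 0

/-- No dangling index. -/
def Ty.LC {k : ℕ} (τ : Ty k) : Prop := ∀ d u, τ.inst d u = τ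

/-- No free name and no dangling index. -/
def Code.Closed {k : ℕ} (v : Code k) : Prop := (∀ θ, v.msubst θ = v) ∧ ∀ d u, v.inst d u = v

/-- The type `Π x₁:A₁. … Π xₙ:Aₙ. ¬ Γ` of a code value. -/
def Code.ty {k : ℕ} : Code k → Ty k
  | .body Γ _ => .neg Γ
  | .lam A v => .pi A v.ty

/-- `[M₁, …, Mₙ / x₁, …, xₙ] I`, for a code value with exactly `n` parameters and body `I`. -/
def Code.instantiate {k : ℕ} : Code k → List LF → Option (Instr k)
  | .body _ I, [] => some I
  | .lam _ v, M :: Ms => (v.inst 0 M).instantiate Ms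
  | _, _ => none
termination_by _ Ms => Ms.length

/-! ## Typing of operands and instructions

`Ξ` assigns types to code locations. -/

/-- `Δ; Γ ⊢ op : τ` -/
inductive OpTy {k : ℕ} (sg : Sig) (Ξ : ℕ → Option (Ty k)) : Ctx → RTy k → Op k → Ty k → Prop
  | cloc {Δ Γ l τ} : Ξ l = some τ → OpTy sg Ξ Δ Γ (.cloc l) τ
  | reg {Δ Γ r τ} : Γ r = some τ → OpTy sg Ξ Δ Γ (.reg r) τ
  | app {Δ Γ op M A τ} : OpTy sg Ξ Δ Γ op (.pi A τ) → HasType sg Δ M A →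
      OpTy sg Ξ Δ Γ (.app op M) (τ.inst 0 M)
  | lam {Δ Γ A op τ} (L : Finset ℕ) : HasKind sg Δ A .typ →
      (∀ x ∉ L, OpTy sg Ξ ((x, A) :: Δ) Γ (op.inst 0 (.fv x)) (τ.inst 0 (.fv x))) →
      OpTy sg Ξ Δ Γ (.lam A op) (.pi A τ)

mutual
  /-- `Δ; Γ ⊢ I ok` -/
  inductive InstrOk {k : ℕ} (sg : Sig) (Ξ : ℕ → Option (Ty k)) : Ctx → RTy k → Instr k → Prop
    | succeed {Δ Γ M A I} : HasType sg Δ M A → InstrOk sg Ξ Δ Γ (.succeed M A I)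
    | putVar {Δ Γ r a I} (L : Finset ℕ) : Decl.ptype a ∈ sg →
        (∀ x ∉ L, InstrOk sg Ξ ((x, .fam a) :: Δ) (Γ.set r (.sing (.fv x) a)) (I.inst 0 (.fv x))) →
        InstrOk sg Ξ Δ Γ (.putVar r a I)
    | getValS {Δ Γ r₁ r₂ I M₁ M₂ a σ} : Γ r₁ = some (.sing M₁ a) → Γ r₂ = some (.sing M₂ a) →
        SUnify Δ M₁ M₂ σ → InstrOk sg Ξ (σ.ctx Δ) (Γ.msubst σ.fn) (I.msubst σ.fn) →
        InstrOk sg Ξ Δ Γ (.getVal r₁ r₂ I)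
    | getValF {Δ Γ r₁ r₂ I M₁ M₂ a} : Γ r₁ = some (.sing M₁ a) → Γ r₂ = some (.sing M₂ a) →
        SFail Δ M₁ M₂ → InstrOk sg Ξ Δ Γ (.getVal r₁ r₂ I)
    | jmp {Δ Γ Γ₁ op I} : OpTy sg Ξ Δ Γ op (.neg Γ₁) → RTy.Le Γ₁ Γ → InstrOk sg Ξ Δ Γ (.jmp op I)
    | mov {Δ Γ rd op I τ} : OpTy sg Ξ Δ Γ op τ → InstrOk sg Ξ Δ (Γ.set rd τ) I →
        InstrOk sg Ξ Δ Γ (.mov rd op I)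
    | pushBt {Δ Γ re l Ms I τ} : InstrOk sg Ξ Δ Γ I → Γ re = some τ →
        OpTy sg Ξ Δ Γ (.call l Ms) (.neg (RTy.set (fun _ => none) Reg.env τ)) →
        InstrOk sg Ξ Δ Γ (.pushBt re l Ms I)
    | close {Δ Γ Γ₁ rd re l Ms I τ As} : Γ re = some τ → τ.LC →
        OpTy sg Ξ Δ Γ (.call l Ms) (.pis As (.neg (RTy.set Γ₁ Reg.env τ))) →
        InstrOk sg Ξ Δ (Γ.set rd (.pis As (.neg Γ₁))) I →
        InstrOk sg Ξ Δ Γ (.close rd re l Ms I)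
    | putTuple {Δ Γ rd n I τs} : τs.length = n → TupleOk sg Ξ Δ Γ I τs rd (.tup τs) →
        InstrOk sg Ξ Δ Γ (.putTuple rd n I)
    /-  Tuple components are counted from 0. -/
    | proj {Δ Γ rd rs i I τs τ} : Γ rs = some (.tup τs) → τs[i]? = some τ →
        InstrOk sg Ξ Δ (Γ.set rd τ) I → InstrOk sg Ξ Δ Γ (.proj rd rs i I)
    | putStr {Δ Γ c r I as a} (L : Finset ℕ) : sg.Ctor c as a →
        (∀ x ∉ L, SpineOk sg Ξ ((x, .fam a) :: Δ) (Γ.set r (.sing (.fv x) a)) I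
          (.str (.fv x) c [] as)) →
        InstrOk sg Ξ Δ Γ (.putStr c r I)
    | getStr {Δ Γ c r I as a M} : sg.Ctor c as a → Γ r = some (.sing M a) →
        SpineOk sg Ξ Δ Γ I (.str M c [] as) → InstrOk sg Ξ Δ Γ (.getStr c r I)
  /-- Prolog spines, `Δ; Γ ⊢ I :ₛ J` -/
  inductive SpineOk {k : ℕ} (sg : Sig) (Ξ : ℕ → Option (Ty k)) :
      Ctx → RTy k → Instr k → Spine → Prop
    | unifyVar {Δ Γ r a I J} (L : Finset ℕ) :
        (∀ x ∉ L, SpineOk sg Ξ ((x, .fam a) :: Δ) (Γ.set r (.sing (.fv x) a)) (I.inst 0 (.fv x))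
          (J.inst 0 (.fv x))) →
        SpineOk sg Ξ Δ Γ (.unifyVar r a I) (.pi a J)
    | unifyVal {Δ Γ r a I J M} : Γ r = some (.sing M a) →
        SpineOk sg Ξ Δ Γ (I.inst 0 M) (J.inst 0 M) → SpineOk sg Ξ Δ Γ (.unifyVal r a I) (.pi a J)
    | endS {Δ Γ I M₁ M₂ σ} : SUnify Δ M₁ M₂ σ →
        InstrOk sg Ξ (σ.ctx Δ) (Γ.msubst σ.fn) (I.msubst σ.fn) →
        SpineOk sg Ξ Δ Γ I (.unif M₁ M₂)
    | endF {Δ Γ I M₁ M₂} : SFail Δ M₁ M₂ → SpineOk sg Ξ Δ Γ I (.unif M₁ M₂)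
  /-- Tuple spines, `Δ; Γ ⊢ I :ₜ (τ₁ → … → τₙ → {r : τ})` -/
  inductive TupleOk {k : ℕ} (sg : Sig) (Ξ : ℕ → Option (Ty k)) :
      Ctx → RTy k → Instr k → List (Ty k) → Reg k → Ty k → Prop
    | setVal {Δ Γ rs I τ₁ τs r τ} : Γ rs = some τ₁ → TupleOk sg Ξ Δ Γ I τs r τ →
        TupleOk sg Ξ Δ Γ (.setVal rs I) (τ₁ :: τs) r τ
    | done {Δ Γ I r τ} : InstrOk sg Ξ Δ (Γ.set r τ) I → TupleOk sg Ξ Δ Γ I [] r τ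
end

/-- The body of a code value is well-typed once its parameters are declared. -/
inductive CodeOk {k : ℕ} (sg : Sig) (Ξ : ℕ → Option (Ty k)) : Ctx → Code k → Prop
  | body {Δ Γ I} : InstrOk sg Ξ Δ Γ I → CodeOk sg Ξ Δ (.body Γ I)
  | lam {Δ A v} (L : Finset ℕ) : (∀ x ∉ L, CodeOk sg Ξ ((x, A) :: Δ) (v.inst 0 (.fv x))) →
      CodeOk sg Ξ Δ (.lam A v)

/-- `⊢ C : Ξ` -/
def CodeSecOk {k : ℕ} (sg : Sig) (C : ℕ → Option (Code k)) (Ξ : ℕ → Option (Ty k)) : Prop :=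
  (∀ l, Ξ l = (C l).map Code.ty) ∧ ∀ l v, C l = some v → v.Closed ∧ CodeOk sg Ξ [] v

/-! ## Heaps, trails and machine states -/

abbrev Heap := ℕ → Option HVal

/-- A trail frame: the free variables (with their types) that were bound since the frame was
pushed, latest first, and a failure continuation with its environment. -/
structure Frame where
  bindings : List (ℕ × ℕ)
  env : Word
  label : ℕ
  args : List LF

abbrev Trail := List Frame

/-- The trail, the LF context `Δ`, the store `(C, H)`, the register file and the remaining
instructions. -/
structure Conf (k : ℕ) where
  trail : Trail
  ctx : Ctx
  code : ℕ → Option (Code k)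
  heap : Heap
  regs : Reg k → Option Word
  instr : Instr k

/-- Machine states: normal states; read spines with the arguments not yet read; write spines with
the constructor, the destination and the arguments written so far; tuple spines with the
destination register, the number of components still to be written, and those written so far. -/
inductive State (k : ℕ) : Type
  | run (m : Conf k) : State k
  | read (m : Conf k) (ls : List ℕ) : State k
  | write (m : Conf k) (c : ℕ) (l : ℕ) (ls : List ℕ) : State k
  | twrite (m : Conf k) (r : Reg k) (n : ℕ) (ws : List Word) : State k

mutual
  /-- The Prolog term at location `l` of the heap `H` encodes the LF term `M`. -/
  inductive Encodes (H : Heap) : ℕ → LF → Prop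
    | free {l a} : H l = some (.free a) → Encodes H l (.fv l)
    | bound {l l₁ M} : H l = some (.bound l₁) → Encodes H l₁ M → Encodes H l M
    | str {l c ls Ms} : H l = some (.str c ls) → EncodesList H ls Ms →
        Encodes H l ((LF.cst c).apps Ms)
  inductive EncodesList (H : Heap) : List ℕ → List LF → Prop
    | nil : EncodesList H [] []
    | cons {l ls M Ms} : Encodes H l M → EncodesList H ls Ms → EncodesList H (l :: ls) (M :: Ms)
end

open Classical in
/-- The LF term encoded at location `l`.  As names of LF variables are heap locations,
`readback H` is also the composite of all unifiers found so far: it replaces each variable that has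
been bound by its current value.  LF expressions in heap values, registers and the trail are not
rewritten when a variable gets bound; they are to be read under the substitution `readback H`
(so undoing the bindings also undoes the substitution), whereas `Δ` and the remaining instructions
are always kept instantiated. -/
noncomputable def readback (H : Heap) (l : ℕ) : LF :=
  if h : ∃ M, Encodes H l M then h.choose else .fv l

/-- The part of a word that is applied to LF terms is not an abstraction. -/
inductive Word.Path : Word → Prop
  | cloc {l} : Word.Path (.cloc l)
  | hloc {l} : Word.Path (.hloc l)
  | app {w M} : Word.Path w → Word.Path (.app w M)

/-- Canonical words. -/
inductive Word.Canon : Word → Prop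
  | path {w} : Word.Path w → Word.Canon w
  | lam {A w} : Word.Canon w → Word.Canon (.lam A w)

/-- `Δ; Ψ ⊢ w : τ` -/
inductive WordTy {k : ℕ} (sg : Sig) (Ξ : ℕ → Option (Ty k)) :
    Ctx → List (ℕ × Ty k) → Word → Ty k → Prop
  | cloc {Δ Ψ l τ} : Ξ l = some τ → WordTy sg Ξ Δ Ψ (.cloc l) τ
  | hloc {Δ Ψ l τ} : (l, τ) ∈ Ψ → WordTy sg Ξ Δ Ψ (.hloc l) τ
  | app {Δ Ψ w M A τ} : WordTy sg Ξ Δ Ψ w (.pi A τ) → HasType sg Δ M A →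
      WordTy sg Ξ Δ Ψ (.app w M) (τ.inst 0 M)
  | lam {Δ Ψ A w τ} (L : Finset ℕ) : HasKind sg Δ A .typ →
      (∀ x ∉ L, WordTy sg Ξ ((x, A) :: Δ) Ψ (w.inst 0 (.fv x)) (τ.inst 0 (.fv x))) →
      WordTy sg Ξ Δ Ψ (.lam A w) (.pi A τ)

/-- The locations `ℓᵢ` have the types `S(Mᵢ : aᵢ)`. -/
inductive LocsTy {k : ℕ} (Ψ : List (ℕ × Ty k)) : List ℕ → List LF → List ℕ → Prop
  | nil : LocsTy Ψ [] [] []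
  | cons {l ls M Ms a as} : (l, Ty.sing M a) ∈ Ψ → LocsTy Ψ ls Ms as →
      LocsTy Ψ (l :: ls) (M :: Ms) (a :: as)

/-- `Δ; Ψ ⊢ v : τ` for the heap value `v` at location `l`. -/
inductive HValTy {k : ℕ} (sg : Sig) (Ξ : ℕ → Option (Ty k)) (Δ : Ctx) (Ψ : List (ℕ × Ty k))
    (l : ℕ) : HVal → Ty k → Prop
  | clos {w l₁ Ms τ As Γ} : WordTy sg Ξ Δ Ψ w τ → w.Canon → τ.LC →
      WordTy sg Ξ Δ Ψ ((Word.cloc l₁).apps Ms) (.pis As (.neg (RTy.set Γ Reg.env τ))) →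
      HValTy sg Ξ Δ Ψ l (.clos w l₁ Ms) (.pis As (.neg Γ))
  | tup {ws τs} : List.Forall₂ (fun w τ => WordTy sg Ξ Δ Ψ w τ ∧ w.Canon) ws τs →
      HValTy sg Ξ Δ Ψ l (.tup ws) (.tup τs)
  | free {a} : (l, LF.fam a) ∈ Δ → HValTy sg Ξ Δ Ψ l (.free a) (.sing (.fv l) a)
  | bound {l₁ M a} : (l₁, Ty.sing M a) ∈ Ψ → HValTy sg Ξ Δ Ψ l (.bound l₁) (.sing M a)
  | str {c ls Ms as a} : sg.Ctor c as a → LocsTy Ψ ls Ms as →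
      HValTy sg Ξ Δ Ψ l (.str c ls) (.sing ((LF.cst c).apps Ms) a)

/-- `Δ ⊢ H : Ψ`: each value refers only to locations typed before it, so that the typed part of
the heap is acyclic. -/
inductive HeapOk {k : ℕ} (sg : Sig) (Ξ : ℕ → Option (Ty k)) (Δ : Ctx) (H : Heap) :
    List (ℕ × Ty k) → Prop
  | nil : HeapOk sg Ξ Δ H []
  | cons {Ψ l v τ} : HeapOk sg Ξ Δ H Ψ → H l = some v →
      HValTy sg Ξ Δ Ψ l (v.msubst (readback H)) τ → l ∉ Ψ.map Prod.fst →
      HeapOk sg Ξ Δ H ((l, τ) :: Ψ)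

/-- `⊢ (Δ; μ) : H`: the variables declared in `Δ` are exactly the free variables on the heap, with
their Prolog types.  As variables are named by their locations, the mapping `μ` sends each name to
itself and is not recorded. -/
def CtxOk (sg : Sig) (Δ : Ctx) (H : Heap) : Prop :=
  (Δ.map Prod.fst).Nodup ∧
  (∀ x A, (x, A) ∈ Δ ↔ ∃ a, A = .fam a ∧ H x = some (.free a)) ∧
  ∀ x a, H x = some (.free a) → Decl.ptype a ∈ sg

/-- `Δ; Ψ ⊢ R : Γ` -/
def RegsOk {k : ℕ} (sg : Sig) (Ξ : ℕ → Option (Ty k)) (Δ : Ctx) (Ψ : List (ℕ × Ty k)) (H : Heap)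
    (R : Reg k → Option Word) (Γ : RTy k) : Prop :=
  ∀ r, Option.Rel (fun w τ => WordTy sg Ξ Δ Ψ (w.msubst (readback H)) τ ∧ w.Canon) (R r) (Γ r)

/-- `unwind(S, Δ, t) = (Δ', S')`: makes the recorded variables free again, latest first. -/
inductive Unwind : Heap → Ctx → List (ℕ × ℕ) → Ctx → Heap → Prop
  | nil {H Δ} : Unwind H Δ [] Δ H
  | cons {H Δ l a t Δ₁ H₁ v} : H l = some v →
      Unwind (Function.update H l (some (.free a))) ((l, .fam a) :: Δ) t Δ₁ H₁ →
      Unwind H Δ ((l, a) :: t) Δ₁ H₁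

/-- `uptrail` -/
def uptrail (l a : ℕ) : Trail → Trail
  | [] => []
  | F :: T => { F with bindings := (l, a) :: F.bindings } :: T

/-- `Δ; S ⊢ T ok` -/
inductive TrailOk {k : ℕ} (sg : Sig) (Ξ : ℕ → Option (Ty k)) : Ctx → Heap → Trail → Prop
  | nil {Δ H} : TrailOk sg Ξ Δ H []
  | cons {Δ H Δ₁ H₁ Ψ₁ τ F T} : Unwind H Δ F.bindings Δ₁ H₁ → TrailOk sg Ξ Δ₁ H₁ T →
      CtxOk sg Δ₁ H₁ → HeapOk sg Ξ Δ₁ H₁ Ψ₁ →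
      WordTy sg Ξ Δ₁ Ψ₁ (F.env.msubst (readback H₁)) τ → F.env.Canon →
      WordTy sg Ξ Δ₁ Ψ₁ (((Word.cloc F.label).apps F.args).msubst (readback H₁))
        (.neg (RTy.set (fun _ => none) Reg.env τ)) →
      TrailOk sg Ξ Δ H (F :: T)

/-- `Δ; Ψ ⊢ ℓ⃗ reads J` -/
inductive Reads {k : ℕ} (Δ : Ctx) (Ψ : List (ℕ × Ty k)) : List ℕ → Spine → Prop
  | intro {ls c Ms Ns as} (L : Finset ℕ) : LocsTy Ψ ls Ns as →
      (∀ xs : List ℕ, xs.length = as.length → xs.Nodup → (∀ x ∈ xs, x ∉ L) →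
        ∃ σ, SUnify (xs.zip (as.map LF.fam) ++ Δ) ((LF.cst c).apps (Ms ++ xs.map LF.fv))
          ((LF.cst c).apps (Ms ++ Ns)) σ) →
      Reads Δ Ψ ls (.str ((LF.cst c).apps (Ms ++ Ns)) c Ms as)

/-- `Δ; Ψ ⊢ (ℓ⃗, ℓ, c) writes J` for Prolog spines -/
inductive Writes {k : ℕ} (sg : Sig) (Ψ : List (ℕ × Ty k)) : List ℕ → ℕ → ℕ → Spine → Prop
  | intro {ls l c x Ms as₁ as₂ a} : sg.Ctor c (as₁ ++ as₂) a → LocsTy Ψ ls Ms as₁ →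
      (l, Ty.sing (.fv x) a) ∈ Ψ → Writes sg Ψ ls l c (.str (.fv x) c Ms as₂)

/-- The conditions common to all machine states. -/
def ConfOk {k : ℕ} (sg : Sig) (Ξ : ℕ → Option (Ty k)) (Ψ : List (ℕ × Ty k)) (Γ : RTy k)
    (m : Conf k) : Prop :=
  CodeSecOk sg m.code Ξ ∧ HeapOk sg Ξ m.ctx m.heap Ψ ∧ CtxOk sg m.ctx m.heap ∧
  TrailOk sg Ξ m.ctx m.heap m.trail ∧ RegsOk sg Ξ m.ctx Ψ m.heap m.regs Γ

/-- `⊢ m ok` -/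
inductive MachineOk {k : ℕ} (sg : Sig) (Ξ : ℕ → Option (Ty k)) : State k → Prop
  | run {m Ψ Γ} : ConfOk sg Ξ Ψ Γ m → InstrOk sg Ξ m.ctx Γ m.instr → MachineOk sg Ξ (.run m)
  | read {m Ψ Γ ls J} : ConfOk sg Ξ Ψ Γ m → SpineOk sg Ξ m.ctx Γ m.instr J →
      Reads m.ctx Ψ ls J → MachineOk sg Ξ (.read m ls)
  | write {m Ψ Γ c l ls J} : ConfOk sg Ξ Ψ Γ m → SpineOk sg Ξ m.ctx Γ m.instr J →
      Writes sg Ψ ls l c J → MachineOk sg Ξ (.write m c l ls)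
  | twrite {m Ψ Γ r n ws τs₁ τs₂} : ConfOk sg Ξ Ψ Γ m →
      TupleOk sg Ξ m.ctx Γ m.instr τs₂ r (.tup (τs₁ ++ τs₂)) → τs₂.length = n →
      List.Forall₂ (fun w τ => WordTy sg Ξ m.ctx Ψ (w.msubst (readback m.heap)) τ ∧ w.Canon)
        ws τs₁ →
      MachineOk sg Ξ (.twrite m r n ws)

/-! ## Operational semantics -/

/-- Word evaluation, `w ⇓ w'` -/
inductive WordEval : Word → Word → Prop
  | cloc {l} : WordEval (.cloc l) (.cloc l)
  | hloc {l} : WordEval (.hloc l) (.hloc l)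
  | lam {A w w₁} (L : Finset ℕ) :
      (∀ x ∉ L, WordEval (w.inst 0 (.fv x)) (w₁.inst 0 (.fv x))) →
      WordEval (.lam A w) (.lam A w₁)
  | beta {w A w₁ M w₂} : WordEval w (.lam A w₁) → WordEval (w₁.inst 0 M) w₂ →
      WordEval (.app w M) w₂
  | app {w w₁ M} : WordEval w w₁ → w₁.Path → WordEval (.app w M) (.app w₁ M)

/-- Operand resolution: looks up the registers. -/
inductive OpResolve {k : ℕ} (R : Reg k → Option Word) : Op k → Word → Prop
  | cloc {l} : OpResolve R (.cloc l) (.cloc l)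
  | reg {r w} : R r = some w → OpResolve R (.reg r) w
  | app {op w M} : OpResolve R op w → OpResolve R (.app op M) (.app w M)
  | lam {A op w} : OpResolve R op w → OpResolve R (.lam A op) (.lam A w)

/-- Operand evaluation, `R ⊢ op ⇓ w` -/
def OpEval {k : ℕ} (R : Reg k → Option Word) (op : Op k) (w : Word) : Prop :=
  ∃ w₁, OpResolve R op w₁ ∧ WordEval w₁ w

/-- `end(S, ℓ) = ℓ'`: follows pointers. -/
inductive End (H : Heap) : ℕ → ℕ → Prop
  | free {l a} : H l = some (.free a) → End H l l
  | str {l c ls} : H l = some (.str c ls) → End H l l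
  | bound {l l₁ l₂} : H l = some (.bound l₁) → End H l₁ l₂ → End H l l₂

/-- Dynamic occurs check, `ℓ₁ ∈ ℓ₂` -/
inductive Occ (H : Heap) (l₁ : ℕ) : ℕ → Prop
  | eq : Occ H l₁ l₁
  | bound {l₂ l} : H l₂ = some (.bound l) → Occ H l₁ l → Occ H l₁ l₂
  | str {l₂ c ls l} : H l₂ = some (.str c ls) → l ∈ ls → Occ H l₁ l → Occ H l₁ l₂
  | tup {l₂ ws w l} : H l₂ = some (.tup ws) → w ∈ ws → w.loc = some l → Occ H l₁ l → Occ H l₁ l₂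
  | clos {l₂ w lc Ms l} : H l₂ = some (.clos w lc Ms) → w.loc = some l → Occ H l₁ l → Occ H l₁ l₂

/-- `ℓ₁ ∉ ℓ₂` -/
inductive NotOcc (H : Heap) (l₁ : ℕ) : ℕ → Prop
  | free {l₂ a} : l₁ ≠ l₂ → H l₂ = some (.free a) → NotOcc H l₁ l₂
  | bound {l₂ l} : l₁ ≠ l₂ → H l₂ = some (.bound l) → NotOcc H l₁ l → NotOcc H l₁ l₂
  | str {l₂ c ls} : l₁ ≠ l₂ → H l₂ = some (.str c ls) → (∀ l ∈ ls, NotOcc H l₁ l) → NotOcc H l₁ l₂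
  | tup {l₂ ws} : l₁ ≠ l₂ → H l₂ = some (.tup ws) →
      (∀ w ∈ ws, ∀ l, w.loc = some l → NotOcc H l₁ l) → NotOcc H l₁ l₂
  | clos {l₂ w lc Ms} : l₁ ≠ l₂ → H l₂ = some (.clos w lc Ms) →
      (∀ l, w.loc = some l → NotOcc H l₁ l) → NotOcc H l₁ l₂

/-- Binding a variable removes it from `Δ`; the types in the `Δ` of a machine state are constants,
so there is nothing to substitute in them. -/
def Ctx.remove (Δ : Ctx) (x : ℕ) : Ctx := Δ.filter (fun p => p.1 ≠ x)

/-- `H{ℓ ↦ v}` -/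
def Heap.set (H : Heap) (l : ℕ) (v : HVal) : Heap := Function.update H l (some v)

mutual
  /-- `unify(Δ, S, T, ℓ₁, ℓ₂) = (Δ', S', T')`, or `⊥`, which is `none`. -/
  inductive Unify : Ctx → Heap → Trail → ℕ → ℕ → Option (Ctx × Heap × Trail) → Prop
    | eq {Δ H T l₁ l₂ l} : End H l₁ l → End H l₂ l → Unify Δ H T l₁ l₂ (some (Δ, H, T))
    | freeR {Δ H T l₁ l₂ e₁ e₂ a} : End H l₁ e₁ → End H l₂ e₂ → H e₂ = some (.free a) →
        NotOcc H e₂ l₁ →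
        Unify Δ H T l₁ l₂ (some (Δ.remove e₂, Heap.set H e₂ (.bound l₁), uptrail e₂ a T))
    | freeL {Δ H T l₁ l₂ e₁ e₂ a} : End H l₁ e₁ → End H l₂ e₂ → H e₁ = some (.free a) →
        NotOcc H e₁ l₂ →
        Unify Δ H T l₁ l₂ (some (Δ.remove e₁, Heap.set H e₁ (.bound l₂), uptrail e₁ a T))
    | str {Δ H T l₁ l₂ e₁ e₂ c ls₁ ls₂ res} : End H l₁ e₁ → End H l₂ e₂ → e₁ ≠ e₂ →
        H e₁ = some (.str c ls₁) → H e₂ = some (.str c ls₂) →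
        UnifyArgs Δ H T ls₁ ls₂ res → Unify Δ H T l₁ l₂ res
    | occL {Δ H T l₁ l₂ e₁ e₂ a} : End H l₁ e₁ → End H l₂ e₂ → e₁ ≠ e₂ →
        H e₁ = some (.free a) → Occ H e₁ l₂ → Unify Δ H T l₁ l₂ none
    | occR {Δ H T l₁ l₂ e₁ e₂ a} : End H l₁ e₁ → End H l₂ e₂ → e₁ ≠ e₂ →
        H e₂ = some (.free a) → Occ H e₂ l₁ → Unify Δ H T l₁ l₂ none
    | clash {Δ H T l₁ l₂ e₁ e₂ c₁ c₂ ls₁ ls₂} : End H l₁ e₁ → End H l₂ e₂ →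
        H e₁ = some (.str c₁ ls₁) → H e₂ = some (.str c₂ ls₂) → c₁ ≠ c₂ →
        Unify Δ H T l₁ l₂ none
  inductive UnifyArgs : Ctx → Heap → Trail → List ℕ → List ℕ → Option (Ctx × Heap × Trail) → Prop
    | nil {Δ H T} : UnifyArgs Δ H T [] [] (some (Δ, H, T))
    | cons {Δ H T l₁ l₂ ls₁ ls₂ Δ₁ H₁ T₁ res} : Unify Δ H T l₁ l₂ (some (Δ₁, H₁, T₁)) →
        UnifyArgs Δ₁ H₁ T₁ ls₁ ls₂ res → UnifyArgs Δ H T (l₁ :: ls₁) (l₂ :: ls₂) res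
    | fail {Δ H T l₁ l₂ ls₁ ls₂} : Unify Δ H T l₁ l₂ none →
        UnifyArgs Δ H T (l₁ :: ls₁) (l₂ :: ls₂) none
end

/-- The register file `{env ↦ w}`. -/
def onlyEnv {k : ℕ} (w : Word) : Reg k → Option Word := Function.update (fun _ => none) Reg.env (some w)

/-- `R{r ↦ w}` -/
def setReg {k : ℕ} (R : Reg k → Option Word) (r : Reg k) (w : Word) : Reg k → Option Word :=
  Function.update R r (some w)

/-- Backtracking to the latest failure continuation. -/
inductive Backtrack {k : ℕ} : Conf k → State k → Prop
  | intro {m : Conf k} {F T Δ₁ H₁ v I} : m.trail = F :: T →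
      Unwind m.heap m.ctx F.bindings Δ₁ H₁ → m.code F.label = some v →
      v.instantiate F.args = some I →
      Backtrack m (.run { m with
        trail := T, ctx := Δ₁, heap := H₁, regs := onlyEnv F.env,
        instr := I.msubst (readback H₁) })

/-- One step of the machine, `m ⟶ m'`. -/
inductive Step {k : ℕ} (sg : Sig) : State k → State k → Prop
  | mov {m : Conf k} {rd op I w} : m.instr = .mov rd op I → OpEval m.regs op w →
      Step sg (.run m) (.run { m with regs := setReg m.regs rd w, instr := I })
  /-  Jumps and closures -/
  | jmpCode {m : Conf k} {op I l Ms v I₁} : m.instr = .jmp op I →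
      OpEval m.regs op ((Word.cloc l).apps Ms) → m.code l = some v → v.instantiate Ms = some I₁ →
      Step sg (.run m) (.run { m with instr := I₁.msubst (readback m.heap) })
  | jmpClos {m : Conf k} {op I l Ms w lc Ns v I₁} : m.instr = .jmp op I →
      OpEval m.regs op ((Word.hloc l).apps Ms) → m.heap l = some (.clos w lc Ns) →
      m.code lc = some v → v.instantiate (Ns ++ Ms) = some I₁ →
      Step sg (.run m) (.run { m with
        regs := setReg m.regs Reg.env w, instr := I₁.msubst (readback m.heap) })
  | close {m : Conf k} {rd re lc Ms I w l} : m.instr = .close rd re lc Ms I → m.regs re = some w →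
      m.heap l = none →
      Step sg (.run m) (.run { m with
        heap := m.heap.set l (.clos w lc Ms), regs := setReg m.regs rd (.hloc l), instr := I })
  | pushBt {m : Conf k} {re lc Ms I w} : m.instr = .pushBt re lc Ms I → m.regs re = some w →
      Step sg (.run m) (.run { m with trail := ⟨[], w, lc, Ms⟩ :: m.trail, instr := I })
  /-  Tuples -/
  | putTuple {m : Conf k} {rd n I} : m.instr = .putTuple rd n I →
      Step sg (.run m) (.twrite { m with instr := I } rd n [])
  | setVal {m : Conf k} {rd n ws rs I w} : m.instr = .setVal rs I → m.regs rs = some w →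
      Step sg (.twrite m rd (n + 1) ws) (.twrite { m with instr := I } rd n (ws ++ [w]))
  | tupleEnd {m : Conf k} {rd ws l} : m.heap l = none →
      Step sg (.twrite m rd 0 ws) (.run { m with
        heap := m.heap.set l (.tup ws), regs := setReg m.regs rd (.hloc l) })
  | proj {m : Conf k} {rd rs i I l ws w} : m.instr = .proj rd rs i I → m.regs rs = some (.hloc l) →
      m.heap l = some (.tup ws) → ws[i]? = some w →
      Step sg (.run m) (.run { m with regs := setReg m.regs rd w, instr := I })
  /-  Unification of two registers -/
  | getVal {m : Conf k} {r₁ r₂ I l₁ l₂ Δ₁ H₁ T₁} : m.instr = .getVal r₁ r₂ I →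
      m.regs r₁ = some (.hloc l₁) → m.regs r₂ = some (.hloc l₂) →
      Unify m.ctx m.heap m.trail l₁ l₂ (some (Δ₁, H₁, T₁)) →
      Step sg (.run m) (.run { m with
        trail := T₁, ctx := Δ₁, heap := H₁, instr := I.msubst (readback H₁) })
  | getValBt {m : Conf k} {r₁ r₂ I l₁ l₂ m₁} : m.instr = .getVal r₁ r₂ I →
      m.regs r₁ = some (.hloc l₁) → m.regs r₂ = some (.hloc l₂) →
      Unify m.ctx m.heap m.trail l₁ l₂ none → Backtrack m m₁ → Step sg (.run m) m₁
  /-  Term constructors -/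
  | putVar {m : Conf k} {r a I l} : m.instr = .putVar r a I → m.heap l = none →
      Step sg (.run m) (.run { m with
        ctx := (l, .fam a) :: m.ctx, heap := m.heap.set l (.free a),
        regs := setReg m.regs r (.hloc l), instr := I.inst 0 (.fv l) })
  | putStr {m : Conf k} {c r I l as a} : m.instr = .putStr c r I → sg.Ctor c as a →
      m.heap l = none →
      Step sg (.run m) (.write { m with
        ctx := (l, .fam a) :: m.ctx, heap := m.heap.set l (.free a),
        regs := setReg m.regs r (.hloc l), instr := I } c l [])
  | unifyVarW {m : Conf k} {c ld ls r a I l as b} : m.instr = .unifyVar r a I → sg.Ctor c as b →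
      ls.length < as.length → m.heap l = none →
      Step sg (.write m c ld ls) (.write { m with
        ctx := (l, .fam a) :: m.ctx, heap := m.heap.set l (.free a),
        regs := setReg m.regs r (.hloc l), instr := I.inst 0 (.fv l) } c ld (ls ++ [l]))
  | unifyValW {m : Conf k} {c ld ls r a I l as b} : m.instr = .unifyVal r a I → sg.Ctor c as b →
      ls.length < as.length → m.regs r = some (.hloc l) →
      Step sg (.write m c ld ls)
        (.write { m with instr := I.inst 0 (readback m.heap l) } c ld (ls ++ [l]))
  | writeEnd {m : Conf k} {c ld ls as b e a} : sg.Ctor c as b → ls.length = as.length →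
      End m.heap ld e → m.heap e = some (.free a) → (∀ l ∈ ls, NotOcc m.heap e l) →
      Step sg (.write m c ld ls) (.run { m with
        trail := uptrail e a m.trail, ctx := m.ctx.remove e, heap := m.heap.set e (.str c ls),
        instr := m.instr.msubst (readback (m.heap.set e (.str c ls))) })
  | writeBt {m : Conf k} {c ld ls as b e a l m₁} : sg.Ctor c as b → ls.length = as.length →
      End m.heap ld e → m.heap e = some (.free a) → l ∈ ls → Occ m.heap e l → Backtrack m m₁ →
      Step sg (.write m c ld ls) m₁
  /-  Term destructors -/
  | getStrW {m : Conf k} {c r I l e a} : m.instr = .getStr c r I → m.regs r = some (.hloc l) →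
      End m.heap l e → m.heap e = some (.free a) →
      Step sg (.run m) (.write { m with instr := I } c e [])
  | getStrR {m : Conf k} {c r I l e ls} : m.instr = .getStr c r I → m.regs r = some (.hloc l) →
      End m.heap l e → m.heap e = some (.str c ls) →
      Step sg (.run m) (.read { m with instr := I } ls)
  | getStrBt {m : Conf k} {c c₁ r I l e ls m₁} : m.instr = .getStr c r I →
      m.regs r = some (.hloc l) → End m.heap l e → m.heap e = some (.str c₁ ls) → c ≠ c₁ →
      Backtrack m m₁ → Step sg (.run m) m₁
  | unifyVarR {m : Conf k} {r a I l ls} : m.instr = .unifyVar r a I →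
      Step sg (.read m (l :: ls)) (.read { m with
        regs := setReg m.regs r (.hloc l), instr := I.inst 0 (readback m.heap l) } ls)
  | unifyValR {m : Conf k} {r a I l l₁ ls Δ₁ H₁ T₁} : m.instr = .unifyVal r a I →
      m.regs r = some (.hloc l₁) → Unify m.ctx m.heap m.trail l l₁ (some (Δ₁, H₁, T₁)) →
      Step sg (.read m (l :: ls)) (.read { m with
        trail := T₁, ctx := Δ₁, heap := H₁,
        instr := (I.inst 0 (readback m.heap l₁)).msubst (readback H₁) } ls)
  | unifyValBt {m : Conf k} {r a I l l₁ ls m₁} : m.instr = .unifyVal r a I →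
      m.regs r = some (.hloc l₁) → Unify m.ctx m.heap m.trail l l₁ none → Backtrack m m₁ →
      Step sg (.read m (l :: ls)) m₁
  | readEnd {m : Conf k} : Step sg (.read m []) (.run m)

/-- The state executes a `succeed` instruction. -/
inductive State.Done {k : ℕ} : State k → Prop
  | intro {m : Conf k} {M A I} : m.instr = .succeed M A I → State.Done (.run m)

end TWAM

/-!
The proof is by preservation of an invariant, `TWAM.Inv`, along machine steps.

The typing rules execute unification statically: at `get_val` and at the end of a structure the rest
of the block is typed under a most general unifier that is computed on the static terms. At run time
these terms have been instantiated further, and the machine computes unifiers of the instances. One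
way to relate the two would be to show that typing derivations are stable under substitution, which
requires most general unifiers to be transported along substitutions. The invariant avoids this: it
leaves the static derivation `Δ₀; Γ ⊢ I ok` of the current block untouched and records that the state
is an instance of it. There is a substitution `θ` from `Δ₀` to the current context `Δ`, the
instructions of the machine are `[θ]I`, and the registers have the types `[θ]Γ`.

At a unification step, `Unify.sound` says that the new heap amounts to a substitution `ρ`, its
`readback`, that equates the two instances, so that `ρ ∘ θ` unifies the static terms. Every unifier
absorbs a most general one (`SUnify.factor`): `(ρ ∘ θ) ∘ σ = ρ ∘ θ`. Hence the same `ρ ∘ θ` serves as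
the closing substitution for the derivation that continues under `σ`. If the static unification
fails, the terms have no unifier at all (`SFail.msubst_ne`), so the machine does not succeed either.
An instruction that binds a variable extends `θ` (`RegInv.open`); a jump starts over with the
derivation of the code block and the arguments of the call (`CodeOk.enter`).

The structure `Ext` describes how binding variables changes the heap: every location then encodes
the instance of its former term under the new readback, which is well typed over the new context.
Heap types, words and registers are transported along it by the substitution lemma of LF. On the
trail nothing needs to be transported, since recording a binding compensates for it
(`TrailInv.set_bound`), and fresh allocations only add to the heap.

When the machine reaches a `succeed`, its instruction is `succeed[[θ]M : [θ]A]` with `Δ₀ ⊢ M : A`, and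
the substitution lemma gives `Δ ⊢ [θ]M : [θ]A`.
-/

namespace TWAM

/-! ### Names and substitution in LF expressions -/

namespace LF

/-- The names that occur in an expression. -/
def fvs : LF → Finset ℕ
  | typ => ∅
  | fam _ => ∅
  | cst _ => ∅
  | bv _ => ∅
  | fv x => {x}
  | app M N => M.fvs ∪ N.fvs
  | lam A M => A.fvs ∪ M.fvs
  | pi A B => A.fvs ∪ B.fvs

theorem msubst_congr {θ θ₁ : ℕ → LF} {M : LF} (h : ∀ x ∈ M.fvs, θ x = θ₁ x) :
    M.msubst θ = M.msubst θ₁ := by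
  induction M <;> simp_all [msubst, fvs]

theorem msubst_fv (M : LF) : M.msubst fv = M := by
  induction M <;> simp_all [msubst]

theorem msubst_eq_self {θ : ℕ → LF} {M : LF} (h : ∀ x ∈ M.fvs, θ x = fv x) : M.msubst θ = M :=
  (msubst_congr h).trans (msubst_fv M)

theorem msubst_msubst (θ θ₁ : ℕ → LF) (M : LF) :
    (M.msubst θ).msubst θ₁ = M.msubst (fun x => (θ x).msubst θ₁) := by
  induction M <;> simp_all [msubst]

theorem mem_fvs_msubst {θ : ℕ → LF} {M : LF} {y : ℕ} :
    y ∈ (M.msubst θ).fvs ↔ ∃ x ∈ M.fvs, y ∈ (θ x).fvs := by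
  induction M <;> simp_all [msubst, fvs, or_and_right, exists_or]

theorem fvs_subset_fvs_inst (M : LF) (d : ℕ) (u : LF) : M.fvs ⊆ (M.inst d u).fvs := by
  induction M generalizing d <;> simp_all [inst, fvs] <;> grind

theorem inst_msubst {θ : ℕ → LF} (hθ : ∀ x, LC (θ x)) (M : LF) (d : ℕ) (u : LF) :
    (M.inst d u).msubst θ = (M.msubst θ).inst d (u.msubst θ) := by
  induction M generalizing d with
  | bv i => simp only [inst, msubst]; split <;> rfl
  | fv x => simp only [inst, msubst]; exact (hθ x d _).symm
  | _ => simp_all [inst, msubst]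

/-- Substituting for a fresh name after opening amounts to opening with the substituted term, even
if that term has dangling indices. -/
theorem open_msubst {θ : ℕ → LF} (hθ : ∀ x, LC (θ x)) {M : LF} {x : ℕ} (hx : x ∉ M.fvs) (d : ℕ)
    (u : LF) : (M.inst d (fv x)).msubst (Function.update θ x u) = (M.msubst θ).inst d u := by
  induction M generalizing d with
  | bv i => simp only [inst, msubst]; split <;> simp [msubst]
  | fv y =>
    have : y ≠ x := by simpa [fvs, eq_comm] using hx
    simp only [inst, msubst, Function.update_of_ne this]; exact (hθ y d _).symm
  | _ => simp_all [inst, msubst, fvs]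

/-- An index that is absent after another one has been instantiated was absent before. -/
theorem inst_core {M u v : LF} {i j : ℕ} (hij : i ≠ j) (h : (M.inst i v).inst j u = M.inst i v) :
    M.inst j u = M := by
  induction M generalizing i j with
  | bv n =>
    simp only [inst] at h ⊢
    split
    · subst n; simp only [hij.symm, if_false, inst, if_true] at h; exact h
    · rfl
  | app _ _ h₁ h₂ | lam _ _ h₁ h₂ | pi _ _ h₁ h₂ =>
    simp only [inst, app.injEq, lam.injEq, pi.injEq] at h ⊢
    exact ⟨h₁ (by omega) h.1, h₂ (by omega) h.2⟩
  | _ => rfl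

theorem LC.msubst {θ : ℕ → LF} (hθ : ∀ x, LC (θ x)) {M : LF} (hM : LC M) : LC (M.msubst θ) := by
  intro d u
  obtain ⟨y, hy⟩ := Infinite.exists_notMem_finset M.fvs
  rw [← open_msubst hθ hy, hM]
  exact msubst_congr fun x hx => Function.update_of_ne (by rintro rfl; exact hy hx) _ _

/-- A dangling index survives substitution, so its absence from an instance is its absence. -/
theorem inst_of_msubst {θ : ℕ → LF} {M : LF} {d : ℕ}
    (h : ∀ u, (M.msubst θ).inst d u = M.msubst θ) (u : LF) : M.inst d u = M := by
  induction M generalizing d with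
  | bv i =>
    by_cases hi : i = d
    · simpa [LF.msubst, inst, hi] using h typ
    · simp [inst, hi]
  | app _ _ h₁ h₂ | lam _ _ h₁ h₂ | pi _ _ h₁ h₂ =>
    simp only [LF.msubst, inst, app.injEq, lam.injEq, pi.injEq] at h ⊢
    exact ⟨h₁ fun u => (h u).1, h₂ fun u => (h u).2⟩
  | _ => rfl

theorem lc_fv (x : ℕ) : LC (fv x) := fun _ _ => rfl

theorem lc_update {θ : ℕ → LF} (hθ : ∀ x, LC (θ x)) {u : LF} (hu : LC u) (x : ℕ) :
    ∀ y, LC (Function.update θ x u y) := by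
  intro y
  by_cases h : y = x
  · subst h; simpa using hu
  · simpa [h] using hθ y

theorem LC.lam {A M : LF} {x : ℕ} (hA : LC A) (hM : LC (M.inst 0 (fv x))) : LC (lam A M) :=
  fun d u => by simp [inst, hA d u, inst_core (Nat.succ_ne_zero d).symm (hM (d + 1) u)]

theorem LC.pi {A M : LF} {x : ℕ} (hA : LC A) (hM : LC (M.inst 0 (fv x))) : LC (pi A M) :=
  fun d u => by simp [inst, hA d u, inst_core (Nat.succ_ne_zero d).symm (hM (d + 1) u)]

theorem LC.app {M N : LF} (hM : LC M) (hN : LC N) : LC (app M N) :=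
  fun d u => by simp [inst, hM d u, hN d u]

theorem BetaEq.msubst {M N : LF} (h : BetaEq M N) {θ : ℕ → LF} (hθ : ∀ x, LC (θ x)) :
    BetaEq (M.msubst θ) (N.msubst θ) := by
  induction h generalizing θ with
  | beta h₁ h₂ => rw [inst_msubst hθ]; exact .beta (h₁.msubst hθ) (h₂.msubst hθ)
  | refl => exact .refl
  | symm _ ih => exact (ih hθ).symm
  | trans _ _ ih₁ ih₂ => exact (ih₁ hθ).trans (ih₂ hθ)
  | app _ _ ih₁ ih₂ => exact .app (ih₁ hθ) (ih₂ hθ)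
  | @lam A A₁ M M₁ L _ _ ih₁ ih₂ =>
    refine .lam (L ∪ M.fvs ∪ M₁.fvs) (ih₁ hθ) fun x hx => ?_
    simp only [Finset.mem_union, not_or] at hx
    rw [← open_msubst hθ hx.1.2, ← open_msubst hθ hx.2]
    exact ih₂ x hx.1.1 (lc_update hθ (lc_fv x) x)
  | @pi A A₁ M M₁ L _ _ ih₁ ih₂ =>
    refine .pi (L ∪ M.fvs ∪ M₁.fvs) (ih₁ hθ) fun x hx => ?_
    simp only [Finset.mem_union, not_or] at hx
    rw [← open_msubst hθ hx.1.2, ← open_msubst hθ hx.2]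
    exact ih₂ x hx.1.1 (lc_update hθ (lc_fv x) x)

theorem apps_append (M : LF) (Ms Ns : List LF) : M.apps (Ms ++ Ns) = (M.apps Ms).apps Ns :=
  List.foldl_append

theorem apps_concat (M : LF) (Ms : List LF) (N : LF) : M.apps (Ms ++ [N]) = (M.apps Ms).app N :=
  apps_append M Ms [N]

theorem msubst_apps (θ : ℕ → LF) (M : LF) (Ms : List LF) :
    (M.apps Ms).msubst θ = (M.msubst θ).apps (Ms.map (msubst θ)) := by
  induction Ms generalizing M with
  | nil => rfl
  | cons N Ms ih => exact ih _

theorem inst_apps (M : LF) (Ms : List LF) (d : ℕ) (u : LF) :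
    (M.apps Ms).inst d u = (M.inst d u).apps (Ms.map fun N => N.inst d u) := by
  induction Ms generalizing M with
  | nil => rfl
  | cons N Ms ih => exact ih _

theorem mem_fvs_apps {M : LF} {Ms : List LF} {x : ℕ} :
    x ∈ (M.apps Ms).fvs ↔ x ∈ M.fvs ∨ ∃ N ∈ Ms, x ∈ N.fvs := by
  induction Ms generalizing M with
  | nil => simp [apps]
  | cons N Ms ih => exact ih.trans (by simp [fvs, or_assoc])

theorem cst_apps_inj {c c₁ : ℕ} {Ms Ns : List LF} (h : (cst c).apps Ms = (cst c₁).apps Ns) :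
    c = c₁ ∧ Ms = Ns := by
  induction Ms using List.reverseRecOn generalizing Ns with
  | nil =>
    cases Ns using List.reverseRecOn with
    | nil => simpa [apps] using h
    | append_singleton Ns N => rw [apps_concat] at h; cases h
  | append_singleton Ms M ih =>
    cases Ns using List.reverseRecOn with
    | nil => rw [apps_concat] at h; cases h
    | append_singleton Ns N =>
      rw [apps_concat, apps_concat] at h
      injection h with h₁ h₂
      obtain ⟨rfl, rfl⟩ := ih h₁
      exact ⟨rfl, by rw [h₂]⟩

theorem cst_apps_ne_fv {c x : ℕ} {Ms : List LF} : (cst c).apps Ms ≠ fv x := by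
  cases Ms using List.reverseRecOn with
  | nil => rintro ⟨⟩
  | append_singleton Ms M => rw [apps_concat]; rintro ⟨⟩

/-- The number of nodes of an expression. -/
def nodes : LF → ℕ
  | app M N | lam M N | pi M N => M.nodes + N.nodes + 1
  | _ => 1

theorem nodes_lt_nodes_apps {M N : LF} {Ms : List LF} (h : N ∈ Ms) : N.nodes < (M.apps Ms).nodes := by
  have mono : ∀ (Ns : List LF) (P : LF), P.nodes ≤ (P.apps Ns).nodes := by
    intro Ns
    induction Ns with
    | nil => intro P; exact le_rfl
    | cons Q Ns ih => exact fun P => le_trans (by simp only [nodes]; omega) (ih (P.app Q))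
  induction Ms generalizing M with
  | nil => cases h
  | cons Q Ms ih =>
    rcases List.mem_cons.1 h with rfl | h
    · exact lt_of_lt_of_le (by simp only [nodes]; omega) (mono Ms (M.app N))
    · exact ih h

end LF

/-! ### Objects with LF expressions under binders -/

/-- Objects that contain LF expressions under binders.  `map f d` applies `f` to every LF
expression of an object that lies under `d` binders, and it depends on `f` only at expressions
whose names belong to a finite set. -/
class Binding (T : Type) where
  map : (ℕ → LF → LF) → ℕ → T → T
  map_map : ∀ f g d t, map g d (map f d t) = map (fun i M => g i (f i M)) d t
  map_const : ∀ (f : LF → LF) d e t, map (fun _ => f) d t = map (fun _ => f) e t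
  map_id : ∀ d t, map (fun _ M => M) d t = t
  exists_supp : ∀ t, ∃ L : Finset ℕ, ∀ f g d, (∀ i M, M.fvs ⊆ L → f i M = g i M) →
    map f d t = map g d t

namespace Binding

variable {T : Type} [Binding T]

/-- A finite set that contains all names of an object. -/
noncomputable def supp (t : T) : Finset ℕ := (exists_supp t).choose

theorem map_congr {t : T} {f g : ℕ → LF → LF} {d : ℕ}
    (h : ∀ i M, M.fvs ⊆ supp t → f i M = g i M) : map f d t = map g d t :=
  (exists_supp t).choose_spec f g d h

/-- Puts `u` for the variable bound `d` binders further out. -/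
def inst (t : T) (d : ℕ) (u : LF) : T := map (fun i M => M.inst i u) d t

/-- Simultaneous substitution for names. -/
def msubst (t : T) (θ : ℕ → LF) : T := map (fun _ M => M.msubst θ) 0 t

theorem msubst_fv (t : T) : msubst t .fv = t := by
  simp only [msubst, LF.msubst_fv, map_id]

theorem msubst_msubst (t : T) (θ θ₁ : ℕ → LF) :
    msubst (msubst t θ) θ₁ = msubst t (fun x => (θ x).msubst θ₁) := by
  simp only [msubst, map_map, LF.msubst_msubst]

theorem msubst_congr {t : T} {θ θ₁ : ℕ → LF} (h : ∀ x ∈ supp t, θ x = θ₁ x) :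
    msubst t θ = msubst t θ₁ :=
  map_congr fun _ _ hM => LF.msubst_congr fun x hx => h x (hM hx)

theorem msubst_update {t : T} {x : ℕ} (hx : x ∉ supp t) (θ : ℕ → LF) (u : LF) :
    msubst t (Function.update θ x u) = msubst t θ :=
  msubst_congr fun y hy => Function.update_of_ne (by rintro rfl; exact hx hy) _ _

theorem inst_msubst {θ : ℕ → LF} (hθ : ∀ x, LF.LC (θ x)) (t : T) (d : ℕ) (u : LF) :
    msubst (inst t d u) θ = inst (msubst t θ) d (u.msubst θ) := by
  simp only [msubst, inst]
  rw [map_const _ 0 d, map_const _ 0 d, map_map, map_map]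
  simp only [LF.inst_msubst hθ]

theorem open_msubst {θ : ℕ → LF} (hθ : ∀ x, LF.LC (θ x)) {t : T} {x : ℕ} (hx : x ∉ supp t) (d : ℕ)
    (u : LF) : msubst (inst t d (.fv x)) (Function.update θ x u) = inst (msubst t θ) d u := by
  simp only [msubst, inst]
  rw [map_const _ 0 d, map_const _ 0 d, map_map, map_map]
  exact map_congr fun i M hM => LF.open_msubst hθ (fun h => hx (hM h)) i u

/-- Substitution preserves the absence of dangling indices. -/
theorem inst_msubst_of_inst {θ : ℕ → LF} (hθ : ∀ x, LF.LC (θ x)) {t : T}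
    (ht : ∀ d u, inst t d u = t) (d : ℕ) (u : LF) : inst (msubst t θ) d u = msubst t θ := by
  obtain ⟨y, hy⟩ := Infinite.exists_notMem_finset (supp t)
  rw [← open_msubst hθ hy, ht, msubst_update hy]

end Binding

/-! ### The syntax of the machine as objects with LF expressions -/

section Instances

variable {k : ℕ}

/-- Structural induction on types, with the hypotheses for the components of register file types
and tuple types stated by membership. -/
theorem Ty.induct {P : Ty k → Prop} (sing : ∀ M a, P (.sing M a)) (pi : ∀ A τ, P τ → P (.pi A τ))
    (neg : ∀ Γ : RTy k, (∀ r τ, Γ r = some τ → P τ) → P (.neg Γ))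
    (tup : ∀ τs : List (Ty k), (∀ τ ∈ τs, P τ) → P (.tup τs)) (τ : Ty k) : P τ :=
  Ty.rec (motive_1 := P) (motive_2 := fun o => ∀ τ, o = some τ → P τ)
    (motive_3 := fun τs => ∀ τ ∈ τs, P τ) sing pi (fun Γ ih => neg Γ ih) (fun τs ih => tup τs ih)
    (fun _ h => nomatch h) (fun τ ih _ h => Option.some.inj h ▸ ih) (fun _ h => nomatch h)
    (fun τ τs ih ihs _ h => by
      rcases List.mem_cons.1 h with rfl | h
      · exact ih
      · exact ihs _ h) τ

theorem Ty.mapOption_eq (f : ℕ → LF → LF) (d : ℕ) (o : Option (Ty k)) :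
    Ty.mapOption f d o = o.map (Ty.map f d) := by
  cases o <;> simp [Ty.mapOption]

theorem Ty.mapList_eq (f : ℕ → LF → LF) (d : ℕ) (τs : List (Ty k)) :
    Ty.mapList f d τs = τs.map (Ty.map f d) := by
  induction τs <;> simp_all [Ty.mapList]

theorem Ty.map_neg (f : ℕ → LF → LF) (d : ℕ) (Γ : RTy k) :
    Ty.map f d (.neg Γ) = .neg fun r => (Γ r).map (Ty.map f d) := by
  simp [Ty.map, Ty.mapOption_eq]

theorem Ty.map_tup (f : ℕ → LF → LF) (d : ℕ) (τs : List (Ty k)) :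
    Ty.map f d (.tup τs) = .tup (τs.map (Ty.map f d)) := by
  simp [Ty.map, Ty.mapList_eq]

theorem Ty.exists_supp (τ : Ty k) : ∃ L : Finset ℕ, ∀ f g d,
    (∀ i M, M.fvs ⊆ L → f i M = g i M) → Ty.map f d τ = Ty.map g d τ := by
  induction τ using Ty.induct with
  | sing M a => exact ⟨M.fvs, fun f g d h => by simp [Ty.map, h]⟩
  | pi A τ ih =>
    obtain ⟨L, hL⟩ := ih
    refine ⟨A.fvs ∪ L, fun f g d h => ?_⟩
    simp only [Ty.map, h _ A Finset.subset_union_left,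
      hL f g (d + 1) fun i M hM => h i M (hM.trans Finset.subset_union_right)]
  | neg Γ ih =>
    have : ∀ r, ∃ L : Finset ℕ, ∀ τ, Γ r = some τ → ∀ f g d,
        (∀ i M, M.fvs ⊆ L → f i M = g i M) → Ty.map f d τ = Ty.map g d τ := by
      intro r
      cases h : Γ r with
      | none => exact ⟨∅, fun _ h => nomatch h⟩
      | some τ => exact (ih r τ h).imp fun L hL τ' e => Option.some.inj e ▸ hL
    choose L hL using this
    refine ⟨Finset.univ.biUnion L, fun f g d h => ?_⟩
    rw [Ty.map_neg, Ty.map_neg]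
    congr 1
    funext r
    exact Option.map_congr fun τ e => hL r τ e f g d fun i M hM =>
      h i M (hM.trans (Finset.subset_biUnion_of_mem L (Finset.mem_univ r)))
  | tup τs ih =>
    have : ∃ L : Finset ℕ, ∀ τ ∈ τs, ∀ f g d,
        (∀ i M, M.fvs ⊆ L → f i M = g i M) → Ty.map f d τ = Ty.map g d τ := by
      induction τs with
      | nil => exact ⟨∅, by simp⟩
      | cons τ τs ihs =>
        obtain ⟨L₁, h₁⟩ := ih τ (by simp)
        obtain ⟨L₂, h₂⟩ := ihs fun τ h => ih τ (by simp [h])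
        refine ⟨L₁ ∪ L₂, fun τ' h' f g d h => ?_⟩
        rcases List.mem_cons.1 h' with rfl | h'
        · exact h₁ f g d fun i M hM => h i M (hM.trans Finset.subset_union_left)
        · exact h₂ τ' h' f g d fun i M hM => h i M (hM.trans Finset.subset_union_right)
    obtain ⟨L, hL⟩ := this
    refine ⟨L, fun f g d h => ?_⟩
    rw [Ty.map_tup, Ty.map_tup]
    exact congrArg _ (List.map_congr_left fun τ e => hL τ e f g d h)

instance : Binding (Ty k) where
  map := Ty.map
  map_map f g d τ := by
    induction τ using Ty.induct generalizing d with
    | sing M a => rfl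
    | pi A τ ih => simp only [Ty.map, ih]
    | neg Γ ih =>
      simp only [Ty.map_neg, Option.map_map]
      congr 1; funext r; exact Option.map_congr fun τ e => ih r τ e d
    | tup τs ih =>
      simp only [Ty.map_tup, List.map_map]
      exact congrArg _ (List.map_congr_left fun τ e => ih τ e d)
  map_const f d e τ := by
    induction τ using Ty.induct generalizing d e with
    | sing M a => rfl
    | pi A τ ih => simp only [Ty.map, ih (d + 1) (e + 1)]
    | neg Γ ih =>
      simp only [Ty.map_neg]
      congr 1; funext r; exact Option.map_congr fun τ h => ih r τ h d e
    | tup τs ih =>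
      simp only [Ty.map_tup]
      exact congrArg _ (List.map_congr_left fun τ h => ih τ h d e)
  map_id d τ := by
    induction τ using Ty.induct generalizing d with
    | sing M a => rfl
    | pi A τ ih => simp only [Ty.map, ih]
    | neg Γ ih =>
      rw [Ty.map_neg]
      congr 1; funext r
      exact (Option.map_congr (g := id) fun τ e => ih r τ e d).trans (by simp)
    | tup τs ih =>
      rw [Ty.map_tup]
      exact congrArg _ ((List.map_congr_left (g := id) fun τ e => ih τ e d).trans (by simp))
  exists_supp := Ty.exists_supp

/-- Two operations agree on the expressions whose names belong to `L`. -/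
def AgreeOn (f g : ℕ → LF → LF) (L : Finset ℕ) : Prop := ∀ i M, M.fvs ⊆ L → f i M = g i M

theorem AgreeOn.mono {f g : ℕ → LF → LF} {L L₁ : Finset ℕ} (h : AgreeOn f g L) (hL : L₁ ⊆ L) :
    AgreeOn f g L₁ := fun i M hM => h i M (hM.trans hL)

theorem AgreeOn.left {f g : ℕ → LF → LF} {L L₁ : Finset ℕ} (h : AgreeOn f g (L ∪ L₁)) :
    AgreeOn f g L := h.mono Finset.subset_union_left

theorem AgreeOn.right {f g : ℕ → LF → LF} {L L₁ : Finset ℕ} (h : AgreeOn f g (L ∪ L₁)) :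
    AgreeOn f g L₁ := h.mono Finset.subset_union_right

theorem AgreeOn.eq {f g : ℕ → LF → LF} {M : LF} (h : AgreeOn f g M.fvs) (i : ℕ) : f i M = g i M :=
  h i M subset_rfl

/-- The names that occur in a list of expressions. -/
def LF.fvsList : List LF → Finset ℕ
  | [] => ∅
  | M :: Ms => M.fvs ∪ LF.fvsList Ms

theorem LF.mem_fvsList {Ms : List LF} {x : ℕ} : x ∈ LF.fvsList Ms ↔ ∃ M ∈ Ms, x ∈ M.fvs := by
  induction Ms <;> simp_all [LF.fvsList]

theorem AgreeOn.list {f g : ℕ → LF → LF} {Ms : List LF} (h : AgreeOn f g (LF.fvsList Ms)) (i : ℕ) :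
    Ms.map (f i) = Ms.map (g i) :=
  List.map_congr_left fun M hM =>
    h i M fun _ hx => LF.mem_fvsList.2 ⟨M, hM, hx⟩

/-- The names that occur in a word. -/
def Word.fvs : Word → Finset ℕ
  | .cloc _ => ∅
  | .hloc _ => ∅
  | .app w M => w.fvs ∪ M.fvs
  | .lam A w => A.fvs ∪ w.fvs

theorem Word.map_congr {f g : ℕ → LF → LF} {w : Word} (h : AgreeOn f g w.fvs) (d : ℕ) :
    w.map f d = w.map g d := by
  induction w generalizing d with
  | app w M ih => simp only [Word.map, ih h.left, h.right.eq]
  | lam A w ih => simp only [Word.map, ih h.right, h.left.eq]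
  | _ => rfl

instance : Binding Word where
  map := Word.map
  map_map f g d w := by induction w generalizing d <;> simp_all [Word.map]
  map_const f d e w := by
    induction w generalizing d e with
    | app w M ih => simp only [Word.map, ih d e]
    | lam A w ih => simp only [Word.map, ih (d + 1) (e + 1)]
    | _ => rfl
  map_id d w := by induction w generalizing d <;> simp_all [Word.map]
  exists_supp w := ⟨w.fvs, fun _ _ d h => Word.map_congr h d⟩

/-- The names that occur in an operand. -/
def Op.fvs : Op k → Finset ℕ
  | .cloc _ => ∅
  | .reg _ => ∅
  | .app op M => op.fvs ∪ M.fvs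
  | .lam A op => A.fvs ∪ op.fvs

theorem Op.map_congr {f g : ℕ → LF → LF} {op : Op k} (h : AgreeOn f g op.fvs) (d : ℕ) :
    op.map f d = op.map g d := by
  induction op generalizing d with
  | app w M ih => simp only [Op.map, ih h.left, h.right.eq]
  | lam A w ih => simp only [Op.map, ih h.right, h.left.eq]
  | _ => rfl

theorem Op.map_const (f : LF → LF) (d e : ℕ) (op : Op k) :
    op.map (fun _ => f) d = op.map (fun _ => f) e := by
  induction op generalizing d e with
  | app w M ih => simp only [Op.map, ih d e]
  | lam A w ih => simp only [Op.map, ih (d + 1) (e + 1)]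
  | _ => rfl

theorem Op.map_map (f g : ℕ → LF → LF) (d : ℕ) (op : Op k) :
    (op.map f d).map g d = op.map (fun i M => g i (f i M)) d := by
  induction op generalizing d <;> simp_all [Op.map]

theorem Op.map_id (d : ℕ) (op : Op k) : op.map (fun _ M => M) d = op := by
  induction op generalizing d <;> simp_all [Op.map]

instance : Binding (Op k) where
  map := Op.map
  map_map := Op.map_map
  map_const := Op.map_const
  map_id := Op.map_id
  exists_supp op := ⟨op.fvs, fun _ _ d h => Op.map_congr h d⟩

/-- The names that occur in an instruction sequence. -/
def Instr.fvs : Instr k → Finset ℕ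
  | .nil => ∅
  | .succeed M A I => (M.fvs ∪ A.fvs) ∪ I.fvs
  | .jmp op I | .mov _ op I => op.fvs ∪ I.fvs
  | .pushBt _ _ Ms I | .close _ _ _ Ms I => LF.fvsList Ms ∪ I.fvs
  | .putVar _ _ I | .getVal _ _ I | .putTuple _ _ I | .setVal _ I | .proj _ _ _ I | .putStr _ _ I
  | .getStr _ _ I | .unifyVar _ _ I | .unifyVal _ _ I => I.fvs

theorem Instr.map_congr {f g : ℕ → LF → LF} {I : Instr k} (h : AgreeOn f g I.fvs) (d : ℕ) :
    I.map f d = I.map g d := by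
  induction I generalizing d with
  | nil => rfl
  | succeed M A I ih => simp only [Instr.map, h.left.left.eq, h.left.right.eq, ih h.right]
  | jmp op I ih | mov _ op I ih => simp only [Instr.map, Op.map_congr h.left, ih h.right]
  | pushBt _ _ Ms I ih | close _ _ _ Ms I ih => simp only [Instr.map, h.left.list, ih h.right]
  | _ => rename_i ih; simp only [Instr.map, ih h]

instance : Binding (Instr k) where
  map := Instr.map
  map_map f g d I := by
    induction I generalizing d <;> simp_all [Instr.map, Op.map_map]
  map_const f d e I := by
    induction I generalizing d e with
    | nil => rfl
    | putVar _ _ I ih | unifyVar _ _ I ih | unifyVal _ _ I ih =>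
      simp only [Instr.map, ih (d + 1) (e + 1)]
    | _ => rename_i ih; simp only [Instr.map, ih d e, Op.map_const f d e]
  map_id d I := by
    induction I generalizing d <;> simp_all [Instr.map, Op.map_id]
  exists_supp I := ⟨I.fvs, fun _ _ d h => Instr.map_congr h d⟩

instance : Binding (Code k) where
  map := Code.map
  map_map f g d v := by
    induction v generalizing d with
    | body Γ I =>
      simp only [Code.map]
      congr 1
      · have := Binding.map_map f g d (Ty.neg Γ)
        exact Ty.neg.inj this
      · exact Binding.map_map f g d I
    | lam A v ih => simp only [Code.map, ih]
  map_const f d e v := by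
    induction v generalizing d e with
    | body Γ I =>
      simp only [Code.map]
      congr 1
      · exact Ty.neg.inj (Binding.map_const f d e (Ty.neg Γ))
      · exact Binding.map_const f d e I
    | lam A v ih => simp only [Code.map, ih (d + 1) (e + 1)]
  map_id d v := by
    induction v generalizing d with
    | body Γ I =>
      simp only [Code.map]
      congr 1
      · exact Ty.neg.inj (Binding.map_id d (Ty.neg Γ))
      · exact Binding.map_id d I
    | lam A v ih => simp only [Code.map, ih]
  exists_supp v := by
    induction v with
    | body Γ I =>
      refine ⟨Binding.supp (Ty.neg Γ) ∪ I.fvs, fun f g d h => ?_⟩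
      simp only [Code.map]
      congr 1
      · exact Ty.neg.inj (Binding.map_congr (AgreeOn.left h))
      · exact Instr.map_congr (AgreeOn.right h) d
    | lam A v ih =>
      obtain ⟨L, hL⟩ := ih
      refine ⟨A.fvs ∪ L, fun f g d h => ?_⟩
      simp only [Code.map, (AgreeOn.left h).eq, hL f g _ (AgreeOn.right h)]

instance : Binding Spine where
  map := Spine.map
  map_map f g d J := by induction J generalizing d <;> simp_all [Spine.map]
  map_const f d e J := by
    induction J generalizing d e with
    | unif M N => rfl
    | pi a J ih => simp only [Spine.map, ih (d + 1) (e + 1)]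
  map_id d J := by induction J generalizing d <;> simp_all [Spine.map]
  exists_supp J := by
    induction J with
    | unif M N =>
      exact ⟨M.fvs ∪ N.fvs, fun f g d h => by
        simp only [Spine.map, (AgreeOn.left h).eq, (AgreeOn.right h).eq]⟩
    | pi a J ih =>
      obtain ⟨L, hL⟩ := ih
      exact ⟨L, fun f g d h => by simp only [Spine.map, hL f g _ h]⟩

end Instances

/-! ### Metatheory of LF: weakening and substitution -/

theorem LF.msubst_update {M : LF} {x : ℕ} (hx : x ∉ M.fvs) (θ : ℕ → LF) (u : LF) :
    M.msubst (Function.update θ x u) = M.msubst θ :=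
  LF.msubst_congr fun y hy => Function.update_of_ne (by rintro rfl; exact hx hy) _ _

/-- All names in a context: those declared and those in their types. -/
def Ctx.names : Ctx → Finset ℕ
  | [] => ∅
  | (x, A) :: Δ => ({x} ∪ A.fvs) ∪ Ctx.names Δ

theorem Ctx.mem_names {Δ : Ctx} {x : ℕ} {A : LF} (h : (x, A) ∈ Δ) :
    x ∈ Ctx.names Δ ∧ A.fvs ⊆ Ctx.names Δ := by
  induction Δ with
  | nil => cases h
  | cons p Δ ih =>
    rcases List.mem_cons.1 h with rfl | h
    · refine ⟨by simp [Ctx.names], fun y hy => ?_⟩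
      simp [Ctx.names, hy]
    · obtain ⟨h₁, h₂⟩ := ih h
      exact ⟨Finset.mem_union_right _ h₁, h₂.trans Finset.subset_union_right⟩

mutual
  theorem HasType.weaken {sg : Sig} {Δ : Ctx} {M A : LF} (h : HasType sg Δ M A) :
      ∀ {Δ₁ : Ctx}, Δ ⊆ Δ₁ → HasType sg Δ₁ M A :=
    match h with
    | .var h => fun hΔ => .var (hΔ h)
    | .cst h => fun _ => .cst h
    | .app h₁ h₂ => fun hΔ => .app (h₁.weaken hΔ) (h₂.weaken hΔ)
    | .lam L h₁ h₂ => fun hΔ => .lam L (h₁.weaken hΔ) fun x hx =>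
        (h₂ x hx).weaken (List.cons_subset_cons _ hΔ)
    | .conv h₁ h₂ hb => fun hΔ => .conv (h₁.weaken hΔ) (h₂.weaken hΔ) hb
  theorem HasKind.weaken {sg : Sig} {Δ : Ctx} {A K : LF} (h : HasKind sg Δ A K) :
      ∀ {Δ₁ : Ctx}, Δ ⊆ Δ₁ → HasKind sg Δ₁ A K :=
    match h with
    | .ptype h => fun _ => .ptype h
    | .fam h => fun _ => .fam h
    | .pi L h₁ h₂ => fun hΔ => .pi L (h₁.weaken hΔ) fun x hx =>
        (h₂ x hx).weaken (List.cons_subset_cons _ hΔ)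
    | .app h₁ h₂ => fun hΔ => .app (h₁.weaken hΔ) (h₂.weaken hΔ)
    | .conv h₁ h₂ hb => fun hΔ => .conv (h₁.weaken hΔ) (h₂.weaken hΔ) hb
  theorem IsKind.weaken {sg : Sig} {Δ : Ctx} {K : LF} (h : IsKind sg Δ K) :
      ∀ {Δ₁ : Ctx}, Δ ⊆ Δ₁ → IsKind sg Δ₁ K :=
    match h with
    | .typ => fun _ => .typ
    | .pi L h₁ h₂ => fun hΔ => .pi L (h₁.weaken hΔ) fun x hx =>
        (h₂ x hx).weaken (List.cons_subset_cons _ hΔ)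
end

/-- The names in `M` are declared in `Δ`, and `M` has no dangling index. -/
def Scoped (Δ : Ctx) (M : LF) : Prop := (∀ x ∈ M.fvs, ∃ A, (x, A) ∈ Δ) ∧ M.LC

theorem declared_of_open {Δ : Ctx} {A M : LF} {L : Finset ℕ}
    (h : ∀ x ∉ L, Scoped ((x, A) :: Δ) (M.inst 0 (.fv x))) : ∀ y ∈ M.fvs, ∃ B, (y, B) ∈ Δ := by
  intro y hy
  obtain ⟨x, hx⟩ := Infinite.exists_notMem_finset (L ∪ M.fvs)
  simp only [Finset.mem_union, not_or] at hx
  obtain ⟨B, hB⟩ := (h x hx.1).1 y (LF.fvs_subset_fvs_inst _ _ _ hy)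
  rcases List.mem_cons.1 hB with e | hB
  · cases e; exact absurd hy hx.2
  · exact ⟨B, hB⟩

theorem Scoped.lam {Δ : Ctx} {A M : LF} {L : Finset ℕ} (hA : Scoped Δ A)
    (h : ∀ x ∉ L, Scoped ((x, A) :: Δ) (M.inst 0 (.fv x))) : Scoped Δ (.lam A M) := by
  obtain ⟨x, hx⟩ := Infinite.exists_notMem_finset L
  refine ⟨fun y hy => ?_, hA.2.lam (h x hx).2⟩
  rcases Finset.mem_union.1 hy with hy | hy
  exacts [hA.1 y hy, declared_of_open h y hy]

theorem Scoped.pi {Δ : Ctx} {A M : LF} {L : Finset ℕ} (hA : Scoped Δ A)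
    (h : ∀ x ∉ L, Scoped ((x, A) :: Δ) (M.inst 0 (.fv x))) : Scoped Δ (.pi A M) := by
  obtain ⟨x, hx⟩ := Infinite.exists_notMem_finset L
  refine ⟨fun y hy => ?_, hA.2.pi (h x hx).2⟩
  rcases Finset.mem_union.1 hy with hy | hy
  exacts [hA.1 y hy, declared_of_open h y hy]

theorem Scoped.app {Δ : Ctx} {M N : LF} (hM : Scoped Δ M) (hN : Scoped Δ N) :
    Scoped Δ (.app M N) := by
  refine ⟨fun y hy => ?_, hM.2.app hN.2⟩
  rcases Finset.mem_union.1 hy with hy | hy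
  exacts [hM.1 y hy, hN.1 y hy]

theorem scoped_of_fvs_eq_empty {Δ : Ctx} {M : LF} (hM : M.fvs = ∅) (h : M.LC) : Scoped Δ M :=
  ⟨by simp [hM], h⟩

mutual
  theorem HasType.scoped {sg : Sig} {Δ : Ctx} {M A : LF} (h : HasType sg Δ M A) : Scoped Δ M :=
    match h with
    | .var h => ⟨fun y hy => by cases Finset.mem_singleton.1 hy; exact ⟨_, h⟩, LF.lc_fv _⟩
    | .cst h => scoped_of_fvs_eq_empty rfl fun _ _ => rfl
    | .app h₁ h₂ => h₁.scoped.app h₂.scoped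
    | .lam _ h₁ h₂ => h₁.scoped.lam fun x hx => (h₂ x hx).scoped
    | .conv h₁ _ _ => h₁.scoped
  theorem HasKind.scoped {sg : Sig} {Δ : Ctx} {A K : LF} (h : HasKind sg Δ A K) : Scoped Δ A :=
    match h with
    | .ptype h => scoped_of_fvs_eq_empty rfl fun _ _ => rfl
    | .fam h => scoped_of_fvs_eq_empty rfl fun _ _ => rfl
    | .pi _ h₁ h₂ => h₁.scoped.pi fun x hx => (h₂ x hx).scoped
    | .app h₁ h₂ => h₁.scoped.app h₂.scoped
    | .conv h₁ _ _ => h₁.scoped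
  theorem IsKind.scoped {sg : Sig} {Δ : Ctx} {K : LF} (h : IsKind sg Δ K) : Scoped Δ K :=
    match h with
    | .typ => scoped_of_fvs_eq_empty rfl fun _ _ => rfl
    | .pi _ h₁ h₂ => h₁.scoped.pi fun x hx => (h₂ x hx).scoped
end

theorem Scoped.fvs_eq_empty {M : LF} (h : Scoped [] M) : M.fvs = ∅ :=
  Finset.eq_empty_of_forall_notMem fun x hx => by simpa using h.1 x hx

theorem Sig.Valid.fvs_cst {sg : Sig} (h : sg.Valid) {c : ℕ} {A : LF} (hc : Decl.cst c A ∈ sg) :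
    A.fvs = ∅ := by
  induction h with
  | nil => cases hc
  | ptype _ _ ih => exact ih (by simpa using hc)
  | fam _ _ _ ih => exact ih (by simpa using hc)
  | cst _ _ hA ih =>
    rcases List.mem_cons.1 hc with e | hc
    · cases e; exact hA.scoped.fvs_eq_empty
    · exact ih hc

theorem Sig.Valid.fvs_fam {sg : Sig} (h : sg.Valid) {p : ℕ} {K : LF} (hp : Decl.fam p K ∈ sg) :
    K.fvs = ∅ := by
  induction h with
  | nil => cases hp
  | ptype _ _ ih => exact ih (by simpa using hp)
  | cst _ _ _ ih => exact ih (by simpa using hp)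
  | fam _ _ hK ih =>
    rcases List.mem_cons.1 hp with e | hp
    · cases e; exact hK.scoped.fvs_eq_empty
    · exact ih hp

theorem Sig.Valid.cst_unique {sg : Sig} (h : sg.Valid) {c : ℕ} {A B : LF}
    (hA : Decl.cst c A ∈ sg) (hB : Decl.cst c B ∈ sg) : A = B := by
  induction h with
  | nil => cases hA
  | ptype _ _ ih | fam _ _ _ ih => exact ih (by simpa using hA) (by simpa using hB)
  | cst _ hn _ ih =>
    rcases List.mem_cons.1 hA with e₁ | hA₁ <;> rcases List.mem_cons.1 hB with e₂ | hB₁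
    · cases e₁; cases e₂; rfl
    · cases e₁; exact absurd ⟨_, hB₁⟩ hn
    · cases e₂; exact absurd ⟨_, hA₁⟩ hn
    · exact ih hA₁ hB₁

theorem LF.arrows_inj {as bs : List ℕ} {a b : ℕ} (h : arrows as a = arrows bs b) :
    as = bs ∧ a = b := by
  induction as generalizing bs with
  | nil =>
    cases bs with
    | nil => exact ⟨rfl, fam.inj h⟩
    | cons => cases h
  | cons x as ih =>
    cases bs with
    | nil => cases h
    | cons y bs =>
      injection h with h₁ h₂
      injection h₁ with h₁
      obtain ⟨h₂, h₃⟩ := ih h₂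
      exact ⟨by rw [h₁, h₂], h₃⟩

theorem Sig.Ctor.unique {sg : Sig} (hsg : sg.Valid) {c : ℕ} {as bs : List ℕ} {a b : ℕ}
    (h₁ : sg.Ctor c as a) (h₂ : sg.Ctor c bs b) : as = bs ∧ a = b :=
  LF.arrows_inj (hsg.cst_unique h₁.1 h₂.1)

/-- `θ` maps the names of `Δ` to terms over `Δ₁` of the corresponding types.  All values are
required to be free of dangling indices, so that substitution commutes with opening. -/
structure SubOk (sg : Sig) (Δ : Ctx) (θ : ℕ → LF) (Δ₁ : Ctx) : Prop where
  lc : ∀ x, (θ x).LC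
  hasType : ∀ {x A}, (x, A) ∈ Δ → HasType sg Δ₁ (θ x) (A.msubst θ)

theorem SubOk.id (sg : Sig) {Δ Δ₁ : Ctx} (hΔ : Δ ⊆ Δ₁) : SubOk sg Δ .fv Δ₁ :=
  ⟨LF.lc_fv, fun h => by rw [LF.msubst_fv]; exact .var (hΔ h)⟩

theorem SubOk.extend {sg : Sig} {Δ Δ₁ Δ₂ : Ctx} {θ : ℕ → LF} (h : SubOk sg Δ θ Δ₁) {x : ℕ}
    {A u : LF} (hx : x ∉ Ctx.names Δ) (hA : x ∉ A.fvs) (hΔ : Δ₁ ⊆ Δ₂)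
    (hu : HasType sg Δ₂ u (A.msubst θ)) : SubOk sg ((x, A) :: Δ) (Function.update θ x u) Δ₂ := by
  refine ⟨LF.lc_update h.lc hu.scoped.2 x, fun {y B} hy => ?_⟩
  rcases List.mem_cons.1 hy with e | hy
  · cases e
    rw [LF.msubst_update hA, Function.update_self]; exact hu
  · obtain ⟨h₁, h₂⟩ := Ctx.mem_names hy
    rw [LF.msubst_update fun h => hx (h₂ h),
      Function.update_of_ne (by rintro rfl; exact hx h₁)]
    exact (h.hasType hy).weaken hΔ

theorem SubOk.under {sg : Sig} {Δ Δ₁ : Ctx} {θ : ℕ → LF} (h : SubOk sg Δ θ Δ₁) {x : ℕ}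
    {A : LF} (hx : x ∉ Ctx.names Δ) (hA : x ∉ A.fvs) :
    SubOk sg ((x, A) :: Δ) (Function.update θ x (.fv x)) ((x, A.msubst θ) :: Δ₁) :=
  h.extend hx hA (List.subset_cons_self _ _) (.var (List.mem_cons_self ..))

mutual
  theorem HasType.msubst {sg : Sig} (hsg : sg.Valid) {Δ : Ctx} {M A : LF} (h : HasType sg Δ M A) :
      ∀ {θ : ℕ → LF} {Δ₁ : Ctx}, SubOk sg Δ θ Δ₁ → HasType sg Δ₁ (M.msubst θ) (A.msubst θ) :=
    match h with
    | .var h => fun hθ => hθ.hasType h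
    | .cst h => fun hθ => by
        rw [LF.msubst_eq_self (M := A) (by simp [hsg.fvs_cst h])]; exact .cst h
    | .app h₁ h₂ => fun hθ => by
        rw [LF.inst_msubst hθ.lc]; exact .app (h₁.msubst hsg hθ) (h₂.msubst hsg hθ)
    | @HasType.lam _ Δ A M B L h₁ h₂ => fun hθ => by
        refine .lam (L ∪ (Ctx.names Δ ∪ (A.fvs ∪ (M.fvs ∪ B.fvs)))) (h₁.msubst hsg hθ) fun x hx => ?_
        simp only [Finset.mem_union, not_or] at hx
        obtain ⟨hL, hΔ, hA, hM, hB⟩ := hx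
        rw [← LF.open_msubst hθ.lc hM, ← LF.open_msubst hθ.lc hB]
        exact (h₂ x hL).msubst hsg (hθ.under hΔ hA)
    | .conv h₁ h₂ hb => fun hθ =>
        .conv (h₁.msubst hsg hθ) (h₂.msubst hsg hθ) (hb.msubst hθ.lc)
  theorem HasKind.msubst {sg : Sig} (hsg : sg.Valid) {Δ : Ctx} {A K : LF} (h : HasKind sg Δ A K) :
      ∀ {θ : ℕ → LF} {Δ₁ : Ctx}, SubOk sg Δ θ Δ₁ → HasKind sg Δ₁ (A.msubst θ) (K.msubst θ) :=
    match h with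
    | .ptype h => fun _ => .ptype h
    | .fam h => fun hθ => by
        rw [LF.msubst_eq_self (M := K) (by simp [hsg.fvs_fam h])]; exact .fam h
    | @HasKind.pi _ Δ A B L h₁ h₂ => fun hθ => by
        refine .pi (L ∪ (Ctx.names Δ ∪ (A.fvs ∪ B.fvs))) (h₁.msubst hsg hθ) fun x hx => ?_
        simp only [Finset.mem_union, not_or] at hx
        obtain ⟨hL, hΔ, hA, hB⟩ := hx
        rw [← LF.open_msubst hθ.lc hB]
        exact (h₂ x hL).msubst hsg (hθ.under hΔ hA)
    | .app h₁ h₂ => fun hθ => by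
        rw [LF.inst_msubst hθ.lc]; exact .app (h₁.msubst hsg hθ) (h₂.msubst hsg hθ)
    | .conv h₁ h₂ hb => fun hθ =>
        .conv (h₁.msubst hsg hθ) (h₂.msubst hsg hθ) (hb.msubst hθ.lc)
  theorem IsKind.msubst {sg : Sig} (hsg : sg.Valid) {Δ : Ctx} {K : LF} (h : IsKind sg Δ K) :
      ∀ {θ : ℕ → LF} {Δ₁ : Ctx}, SubOk sg Δ θ Δ₁ → IsKind sg Δ₁ (K.msubst θ) :=
    match h with
    | .typ => fun _ => .typ
    | @IsKind.pi _ Δ A K L h₁ h₂ => fun hθ => by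
        refine .pi (L ∪ (Ctx.names Δ ∪ (A.fvs ∪ K.fvs))) (h₁.msubst hsg hθ) fun x hx => ?_
        simp only [Finset.mem_union, not_or] at hx
        obtain ⟨hL, hΔ, hA, hK⟩ := hx
        rw [← LF.open_msubst hθ.lc hK]
        exact (h₂ x hL).msubst hsg (hθ.under hΔ hA)
end

theorem SubOk.comp {sg : Sig} (hsg : sg.Valid) {Δ Δ₁ Δ₂ : Ctx} {θ θ₁ : ℕ → LF}
    (h : SubOk sg Δ θ Δ₁) (h₁ : SubOk sg Δ₁ θ₁ Δ₂) :
    SubOk sg Δ (fun x => (θ x).msubst θ₁) Δ₂ :=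
  ⟨fun x => (h.lc x).msubst h₁.lc, fun hx => by
    rw [← LF.msubst_msubst]; exact (h.hasType hx).msubst hsg h₁⟩

/-! ### Static unification computes most general unifiers -/

theorem Subst.fn_append (σ₂ σ₁ : Subst) (y : ℕ) :
    Subst.fn (σ₂ ++ σ₁) y = (Subst.fn σ₁ y).msubst (Subst.fn σ₂) := by
  induction σ₂ with
  | nil => exact (LF.msubst_fv _).symm
  | cons p σ₂ ih =>
    obtain ⟨x, N⟩ := p
    simp only [List.cons_append, Subst.fn, ih, LF.msubst_msubst]

theorem Subst.mem_ctx {σ : Subst} {Δ : Ctx} {y : ℕ} {B : LF} (h : (y, B) ∈ Subst.ctx σ Δ) :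
    ∃ A, (y, A) ∈ Δ ∧ B = A.msubst (Subst.fn σ) := by
  induction σ generalizing B with
  | nil => exact ⟨B, h, (LF.msubst_fv B).symm⟩
  | cons p σ ih =>
    obtain ⟨x, N⟩ := p
    simp only [Subst.ctx, List.mem_map, List.mem_filter, Prod.exists, Prod.mk.injEq] at h
    obtain ⟨z, C, ⟨hC, -⟩, rfl, rfl⟩ := h
    obtain ⟨A, hA, rfl⟩ := ih hC
    exact ⟨A, hA, by rw [LF.msubst_msubst]; rfl⟩

theorem msubst_single_eq {x : ℕ} {M : LF} {θ : ℕ → LF} (h : θ x = M.msubst θ) (y : ℕ) :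
    (Subst.fn [(x, M)] y).msubst θ = θ y := by
  simp only [Subst.fn, LF.msubst, single]
  split
  · rename_i e; rw [e, h]
  · rfl

theorem map_msubst_of_factor {σ θ : ℕ → LF} (h : ∀ y, (σ y).msubst θ = θ y) (Ms : List LF) :
    (Ms.map (LF.msubst σ)).map (LF.msubst θ) = Ms.map (LF.msubst θ) := by
  simp only [List.map_map]
  exact List.map_congr_left fun M _ => by
    simp only [Function.comp, LF.msubst_msubst, h]

mutual
  /-- Every unifier absorbs the computed one. -/
  theorem SUnify.factor {Δ : Ctx} {M N : LF} {σ : Subst} (h : SUnify Δ M N σ) :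
      ∀ {θ : ℕ → LF}, M.msubst θ = N.msubst θ → ∀ y, (σ.fn y).msubst θ = θ y :=
    match h with
    | .refl => fun _ _ => rfl
    | .varL _ _ => fun e => msubst_single_eq e
    | .varR _ _ => fun e => msubst_single_eq e.symm
    | .cst h => fun e => h.factor (by
        rw [LF.msubst_apps, LF.msubst_apps] at e; exact (LF.cst_apps_inj e).2)
  theorem SUnifyArgs.factor {Δ : Ctx} {Ms Ns : List LF} {σ : Subst} (h : SUnifyArgs Δ Ms Ns σ) :
      ∀ {θ : ℕ → LF}, Ms.map (LF.msubst θ) = Ns.map (LF.msubst θ) →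
        ∀ y, (σ.fn y).msubst θ = θ y :=
    match h with
    | .nil => fun _ _ => rfl
    | .cons h₁ h₂ => fun e y => by
        injection e with e₁ e₂
        have f₁ := h₁.factor e₁
        have f₂ := h₂.factor (by
          rw [map_msubst_of_factor f₁, map_msubst_of_factor f₁]; exact e₂)
        rw [Subst.fn_append, LF.msubst_msubst]
        simp only [f₂, f₁]
end

theorem In.nodes_le {x : ℕ} {M : LF} (h : In x M) (θ : ℕ → LF) :
    (θ x).nodes ≤ (M.msubst θ).nodes := by
  induction h with
  | var => exact le_rfl
  | cst hM _ ih =>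
    rw [LF.msubst_apps]
    exact ih.trans (LF.nodes_lt_nodes_apps (List.mem_map_of_mem hM)).le

/-- Occurs check: an instance of a term is larger than the instances of its proper subterms. -/
theorem In.msubst_ne {x : ℕ} {M : LF} (h : In x M) (hne : M ≠ .fv x) (θ : ℕ → LF) :
    θ x ≠ M.msubst θ := by
  intro e
  cases h with
  | var => exact hne rfl
  | @cst c Ms M hM h =>
    have := (h.nodes_le θ).trans_lt (LF.nodes_lt_nodes_apps (M := .cst c) (List.mem_map_of_mem hM))
    rw [e, LF.msubst_apps] at this
    exact lt_irrefl _ this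

mutual
  /-- Terms whose static unification fails have no unifier. -/
  theorem SFail.msubst_ne {Δ : Ctx} {M N : LF} (h : SFail Δ M N) :
      ∀ {θ : ℕ → LF}, M.msubst θ ≠ N.msubst θ :=
    match h with
    | .varL hne h => fun e => h.msubst_ne hne _ e
    | .varR hne h => fun e => h.msubst_ne hne _ e.symm
    | .clash hne => fun e => by
        rw [LF.msubst_apps, LF.msubst_apps] at e; exact hne (LF.cst_apps_inj e).1
    | .cst h => fun e => h.msubst_ne (by
        rw [LF.msubst_apps, LF.msubst_apps] at e; exact (LF.cst_apps_inj e).2)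
  theorem SFailArgs.msubst_ne {Δ : Ctx} {Ms Ns : List LF} (h : SFailArgs Δ Ms Ns) :
      ∀ {θ : ℕ → LF}, Ms.map (LF.msubst θ) ≠ Ns.map (LF.msubst θ) :=
    match h with
    | .head h => fun e => h.msubst_ne (List.cons.inj e).1
    | .tail h₁ h₂ => fun e => by
        have f₁ := h₁.factor (List.cons.inj e).1
        exact h₂.msubst_ne (by
          rw [map_msubst_of_factor f₁, map_msubst_of_factor f₁]; exact (List.cons.inj e).2)
end

theorem SubOk.of_factor {sg : Sig} {Δ Δ₁ : Ctx} {σ : Subst} {θ : ℕ → LF} (hθ : SubOk sg Δ θ Δ₁)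
    (h : ∀ y, (σ.fn y).msubst θ = θ y) : SubOk sg (σ.ctx Δ) θ Δ₁ :=
  ⟨hθ.lc, fun hy => by
    obtain ⟨A, hA, rfl⟩ := Subst.mem_ctx hy
    rw [LF.msubst_msubst]
    simp only [h]
    exact hθ.hasType hA⟩

/-! ### Typing of words, operands and code -/

section Words

variable {k : ℕ} {sg : Sig} {Ξ : ℕ → Option (Ty k)}

theorem Ty.msubst_fv (τ : Ty k) : τ.msubst .fv = τ := Binding.msubst_fv τ

theorem Ty.msubst_msubst (τ : Ty k) (θ θ₁ : ℕ → LF) :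
    (τ.msubst θ).msubst θ₁ = τ.msubst fun x => (θ x).msubst θ₁ := Binding.msubst_msubst τ θ θ₁

theorem Ty.msubst_update {τ : Ty k} {x : ℕ} (hx : x ∉ Binding.supp τ) (θ : ℕ → LF) (u : LF) :
    τ.msubst (Function.update θ x u) = τ.msubst θ := Binding.msubst_update hx θ u

theorem Ty.inst_msubst {θ : ℕ → LF} (hθ : ∀ x, LF.LC (θ x)) (τ : Ty k) (d : ℕ) (u : LF) :
    (τ.inst d u).msubst θ = (τ.msubst θ).inst d (u.msubst θ) := Binding.inst_msubst hθ τ d u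

theorem Ty.open_msubst {θ : ℕ → LF} (hθ : ∀ x, LF.LC (θ x)) {τ : Ty k} {x : ℕ}
    (hx : x ∉ Binding.supp τ) (d : ℕ) (u : LF) :
    (τ.inst d (.fv x)).msubst (Function.update θ x u) = (τ.msubst θ).inst d u :=
  Binding.open_msubst hθ hx d u

theorem Ty.LC.msubst {θ : ℕ → LF} (hθ : ∀ x, LF.LC (θ x)) {τ : Ty k} (h : τ.LC) :
    (τ.msubst θ).LC := Binding.inst_msubst_of_inst hθ h

theorem Ty.msubst_pi (A : LF) (τ : Ty k) (θ : ℕ → LF) :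
    (Ty.pi A τ).msubst θ = .pi (A.msubst θ) (τ.msubst θ) :=
  congrArg _ (Binding.map_const (LF.msubst θ) 1 0 τ)

theorem RTy.msubst_apply (Γ : RTy k) (θ : ℕ → LF) (r : Reg k) :
    Γ.msubst θ r = (Γ r).map fun τ => τ.msubst θ := Ty.mapOption_eq _ _ _

theorem RTy.msubst_update {Γ : RTy k} {x : ℕ} (hx : x ∉ Binding.supp (Ty.neg Γ)) (θ : ℕ → LF)
    (u : LF) : Γ.msubst (Function.update θ x u) = Γ.msubst θ :=
  Ty.neg.inj (Ty.msubst_update hx θ u)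

theorem Ty.msubst_update_of_mem {Γ : RTy k} {r : Reg k} {τ : Ty k} (h : Γ r = some τ) {x : ℕ}
    (hx : x ∉ Binding.supp (Ty.neg Γ)) (θ : ℕ → LF) (u : LF) :
    τ.msubst (Function.update θ x u) = τ.msubst θ := by
  have := congrFun (RTy.msubst_update hx θ u) r
  simpa [RTy.msubst_apply, h] using this

theorem RTy.map_set (f : ℕ → LF → LF) (d : ℕ) (Γ : RTy k) (r : Reg k) (τ : Ty k) :
    (Γ.set r τ).map f d = (Γ.map f d).set r (τ.map f d) := by
  funext s
  by_cases h : s = r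
  · subst h; simp [RTy.map, RTy.set, Ty.mapOption_eq]
  · simp [RTy.map, RTy.set, h]

theorem RTy.msubst_set (Γ : RTy k) (r : Reg k) (τ : Ty k) (θ : ℕ → LF) :
    (Γ.set r τ).msubst θ = (Γ.msubst θ).set r (τ.msubst θ) := RTy.map_set _ _ _ _ _

theorem Word.msubst_msubst (w : Word) (θ θ₁ : ℕ → LF) :
    (w.msubst θ).msubst θ₁ = w.msubst fun x => (θ x).msubst θ₁ := Binding.msubst_msubst w θ θ₁

theorem Word.msubst_congr {w : Word} {θ θ₁ : ℕ → LF} (h : ∀ x ∈ w.fvs, θ x = θ₁ x) :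
    w.msubst θ = w.msubst θ₁ :=
  Word.map_congr (fun _ _ hM => LF.msubst_congr fun x hx => h x (hM hx)) 0

theorem Word.inst_msubst {θ : ℕ → LF} (hθ : ∀ x, LF.LC (θ x)) (w : Word) (d : ℕ) (u : LF) :
    (w.inst d u).msubst θ = (w.msubst θ).inst d (u.msubst θ) := Binding.inst_msubst hθ w d u

theorem Word.open_msubst {θ : ℕ → LF} (hθ : ∀ x, LF.LC (θ x)) {w : Word} {x : ℕ}
    (hx : x ∉ w.fvs) (d : ℕ) (u : LF) :
    (w.inst d (.fv x)).msubst (Function.update θ x u) = (w.msubst θ).inst d u := by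
  induction w generalizing d with
  | cloc | hloc => rfl
  | app w M ih =>
    simp only [Word.fvs, Finset.mem_union, not_or] at hx
    exact congrArg₂ Word.app (ih hx.1 d) (LF.open_msubst hθ hx.2 d u)
  | lam A w ih =>
    simp only [Word.fvs, Finset.mem_union, not_or] at hx
    refine congrArg₂ Word.lam (LF.open_msubst hθ hx.1 d u) ?_
    have e₁ := Binding.map_const (LF.msubst (Function.update θ x u)) 1 0 (w.inst (d + 1) (.fv x))
    have e₂ := Binding.map_const (LF.msubst θ) 1 0 w
    exact e₁.trans ((ih hx.2 (d + 1)).trans (congrArg (fun v => Word.inst v (d + 1) u) e₂.symm))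

theorem Word.msubst_lam (A : LF) (w : Word) (θ : ℕ → LF) :
    (Word.lam A w).msubst θ = .lam (A.msubst θ) (w.msubst θ) :=
  congrArg _ (Binding.map_const (LF.msubst θ) 1 0 w)

theorem Word.msubst_apps (w : Word) (Ms : List LF) (θ : ℕ → LF) :
    (w.apps Ms).msubst θ = (w.msubst θ).apps (Ms.map (LF.msubst θ)) := by
  induction Ms generalizing w with
  | nil => rfl
  | cons M Ms ih => exact ih _

theorem Word.inst_core {w : Word} {u v : LF} {i j : ℕ} (hij : i ≠ j)
    (h : (w.inst i v).inst j u = w.inst i v) : w.inst j u = w := by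
  induction w generalizing i j with
  | cloc | hloc => rfl
  | app w M ih =>
    injection h with h₁ h₂
    exact congrArg₂ _ (ih hij h₁) (LF.inst_core hij h₂)
  | lam A w ih =>
    injection h with h₁ h₂
    exact congrArg₂ _ (LF.inst_core hij h₁) (ih (by omega) h₂)

theorem Word.inst_of_msubst {θ : ℕ → LF} {w : Word} {d : ℕ}
    (h : ∀ u, (w.msubst θ).inst d u = w.msubst θ) (u : LF) : w.inst d u = w := by
  induction w generalizing d with
  | cloc | hloc => rfl
  | app w M ih =>
    exact congrArg₂ _ (ih fun u => (Word.app.inj (h u)).1)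
      (LF.inst_of_msubst (fun u => (Word.app.inj (h u)).2) u)
  | lam A w ih =>
    simp only [Word.msubst_lam] at h
    exact congrArg₂ _ (LF.inst_of_msubst (fun u => (Word.lam.inj (h u)).1) u)
      (ih fun u => (Word.lam.inj (h u)).2)

theorem Word.fvs_subset_fvs_inst (w : Word) (d : ℕ) (u : LF) : w.fvs ⊆ (w.inst d u).fvs := by
  induction w generalizing d with
  | cloc | hloc => exact subset_rfl
  | app w M ih => exact Finset.union_subset_union (ih d) (LF.fvs_subset_fvs_inst M d u)
  | lam A w ih => exact Finset.union_subset_union (LF.fvs_subset_fvs_inst A d u) (ih (d + 1))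

theorem Word.mem_fvs_msubst {θ : ℕ → LF} {w : Word} {y : ℕ} :
    y ∈ (w.msubst θ).fvs ↔ ∃ x ∈ w.fvs, y ∈ (θ x).fvs := by
  induction w with
  | cloc | hloc => simp [Word.msubst, Word.map, Word.fvs]
  | app w M ih =>
    change y ∈ (w.msubst θ).fvs ∪ (M.msubst θ).fvs ↔ _
    simp only [Finset.mem_union, ih, LF.mem_fvs_msubst, Word.fvs, or_and_right, exists_or]
  | lam A w ih =>
    rw [Word.msubst_lam]
    simp only [Word.fvs, Finset.mem_union, ih, LF.mem_fvs_msubst, or_and_right, exists_or]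

theorem WordTy.weaken {Δ Δ₁ : Ctx} {Ψ Ψ₁ : List (ℕ × Ty k)} {w : Word} {τ : Ty k}
    (h : WordTy sg Ξ Δ Ψ w τ) (hΔ : Δ ⊆ Δ₁) (hΨ : Ψ ⊆ Ψ₁) : WordTy sg Ξ Δ₁ Ψ₁ w τ := by
  induction h generalizing Δ₁ with
  | cloc h => exact .cloc h
  | hloc h => exact .hloc (hΨ h)
  | app _ h ih => exact .app (ih hΔ hΨ) (h.weaken hΔ)
  | lam L hA _ ih =>
    exact .lam L (hA.weaken hΔ) fun x hx => ih x hx (List.cons_subset_cons _ hΔ) hΨ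

theorem WordTy.scoped {Δ : Ctx} {Ψ : List (ℕ × Ty k)} {w : Word} {τ : Ty k}
    (h : WordTy sg Ξ Δ Ψ w τ) :
    (∀ x ∈ w.fvs, ∃ A, (x, A) ∈ Δ) ∧ ∀ d u, w.inst d u = w := by
  induction h with
  | cloc | hloc => exact ⟨fun _ h => (nomatch Finset.notMem_empty _ h), fun _ _ => rfl⟩
  | app _ h ih =>
    refine ⟨fun x hx => ?_, fun d u => congrArg₂ _ (ih.2 d u) (h.scoped.2 d u)⟩
    rcases Finset.mem_union.1 hx with hx | hx
    exacts [ih.1 x hx, h.scoped.1 x hx]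
  | @lam Δ Ψ A w τ L hA _ ih =>
    obtain ⟨x, hx⟩ := Infinite.exists_notMem_finset (L ∪ w.fvs)
    simp only [Finset.mem_union, not_or] at hx
    obtain ⟨h₁, h₂⟩ := ih x hx.1
    refine ⟨fun y hy => ?_, fun d u => congrArg₂ _ (hA.scoped.2 d u)
      (Word.inst_core (Nat.succ_ne_zero d).symm (h₂ (d + 1) u))⟩
    rcases Finset.mem_union.1 hy with hy | hy
    · exact hA.scoped.1 y hy
    · obtain ⟨B, hB⟩ := h₁ y (Word.fvs_subset_fvs_inst _ _ _ hy)
      rcases List.mem_cons.1 hB with e | hB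
      · cases e; exact absurd hy hx.2
      · exact ⟨B, hB⟩

theorem exists_supp_heapTy (Ψ : List (ℕ × Ty k)) :
    ∃ L : Finset ℕ, ∀ l τ, (l, τ) ∈ Ψ → Binding.supp τ ⊆ L := by
  induction Ψ with
  | nil => exact ⟨∅, fun _ _ h => nomatch h⟩
  | cons p Ψ ih =>
    obtain ⟨L, hL⟩ := ih
    refine ⟨Binding.supp p.2 ∪ L, fun l τ h => ?_⟩
    rcases List.mem_cons.1 h with rfl | h
    · exact Finset.subset_union_left
    · exact (hL l τ h).trans Finset.subset_union_right

/-- Substitution in words; code types are closed, and the types of heap locations are substituted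
in along with the type of the word. -/
theorem WordTy.msubst (hsg : sg.Valid) (hΞ : ∀ l τ, Ξ l = some τ → ∀ θ, τ.msubst θ = τ)
    {Δ Δ₁ : Ctx} {Ψ Ψ₁ : List (ℕ × Ty k)} {w : Word} {τ : Ty k} {θ : ℕ → LF}
    (h : WordTy sg Ξ Δ Ψ w τ) (hθ : SubOk sg Δ θ Δ₁)
    (hΨ : ∀ l τ, (l, τ) ∈ Ψ → (l, τ.msubst θ) ∈ Ψ₁) :
    WordTy sg Ξ Δ₁ Ψ₁ (w.msubst θ) (τ.msubst θ) := by
  induction h generalizing Δ₁ θ with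
  | cloc h => rw [hΞ _ _ h]; exact .cloc h
  | hloc h => exact .hloc (hΨ _ _ h)
  | app _ h ih =>
    rw [Ty.inst_msubst hθ.lc]
    have := ih hθ hΨ
    rw [Ty.msubst_pi] at this
    exact .app this (h.msubst hsg hθ)
  | @lam Δ Ψ A w τ L hA _ ih =>
    obtain ⟨L₁, hL₁⟩ := exists_supp_heapTy Ψ
    rw [Word.msubst_lam, Ty.msubst_pi]
    refine .lam (L ∪ (Ctx.names Δ ∪ (A.fvs ∪ (w.fvs ∪ (Binding.supp τ ∪ L₁))))) (hA.msubst hsg hθ)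
      fun x hx => ?_
    simp only [Finset.mem_union, not_or] at hx
    obtain ⟨hL, hΔ, hA, hw, hτ, hx₁⟩ := hx
    rw [← Word.open_msubst hθ.lc hw, ← Ty.open_msubst hθ.lc hτ]
    refine ih x hL (hθ.under hΔ hA) fun l τ' h => ?_
    rw [Ty.msubst_update fun h' => hx₁ (hL₁ l τ' h h')]
    exact hΨ l τ' h

/-! ### Evaluation of words -/

theorem Word.Path.msubst {w : Word} (h : w.Path) (θ : ℕ → LF) : (w.msubst θ).Path := by
  induction h with
  | cloc => exact .cloc
  | hloc => exact .hloc
  | app _ ih => exact .app ih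

theorem WordEval.msubst {w w₁ : Word} (h : WordEval w w₁) {θ : ℕ → LF}
    (hθ : ∀ x, LF.LC (θ x)) : WordEval (w.msubst θ) (w₁.msubst θ) := by
  induction h generalizing θ with
  | cloc => exact .cloc
  | hloc => exact .hloc
  | @lam A w w₁ L _ ih =>
    rw [Word.msubst_lam, Word.msubst_lam]
    refine .lam (L ∪ (w.fvs ∪ w₁.fvs)) fun x hx => ?_
    simp only [Finset.mem_union, not_or] at hx
    rw [← Word.open_msubst hθ hx.2.1, ← Word.open_msubst hθ hx.2.2]
    exact ih x hx.1 (LF.lc_update hθ (LF.lc_fv x) x)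
  | beta _ _ ih₁ ih₂ =>
    have h₁ := ih₁ hθ
    have h₂ := ih₂ hθ
    rw [Word.msubst_lam] at h₁
    rw [Word.inst_msubst hθ] at h₂
    exact .beta h₁ h₂
  | app _ hp ih => exact .app (ih hθ) (hp.msubst θ)

/-- Substitution of a well-typed term in a word that is typed for all fresh names. -/
theorem WordTy.open (hsg : sg.Valid) (hΞ : ∀ l τ, Ξ l = some τ → ∀ θ, τ.msubst θ = τ)
    {Δ : Ctx} {Ψ : List (ℕ × Ty k)} {A M : LF} {w : Word} {τ : Ty k} {L : Finset ℕ}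
    (h : ∀ x ∉ L, WordTy sg Ξ ((x, A) :: Δ) Ψ (w.inst 0 (.fv x)) (τ.inst 0 (.fv x)))
    (hM : HasType sg Δ M A) : WordTy sg Ξ Δ Ψ (w.inst 0 M) (τ.inst 0 M) := by
  obtain ⟨L₁, hL₁⟩ := exists_supp_heapTy Ψ
  obtain ⟨x, hx⟩ := Infinite.exists_notMem_finset
    (L ∪ (Ctx.names Δ ∪ (A.fvs ∪ (w.fvs ∪ (Binding.supp τ ∪ L₁)))))
  simp only [Finset.mem_union, not_or] at hx
  obtain ⟨hL, hΔ, hA, hw, hτ, hx₁⟩ := hx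
  have := (h x hL).msubst hsg hΞ
    ((SubOk.id sg (List.Subset.refl Δ)).extend (u := M) hΔ hA (List.Subset.refl Δ)
      (by rwa [LF.msubst_fv]))
    (Ψ₁ := Ψ) fun l τ' h' => by
      rw [Ty.msubst_update fun h'' => hx₁ (hL₁ l τ' h' h''), Ty.msubst_fv]; exact h'
  rw [Word.open_msubst LF.lc_fv hw, Ty.open_msubst LF.lc_fv hτ, Ty.msubst_fv] at this
  rwa [show w.msubst .fv = w from Binding.msubst_fv w] at this

theorem WordTy.eval (hsg : sg.Valid) (hΞ : ∀ l τ, Ξ l = some τ → ∀ θ, τ.msubst θ = τ)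
    {w w₁ : Word} (hw : WordEval w w₁) {Δ : Ctx} {Ψ : List (ℕ × Ty k)} {τ : Ty k}
    (h : WordTy sg Ξ Δ Ψ w τ) : WordTy sg Ξ Δ Ψ w₁ τ := by
  induction hw generalizing Δ τ with
  | cloc | hloc => exact h
  | lam L _ ih =>
    cases h with
    | lam L₁ hA h =>
      refine .lam (L ∪ L₁) hA fun x hx => ?_
      simp only [Finset.mem_union, not_or] at hx
      exact ih x hx.1 (h x hx.2)
  | beta _ _ ih₁ ih₂ =>
    cases h with
    | app h hM =>
      cases ih₁ h with
      | lam L _ h => exact ih₂ (WordTy.open hsg hΞ h hM)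
  | app _ _ ih =>
    cases h with
    | app h hM => exact .app (ih h) hM

/-! ### Resolution of operands -/

/-- The register, if any, that an operand refers to. -/
def Op.head : Op k → Option (Reg k)
  | .cloc _ => none
  | .reg r => some r
  | .app op _ => op.head
  | .lam _ op => op.head

theorem Op.head_map (f : ℕ → LF → LF) (d : ℕ) (op : Op k) : (op.map f d).head = op.head := by
  induction op generalizing d <;> simp_all [Op.map, Op.head]

theorem Op.msubst_lam (A : LF) (op : Op k) (θ : ℕ → LF) :
    (Op.lam A op).map (fun _ M => M.msubst θ) 0 =
      .lam (A.msubst θ) (op.map (fun _ M => M.msubst θ) 0) :=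
  congrArg _ (Binding.map_const (LF.msubst θ) 1 0 op)

theorem OpTy.head_typed {Δ : Ctx} {Γ : RTy k} {op : Op k} {τ : Ty k} (h : OpTy sg Ξ Δ Γ op τ)
    {r : Reg k} (hr : op.head = some r) : ∃ τ, Γ r = some τ := by
  induction h with
  | cloc => cases hr
  | reg h => cases hr; exact ⟨_, h⟩
  | app _ _ ih => exact ih hr
  | lam L _ _ ih =>
    obtain ⟨x, hx⟩ := Infinite.exists_notMem_finset L
    exact ih x hx (by rw [Op.inst, Op.head_map]; exact hr)

/-- Resolution commutes with opening if the register contents have no dangling indices. -/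
theorem OpResolve.inst {R : Reg k → Option Word} {op : Op k} {w : Word} (h : OpResolve R op w)
    (hR : ∀ r w, op.head = some r → R r = some w → ∀ d u, w.inst d u = w) (d : ℕ) (u : LF) :
    OpResolve R (op.inst d u) (w.inst d u) := by
  induction h generalizing d with
  | cloc => exact .cloc
  | reg h => rw [hR _ _ rfl h]; exact .reg h
  | app _ ih => exact .app (ih hR d)
  | lam _ ih => exact .lam (ih hR (d + 1))

/-- Resolving an instance of a well-typed operand gives a well-typed word. The words in the
registers are read under `ρ`, the readback of the heap, which fixes the variables of `Δ₁`; the types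
are read under `θ`. Both are extended by the identity when passing under an abstraction. -/
theorem OpTy.resolve {Δ Δ₁ : Ctx} {Γ : RTy k} {op : Op k} {τ : Ty k} (hsg : sg.Valid)
    (hΞ : ∀ l τ, Ξ l = some τ → ∀ θ, τ.msubst θ = τ) (h : OpTy sg Ξ Δ Γ op τ)
    {R : Reg k → Option Word} {Ψ : List (ℕ × Ty k)} {θ ρ : ℕ → LF} {w : Word}
    (hθ : SubOk sg Δ θ Δ₁) (hρ : ∀ x, LF.LC (ρ x)) (hρΔ : ∀ x A, (x, A) ∈ Δ₁ → ρ x = .fv x)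
    (hR : ∀ r τ, Γ r = some τ → ∃ w, R r = some w ∧ WordTy sg Ξ Δ₁ Ψ (w.msubst ρ) (τ.msubst θ))
    (hw : OpResolve R (op.map (fun _ M => M.msubst θ) 0) w) :
    WordTy sg Ξ Δ₁ Ψ (w.msubst ρ) (τ.msubst θ) := by
  have fixed : ∀ {Δ₁ : Ctx} {ρ : ℕ → LF} {M : LF}, (∀ x A, (x, A) ∈ Δ₁ → ρ x = .fv x) →
      Scoped Δ₁ M → M.msubst ρ = M := fun hρΔ hM => LF.msubst_eq_self fun x hx =>
    (hM.1 x hx).elim fun A hA => hρΔ x A hA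
  induction h generalizing Δ₁ θ ρ w with
  | cloc h => cases hw; rw [hΞ _ _ h]; exact .cloc h
  | reg h =>
    cases hw with
    | reg h' =>
      obtain ⟨w', h₁, h₂⟩ := hR _ _ h
      cases h'.symm.trans h₁; exact h₂
  | app _ hM ih =>
    cases hw with
    | app hw =>
      have h₁ := ih hθ hρ hρΔ hR hw
      have h₂ := hM.msubst hsg hθ
      rw [Ty.msubst_pi] at h₁
      rw [Ty.inst_msubst hθ.lc]
      have e := fixed hρΔ h₂.scoped
      change WordTy sg Ξ Δ₁ Ψ (.app _ (LF.msubst ρ _)) _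
      rw [e]
      exact .app h₁ h₂
  | @lam Δ Γ A op τ L hA hop ih =>
    rw [Op.msubst_lam] at hw
    cases hw with
    | @lam _ _ w hw =>
      have hA' := hA.msubst hsg hθ
      rw [Word.msubst_lam, Ty.msubst_pi, fixed hρΔ hA'.scoped]
      refine .lam (L ∪ (Ctx.names Δ ∪ (A.fvs ∪ (Binding.supp op ∪ (Binding.supp τ ∪ (w.fvs ∪
        (Binding.supp (Ty.neg Γ) ∪ Finset.univ.biUnion fun r => (R r).elim ∅ Word.fvs))))))) hA'
        fun x hx => ?_
      simp only [Finset.mem_union, not_or, Finset.mem_biUnion, Finset.mem_univ, true_and,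
        not_exists] at hx
      obtain ⟨hL, hΔ, hA, hop', hτ, hxw, hΓ, hxR⟩ := hx
      rw [← Word.open_msubst hρ hxw, ← Ty.open_msubst hθ.lc hτ]
      refine ih x hL (hθ.under hΔ hA) (LF.lc_update hρ (LF.lc_fv x) x) ?_ ?_ ?_
      · intro y B hy
        by_cases e : y = x
        · subst e; simp
        · rcases List.mem_cons.1 hy with h | h
          · cases h; exact absurd rfl e
          · rw [Function.update_of_ne e]; exact hρΔ y B h
      · intro r τ' h
        obtain ⟨v, h₁, h₂⟩ := hR r τ' h
        refine ⟨v, h₁, ?_⟩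
        have hv : x ∉ v.fvs := by simpa [h₁] using hxR r
        rw [Ty.msubst_update_of_mem h hΓ, Word.msubst_congr (θ₁ := ρ) fun y hy =>
          Function.update_of_ne (by rintro rfl; exact hv hy) _ _]
        exact h₂.weaken (List.subset_cons_self _ _) (List.Subset.refl _)
      · have e := Binding.open_msubst hθ.lc hop' 0 (.fv x)
        change OpResolve R (Binding.msubst (Binding.inst op 0 (.fv x)) _) _
        rw [e]
        refine hw.inst (fun r v hr hv d u => ?_) 0 (.fv x)
        rw [Op.head_map] at hr
        obtain ⟨τ', h'⟩ := OpTy.head_typed (hop x hL) (by rw [Op.inst, Op.head_map]; exact hr)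
        obtain ⟨v', h₁, h₂⟩ := hR r τ' h'
        cases hv.symm.trans h₁
        exact Word.inst_of_msubst (h₂.scoped.2 d) u

/-! ### Calls of code -/

/-- A word of type `τ` can be applied to the terms `Ms`, and the result has type `τ₁`. -/
inductive AppTy (sg : Sig) (Δ : Ctx) : Ty k → List LF → Ty k → Prop
  | nil {τ} : AppTy sg Δ τ [] τ
  | cons {A M τ Ms τ₁} : HasType sg Δ M A → AppTy sg Δ (τ.inst 0 M) Ms τ₁ →
      AppTy sg Δ (.pi A τ) (M :: Ms) τ₁

theorem WordTy.apps_inv {Δ : Ctx} {Ψ : List (ℕ × Ty k)} {w : Word} {Ms : List LF} {τ : Ty k}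
    (h : WordTy sg Ξ Δ Ψ (w.apps Ms) τ) :
    ∃ τ₀, WordTy sg Ξ Δ Ψ w τ₀ ∧ AppTy sg Δ τ₀ Ms τ := by
  induction Ms generalizing w with
  | nil => exact ⟨τ, h, .nil⟩
  | cons M Ms ih =>
    obtain ⟨τ₀, h₁, h₂⟩ := ih (w := w.app M) h
    cases h₁ with
    | app h₁ hM => exact ⟨_, h₁, .cons hM h₂⟩

theorem AppTy.append {Δ : Ctx} {τ τ₁ τ₂ : Ty k} {Ms Ns : List LF} (h : AppTy sg Δ τ Ms τ₁)
    (h₁ : AppTy sg Δ τ₁ Ns τ₂) : AppTy sg Δ τ (Ms ++ Ns) τ₂ := by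
  induction h with
  | nil => exact h₁
  | cons hM _ ih => exact .cons hM (ih h₁)

theorem Ty.inst_pis (As : List LF) (d : ℕ) (u : LF) :
    ∃ Bs, ∀ τ : Ty k, (Ty.pis As τ).inst d u = Ty.pis Bs (τ.inst (d + As.length) u) := by
  induction As generalizing d with
  | nil => exact ⟨[], fun _ => rfl⟩
  | cons A As ih =>
    obtain ⟨Bs, h⟩ := ih (d + 1)
    refine ⟨A.inst d u :: Bs, fun τ => congrArg (Ty.pi (A.inst d u)) ((h τ).trans ?_)⟩
    rw [List.length_cons, Nat.add_right_comm, Nat.add_assoc]; rfl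

theorem Ty.msubst_pis (As : List LF) (τ : Ty k) (θ : ℕ → LF) :
    (Ty.pis As τ).msubst θ = Ty.pis (As.map (LF.msubst θ)) (τ.msubst θ) := by
  induction As with
  | nil => rfl
  | cons A As ih => exact (Ty.msubst_pi _ _ _).trans (congrArg _ ih)

/-- Applying a closure to its parameters does not affect the type of its environment. -/
theorem AppTy.set_env {Δ : Ctx} {As Ms : List LF} {Γ Γ₁ : RTy k} {τ : Ty k} (hτ : τ.LC)
    (h : AppTy sg Δ (.pis As (.neg Γ)) Ms (.neg Γ₁)) :
    AppTy sg Δ (.pis As (.neg (Γ.set Reg.env τ))) Ms (.neg (Γ₁.set Reg.env τ)) := by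
  induction Ms generalizing As Γ with
  | nil =>
    cases As with
    | nil => cases h; exact .nil
    | cons => cases h
  | cons M Ms ih =>
    cases As with
    | nil => cases h
    | cons A As =>
      cases h with
      | cons hM h =>
        obtain ⟨Bs, hB⟩ := Ty.inst_pis (k := k) As 0 M
        refine .cons hM ?_
        change AppTy sg Δ ((Ty.pis As _).inst 0 M) Ms _ at h
        change AppTy sg Δ ((Ty.pis As _).inst 0 M) Ms _
        rw [hB] at h ⊢
        have := ih h
        rwa [show Ty.inst (.neg (Γ.set Reg.env τ)) (0 + As.length) M = .neg
          (RTy.set (Γ.map (fun i N => N.inst i M) (0 + As.length)) Reg.env τ) from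
            congrArg Ty.neg ((RTy.map_set _ _ _ _ _).trans
              (congrArg (RTy.set _ Reg.env) (hτ (0 + As.length) M)))]

theorem Code.ty_map (f : ℕ → LF → LF) (d : ℕ) (v : Code k) : (v.map f d).ty = v.ty.map f d := by
  induction v generalizing d with
  | body Γ I => rfl
  | lam A v ih => exact congrArg _ (ih (d + 1))

theorem Code.msubst_lam (A : LF) (v : Code k) (θ : ℕ → LF) :
    (Code.lam A v).msubst θ = .lam (A.msubst θ) (v.msubst θ) :=
  congrArg _ (Binding.map_const (LF.msubst θ) 1 0 v)

theorem Code.instantiate_msubst {θ : ℕ → LF} (hθ : ∀ x, LF.LC (θ x)) {v : Code k} {Ms : List LF}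
    {I : Instr k} (h : v.instantiate Ms = some I) :
    (v.msubst θ).instantiate (Ms.map (LF.msubst θ)) = some (I.msubst θ) := by
  induction Ms generalizing v with
  | nil =>
    cases v with
    | body Γ I₁ =>
      simp only [Code.instantiate, Option.some.injEq] at h
      subst h; simp [Code.msubst, Code.map, Code.instantiate, Instr.msubst]
    | lam => simp [Code.instantiate] at h
  | cons M Ms ih =>
    cases v with
    | body => simp [Code.instantiate] at h
    | lam A v =>
      simp only [Code.instantiate] at h
      have := ih h
      rw [show (v.inst 0 M).msubst θ = (v.msubst θ).inst 0 (M.msubst θ) from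
        Binding.inst_msubst hθ v 0 M] at this
      rw [Code.msubst_lam]
      simpa only [List.map_cons, Code.instantiate] using this

/-- The body of a called code value is typed by the declared typing of the code, read under a
substitution of the arguments for the parameters. -/
theorem CodeOk.enter {Δ Δ₁ : Ctx} {v : Code k} {θ : ℕ → LF} {Ms : List LF} {Γ : RTy k}
    {I : Instr k} (h : CodeOk sg Ξ Δ v) (hθ : SubOk sg Δ θ Δ₁)
    (happ : AppTy sg Δ₁ (v.msubst θ).ty Ms (.neg Γ))
    (hI : (v.msubst θ).instantiate Ms = some I) :
    ∃ Δ₂ Γ₂ I₂ θ₂, InstrOk sg Ξ Δ₂ Γ₂ I₂ ∧ SubOk sg Δ₂ θ₂ Δ₁ ∧ I = I₂.msubst θ₂ ∧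
      Γ = Γ₂.msubst θ₂ := by
  induction h generalizing θ Ms with
  | @body Δ Γ₀ I₀ h =>
    change (Code.body (Γ₀.msubst θ) (I₀.msubst θ)).instantiate Ms = _ at hI
    cases Ms with
    | cons => simp [Code.instantiate] at hI
    | nil =>
      simp only [Code.instantiate, Option.some.injEq] at hI
      cases happ
      exact ⟨_, _, _, _, h, hθ, hI.symm, rfl⟩
  | @lam Δ A v L _ ih =>
    rw [Code.msubst_lam] at happ hI
    cases Ms with
    | nil => simp [Code.instantiate] at hI
    | cons M Ms =>
      simp only [Code.instantiate] at hI
      cases happ with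
      | cons hM happ =>
        obtain ⟨x, hx⟩ := Infinite.exists_notMem_finset
          (L ∪ (Ctx.names Δ ∪ (A.fvs ∪ Binding.supp v)))
        simp only [Finset.mem_union, not_or] at hx
        obtain ⟨hL, hΔ, hA, hv⟩ := hx
        have e : (v.inst 0 (.fv x)).msubst (Function.update θ x M) = (v.msubst θ).inst 0 M :=
          Binding.open_msubst hθ.lc hv 0 M
        refine ih x hL (hθ.extend hΔ hA (List.Subset.refl _) hM) (Ms := Ms) ?_ ?_
        · rw [e]
          change AppTy sg Δ₁ ((v.msubst θ).ty.map _ 0) Ms _ at happ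
          rwa [← Code.ty_map] at happ
        · rw [e]; exact hI

end Words

/-! ### Terms encoded on the heap -/

theorem Heap.set_self (H : Heap) (l : ℕ) (v : HVal) : H.set l v l = some v :=
  Function.update_self ..

theorem Heap.set_of_ne (H : Heap) {l l₁ : ℕ} (h : l₁ ≠ l) (v : HVal) : H.set l v l₁ = H l₁ :=
  Function.update_of_ne h ..

mutual
  theorem Encodes.det {H : Heap} {l : ℕ} {M : LF} (h : Encodes H l M) :
      ∀ {N : LF}, Encodes H l N → M = N :=
    match h with
    | .free h => fun h' => by
        cases h' with
        | free => rfl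
        | bound h₁ => cases h.symm.trans h₁
        | str h₁ => cases h.symm.trans h₁
    | .bound h hM => fun h' => by
        cases h' with
        | free h₁ => cases h.symm.trans h₁
        | bound h₁ hN => cases h.symm.trans h₁; exact hM.det hN
        | str h₁ => cases h.symm.trans h₁
    | .str h hM => fun h' => by
        cases h' with
        | free h₁ => cases h.symm.trans h₁
        | bound h₁ => cases h.symm.trans h₁
        | str h₁ hN => cases h.symm.trans h₁; rw [hM.det hN]
  theorem EncodesList.det {H : Heap} {ls : List ℕ} {Ms : List LF} (h : EncodesList H ls Ms) :
      ∀ {Ns : List LF}, EncodesList H ls Ns → Ms = Ns :=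
    match h with
    | .nil => fun h' => by cases h'; rfl
    | .cons h₁ h₂ => fun h' => by
        cases h' with
        | cons h₁' h₂' => rw [h₁.det h₁', h₂.det h₂']
end

mutual
  theorem Encodes.free_of_mem {H : Heap} {l : ℕ} {M : LF} (h : Encodes H l M) :
      ∀ x ∈ M.fvs, ∃ a, H x = some (.free a) :=
    match h with
    | .free h => fun x hx => by cases Finset.mem_singleton.1 hx; exact ⟨_, h⟩
    | .bound _ hM => hM.free_of_mem
    | .str _ hM => fun x hx => by
        rcases LF.mem_fvs_apps.1 hx with hx | ⟨N, hN, hx⟩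
        · exact (nomatch Finset.notMem_empty _ hx)
        · exact hM.free_of_mem N hN x hx
  theorem EncodesList.free_of_mem {H : Heap} {ls : List ℕ} {Ms : List LF}
      (h : EncodesList H ls Ms) : ∀ M ∈ Ms, ∀ x ∈ M.fvs, ∃ a, H x = some (.free a) :=
    match h with
    | .nil => fun _ h => nomatch h
    | .cons h₁ h₂ => List.forall_mem_cons.2 ⟨h₁.free_of_mem, h₂.free_of_mem⟩
end

theorem LF.lc_apps {M : LF} {Ms : List LF} (hM : M.LC) (h : ∀ N ∈ Ms, N.LC) :
    (M.apps Ms).LC := fun d u => by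
  rw [LF.inst_apps, hM d u]
  exact congrArg _ ((List.map_congr_left fun N hN => h N hN d u).trans (List.map_id _))

mutual
  theorem Encodes.lc {H : Heap} {l : ℕ} {M : LF} (h : Encodes H l M) : M.LC :=
    match h with
    | .free _ => LF.lc_fv _
    | .bound _ hM => hM.lc
    | .str _ hM => LF.lc_apps (fun _ _ => rfl) hM.lc
  theorem EncodesList.lc {H : Heap} {ls : List ℕ} {Ms : List LF} (h : EncodesList H ls Ms) :
      ∀ M ∈ Ms, M.LC :=
    match h with
    | .nil => fun _ h => nomatch h
    | .cons h₁ h₂ => List.forall_mem_cons.2 ⟨h₁.lc, h₂.lc⟩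
end

theorem Encodes.readback_eq {H : Heap} {l : ℕ} {M : LF} (h : Encodes H l M) :
    readback H l = M := by
  have h' : ∃ M, Encodes H l M := ⟨M, h⟩
  rw [readback, dif_pos h']
  exact h'.choose_spec.det h

theorem readback_free {H : Heap} {l a : ℕ} (h : H l = some (.free a)) : readback H l = .fv l :=
  (Encodes.free h).readback_eq

theorem readback_lc (H : Heap) (l : ℕ) : (readback H l).LC := by
  by_cases h : ∃ M, Encodes H l M
  · obtain ⟨M, h⟩ := h
    rw [h.readback_eq]; exact h.lc
  · rw [readback, dif_neg h]; exact LF.lc_fv l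

theorem Encodes.msubst_readback {H : Heap} {l : ℕ} {M : LF} (h : Encodes H l M) :
    M.msubst (readback H) = M :=
  LF.msubst_eq_self fun x hx => (h.free_of_mem x hx).elim fun _ hx => readback_free hx

/-- `H₁` has at least the values of `H`. -/
def Heap.Le (H H₁ : Heap) : Prop := ∀ l v, H l = some v → H₁ l = some v

theorem Heap.le_set {H : Heap} {l : ℕ} (h : H l = none) (v : HVal) : H.Le (H.set l v) :=
  fun l₁ v₁ h₁ => by rw [H.set_of_ne (by rintro rfl; cases h.symm.trans h₁), h₁]

mutual
  theorem Encodes.mono {H H₁ : Heap} (hH : H.Le H₁) {l : ℕ} {M : LF} (h : Encodes H l M) :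
      Encodes H₁ l M :=
    match h with
    | .free h => .free (hH _ _ h)
    | .bound h hM => .bound (hH _ _ h) (hM.mono hH)
    | .str h hM => .str (hH _ _ h) (hM.mono hH)
  theorem EncodesList.mono {H H₁ : Heap} (hH : H.Le H₁) {ls : List ℕ} {Ms : List LF}
      (h : EncodesList H ls Ms) : EncodesList H₁ ls Ms :=
    match h with
    | .nil => .nil
    | .cons h₁ h₂ => .cons (h₁.mono hH) (h₂.mono hH)
end

theorem End.encodes {H : Heap} {l e : ℕ} (h : End H l e) {M : LF} (hM : Encodes H l M) :
    Encodes H e M := by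
  induction h with
  | free | str => exact hM
  | bound h _ ih =>
    cases hM with
    | free h₁ => cases h.symm.trans h₁
    | bound h₁ hM => cases h.symm.trans h₁; exact ih hM
    | str h₁ => cases h.symm.trans h₁

mutual
  /-- A term in which a location does not occur is not affected by a change at that location. -/
  theorem Encodes.set_of_notOcc {H : Heap} {e : ℕ} {v : HVal} {l : ℕ} {M : LF}
      (h : Encodes H l M) : NotOcc H e l → Encodes (H.set e v) l M :=
    match h with
    | .free h => fun ho => by
        have hne : l ≠ e := by cases ho <;> exact Ne.symm ‹_›
        exact .free (by rw [H.set_of_ne hne, h])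
    | .bound h hM => fun ho => by
        have hne : l ≠ e := by cases ho <;> exact Ne.symm ‹_›
        refine .bound (by rw [H.set_of_ne hne, h]) (hM.set_of_notOcc ?_)
        cases ho with
        | bound _ h₁ ho => cases h.symm.trans h₁; exact ho
        | free _ h₁ => cases h.symm.trans h₁
        | str _ h₁ => cases h.symm.trans h₁
        | tup _ h₁ => cases h.symm.trans h₁
        | clos _ h₁ => cases h.symm.trans h₁
    | .str h hM => fun ho => by
        have hne : l ≠ e := by cases ho <;> exact Ne.symm ‹_›
        refine .str (by rw [H.set_of_ne hne, h]) (hM.set_of_notOcc ?_)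
        cases ho with
        | bound _ h₁ => cases h.symm.trans h₁
        | free _ h₁ => cases h.symm.trans h₁
        | str _ h₁ ho => cases h.symm.trans h₁; exact ho
        | tup _ h₁ => cases h.symm.trans h₁
        | clos _ h₁ => cases h.symm.trans h₁
  theorem EncodesList.set_of_notOcc {H : Heap} {e : ℕ} {v : HVal} {ls : List ℕ} {Ms : List LF}
      (h : EncodesList H ls Ms) : (∀ l ∈ ls, NotOcc H e l) → EncodesList (H.set e v) ls Ms :=
    match h with
    | .nil => fun _ => .nil
    | .cons h₁ h₂ => fun ho => .cons (h₁.set_of_notOcc (ho _ (by simp)))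
        (h₂.set_of_notOcc fun l hl => ho l (by simp [hl]))
end

mutual
  /-- Binding a free variable substitutes its value in every encoded term. -/
  theorem Encodes.set_of_free {H : Heap} {e a : ℕ} {v : HVal} {N : LF}
      (he : H e = some (.free a)) (hN : Encodes (H.set e v) e N) {l : ℕ} {M : LF}
      (h : Encodes H l M) : Encodes (H.set e v) l (M.msubst (single e N)) :=
    match h with
    | @Encodes.free _ _ b h => by
        by_cases hl : l = e
        · subst hl; simpa [LF.msubst, single] using hN
        · simpa [LF.msubst, single, hl] using
            Encodes.free (H := H.set e v) (l := l) (a := b) (by rw [H.set_of_ne hl, h])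
    | .bound h hM => .bound (by
        rw [H.set_of_ne (by rintro rfl; cases h.symm.trans he), h]) (Encodes.set_of_free he hN hM)
    | .str h hM => by
        rw [LF.msubst_apps]
        exact .str (by rw [H.set_of_ne (by rintro rfl; cases h.symm.trans he), h])
          (EncodesList.set_of_free he hN hM)
  theorem EncodesList.set_of_free {H : Heap} {e a : ℕ} {v : HVal} {N : LF}
      (he : H e = some (.free a)) (hN : Encodes (H.set e v) e N) {ls : List ℕ} {Ms : List LF}
      (h : EncodesList H ls Ms) :
      EncodesList (H.set e v) ls (Ms.map (LF.msubst (single e N))) :=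
    match h with
    | .nil => .nil
    | .cons h₁ h₂ => .cons (Encodes.set_of_free he hN h₁) (EncodesList.set_of_free he hN h₂)
end

/-! ### Prolog terms -/

mutual
  /-- `M` is a Prolog term of Prolog type `a` over the variables of `Δ`. -/
  inductive PTm (sg : Sig) (Δ : Ctx) : LF → ℕ → Prop
    | var {x a} : (x, LF.fam a) ∈ Δ → PTm sg Δ (.fv x) a
    | str {c Ms as a} : sg.Ctor c as a → PTms sg Δ Ms as → PTm sg Δ ((LF.cst c).apps Ms) a
  /-- Lists of Prolog terms of the given Prolog types. -/
  inductive PTms (sg : Sig) (Δ : Ctx) : List LF → List ℕ → Prop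
    | nil : PTms sg Δ [] []
    | cons {M a Ms as} : PTm sg Δ M a → PTms sg Δ Ms as → PTms sg Δ (M :: Ms) (a :: as)
end

section PTm

variable {sg : Sig} {Δ Δ₁ : Ctx}

theorem PTm.var_inv {x a : ℕ} (h : PTm sg Δ (.fv x) a) : (x, LF.fam a) ∈ Δ := by
  generalize e : LF.fv x = M at h
  cases h with
  | var h => cases e; exact h
  | str => exact absurd e.symm LF.cst_apps_ne_fv

theorem PTm.str_inv {c a : ℕ} {Ms : List LF} (h : PTm sg Δ ((LF.cst c).apps Ms) a) :
    ∃ as, sg.Ctor c as a ∧ PTms sg Δ Ms as := by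
  generalize e : (LF.cst c).apps Ms = M at h
  cases h with
  | var => exact absurd e LF.cst_apps_ne_fv
  | str hc h => obtain ⟨rfl, rfl⟩ := LF.cst_apps_inj e; exact ⟨_, hc, h⟩

mutual
  theorem PTm.msubst {θ : ℕ → LF} {M : LF} {a : ℕ} (h : PTm sg Δ M a) :
      (∀ x ∈ M.fvs, ∀ b, (x, LF.fam b) ∈ Δ → PTm sg Δ₁ (θ x) b) → PTm sg Δ₁ (M.msubst θ) a :=
    match h with
    | .var h => fun hθ => hθ _ (Finset.mem_singleton_self _) _ h
    | .str hc h => fun hθ => by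
        rw [LF.msubst_apps]
        exact .str hc (h.msubst fun M hM x hx => hθ x (LF.mem_fvs_apps.2 (.inr ⟨M, hM, hx⟩)))
  theorem PTms.msubst {θ : ℕ → LF} {Ms : List LF} {as : List ℕ} (h : PTms sg Δ Ms as) :
      (∀ M ∈ Ms, ∀ x ∈ M.fvs, ∀ b, (x, LF.fam b) ∈ Δ → PTm sg Δ₁ (θ x) b) →
        PTms sg Δ₁ (Ms.map (LF.msubst θ)) as :=
    match h with
    | .nil => fun _ => .nil
    | .cons h₁ h₂ => fun hθ => .cons (h₁.msubst (hθ _ (by simp)))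
        (h₂.msubst fun M hM => hθ M (by simp [hM]))
end

theorem PTm.weaken {M : LF} {a : ℕ} (h : PTm sg Δ M a) (hΔ : Δ ⊆ Δ₁) : PTm sg Δ₁ M a := by
  have := h.msubst (θ := .fv) (Δ₁ := Δ₁) fun x _ b hx => .var (hΔ hx)
  rwa [LF.msubst_fv] at this

theorem PTms.weaken {Ms : List LF} {as : List ℕ} (h : PTms sg Δ Ms as) (hΔ : Δ ⊆ Δ₁) :
    PTms sg Δ₁ Ms as := by
  induction Ms generalizing as with
  | nil => cases h; exact .nil
  | cons M Ms ih => cases h with | cons h₁ h₂ => exact .cons (h₁.weaken hΔ) (ih h₂)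

theorem PTms.append {Ms Ns : List LF} {as bs : List ℕ} (h : PTms sg Δ Ms as)
    (h₁ : PTms sg Δ Ns bs) : PTms sg Δ (Ms ++ Ns) (as ++ bs) := by
  induction Ms generalizing as with
  | nil => cases h; exact h₁
  | cons M Ms ih => cases h with | cons h₂ h₃ => exact .cons h₂ (ih h₃)

theorem PTms.length_eq {Ms : List LF} {as : List ℕ} (h : PTms sg Δ Ms as) :
    Ms.length = as.length := by
  induction Ms generalizing as with
  | nil => cases h; rfl
  | cons M Ms ih => cases h with | cons h₂ h₃ => simp [ih h₃]

theorem LF.inst_arrows (as : List ℕ) (a d : ℕ) (u : LF) :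
    (LF.arrows as a).inst d u = LF.arrows as a := by
  induction as generalizing d with
  | nil => rfl
  | cons b as ih => exact congrArg _ (ih (d + 1))

mutual
  theorem PTm.hasType {M : LF} {a : ℕ} (h : PTm sg Δ M a) : HasType sg Δ M (.fam a) :=
    match h with
    | .var h => .var h
    | .str hc h => h.hasType_apps (.cst hc.1)
  theorem PTms.hasType_apps {Ms : List LF} {as : List ℕ} (h : PTms sg Δ Ms as) :
      ∀ {N : LF} {a : ℕ}, HasType sg Δ N (LF.arrows as a) → HasType sg Δ (N.apps Ms) (.fam a) :=
    match h with
    | .nil => fun hN => hN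
    | .cons h₁ h₂ => fun hN => h₂.hasType_apps (by
        have := HasType.app hN h₁.hasType
        rwa [← LF.inst_arrows])
end

end PTm

theorem EncodesList.length_eq {H : Heap} {ls : List ℕ} {Ms : List LF} (h : EncodesList H ls Ms) :
    ls.length = Ms.length := by
  induction ls generalizing Ms with
  | nil => cases h; rfl
  | cons l ls ih => cases h with | cons _ h => simp [ih h]

theorem EncodesList.append {H : Heap} {ls ls₁ : List ℕ} {Ms Ms₁ : List LF}
    (h : EncodesList H ls Ms) (h₁ : EncodesList H ls₁ Ms₁) :
    EncodesList H (ls ++ ls₁) (Ms ++ Ms₁) := by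
  induction ls generalizing Ms with
  | nil => cases h; exact h₁
  | cons l ls ih => cases h with | cons h₂ h₃ => exact .cons h₂ (ih h₃)

/-! ### Evolution of the heap under binding -/

/-- `(Δ₁, H₁)` results from `(Δ, H)` by binding free variables to Prolog terms. -/
structure Ext (sg : Sig) (Δ : Ctx) (H : Heap) (Δ₁ : Ctx) (H₁ : Heap) : Prop where
  encodes : ∀ {l M}, Encodes H l M → Encodes H₁ l (M.msubst (readback H₁))
  typed : ∀ {x b}, (x, LF.fam b) ∈ Δ → PTm sg Δ₁ (readback H₁ x) b
  kept : ∀ {l v}, H l = some v → (∀ a, v ≠ .free a) → H₁ l = some v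

section Ext

variable {sg : Sig} {Δ Δ₁ Δ₂ : Ctx} {H H₁ H₂ : Heap}

theorem CtxOk.free (h : CtxOk sg Δ H) {x : ℕ} {A : LF} (hx : (x, A) ∈ Δ) :
    ∃ a, A = .fam a ∧ H x = some (.free a) := (h.2.1 x A).1 hx

theorem CtxOk.readback_eq (h : CtxOk sg Δ H) {x : ℕ} {A : LF} (hx : (x, A) ∈ Δ) :
    readback H x = .fv x := (h.free hx).elim fun _ h => readback_free h.2

theorem Ext.refl (h : CtxOk sg Δ H) : Ext sg Δ H Δ H :=
  ⟨fun hM => by rwa [hM.msubst_readback], fun hx => by rw [h.readback_eq hx]; exact .var hx,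
    fun h _ => h⟩

theorem Ext.msubst_readback (h : Ext sg Δ H Δ₁ H₁) {l : ℕ} {M : LF} (hM : Encodes H l M) :
    M.msubst (readback H₁) = readback H₁ l := (h.encodes hM).readback_eq.symm

/-- A later readback absorbs an earlier one on terms encoded before. -/
theorem Ext.msubst_msubst (h : Ext sg Δ H Δ₁ H₁) (h₁ : Ext sg Δ₁ H₁ Δ₂ H₂) {l : ℕ} {M : LF}
    (hM : Encodes H l M) :
    (M.msubst (readback H₁)).msubst (readback H₂) = M.msubst (readback H₂) := by
  rw [LF.msubst_msubst]
  refine LF.msubst_congr fun x hx => ?_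
  obtain ⟨a, hx⟩ := hM.free_of_mem x hx
  exact h₁.msubst_readback (h.encodes (Encodes.free hx))

theorem Ext.map_msubst_msubst (h : Ext sg Δ H Δ₁ H₁) (h₁ : Ext sg Δ₁ H₁ Δ₂ H₂) {ls : List ℕ}
    {Ms : List LF} (hM : EncodesList H ls Ms) :
    (Ms.map (LF.msubst (readback H₁))).map (LF.msubst (readback H₂)) =
      Ms.map (LF.msubst (readback H₂)) := by
  induction ls generalizing Ms with
  | nil => cases hM; rfl
  | cons l ls ih =>
    cases hM with
    | cons hM hMs => simp only [List.map_cons, h.msubst_msubst h₁ hM, ih hMs]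

theorem Ext.trans (hc : CtxOk sg Δ H) (h : Ext sg Δ H Δ₁ H₁) (h₁ : Ext sg Δ₁ H₁ Δ₂ H₂) :
    Ext sg Δ H Δ₂ H₂ := by
  refine ⟨fun hM => ?_, fun {x b} hx => ?_, fun hv hf => h₁.kept (h.kept hv hf) hf⟩
  · rw [← h.msubst_msubst h₁ hM]; exact h₁.encodes (h.encodes hM)
  · obtain ⟨a, -, hf⟩ := hc.free hx
    have := (h.typed hx).msubst (θ := readback H₂) fun y _ b hy => h₁.typed hy
    have e := h.msubst_msubst h₁ (Encodes.free hf)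
    simp only [LF.msubst] at e
    rwa [e] at this

theorem Ext.subOk (hc : CtxOk sg Δ H) (h : Ext sg Δ H Δ₁ H₁) :
    SubOk sg Δ (readback H₁) Δ₁ :=
  ⟨readback_lc H₁, fun hx => by
    obtain ⟨a, rfl, -⟩ := hc.free hx
    exact (h.typed hx).hasType⟩

theorem Ext.encodesList (h : Ext sg Δ H Δ₁ H₁) {ls : List ℕ} {Ms : List LF}
    (hM : EncodesList H ls Ms) : EncodesList H₁ ls (Ms.map (LF.msubst (readback H₁))) := by
  induction ls generalizing Ms with
  | nil => cases hM; exact .nil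
  | cons l ls ih => cases hM with | cons h₁ h₂ => exact .cons (h.encodes h₁) (ih h₂)

theorem Ext.pTm (h : Ext sg Δ H Δ₁ H₁) {M : LF} {a : ℕ} (hM : PTm sg Δ M a) :
    PTm sg Δ₁ (M.msubst (readback H₁)) a := hM.msubst fun _ _ _ hx => h.typed hx

theorem Ext.pTms (h : Ext sg Δ H Δ₁ H₁) {Ms : List LF} {as : List ℕ} (hM : PTms sg Δ Ms as) :
    PTms sg Δ₁ (Ms.map (LF.msubst (readback H₁))) as :=
  hM.msubst fun _ _ _ _ _ hx => h.typed hx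

theorem Ctx.mem_remove {x y : ℕ} {A : LF} : (y, A) ∈ Δ.remove x ↔ (y, A) ∈ Δ ∧ y ≠ x := by
  simp [Ctx.remove]

theorem CtxOk.set_bound (h : CtxOk sg Δ H) {e a : ℕ} {v : HVal} (he : H e = some (.free a))
    (hv : ∀ b, v ≠ .free b) : CtxOk sg (Δ.remove e) (H.set e v) := by
  refine ⟨h.1.sublist (List.filter_sublist.map _), fun x A => ?_, fun x b hx => ?_⟩
  · rw [Ctx.mem_remove, h.2.1]
    by_cases hx : x = e
    · subst hx; simp [Heap.set_self, hv]
    · simp [H.set_of_ne hx, hx]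
  · by_cases hxe : x = e
    · subst hxe; rw [Heap.set_self] at hx; exact absurd (Option.some.inj hx) (hv b)
    · rw [H.set_of_ne hxe] at hx; exact h.2.2 x b hx

/-- A term encoded after `e` has been bound does not mention `e`. -/
theorem PTm.remove {e a : ℕ} {v : HVal} {l : ℕ} {N : LF} (hN : Encodes (H.set e v) l N)
    (hv : ∀ b, v ≠ .free b) (h : PTm sg Δ N a) : PTm sg (Δ.remove e) N a := by
  have := h.msubst (θ := .fv) (Δ₁ := Δ.remove e) fun x hx b hb => .var <| Ctx.mem_remove.2
    ⟨hb, by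
      rintro rfl
      obtain ⟨b, hb⟩ := hN.free_of_mem x hx
      rw [Heap.set_self] at hb
      exact hv b (Option.some.inj hb)⟩
  rwa [LF.msubst_fv] at this

/-- Binding one variable to an encoded term; that the term is encoded on the new heap is what the
occurs check guarantees. -/
theorem Ext.set_bound (h : CtxOk sg Δ H) {e a : ℕ} {v : HVal} {N : LF}
    (he : H e = some (.free a)) (hv : ∀ b, v ≠ .free b) (hN : Encodes (H.set e v) e N)
    (hT : PTm sg Δ N a) : Ext sg Δ H (Δ.remove e) (H.set e v) := by
  have key : ∀ {y b}, H y = some (.free b) → single e N y = readback (H.set e v) y := by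
    intro y b hy
    by_cases hye : y = e
    · subst hye; rw [hN.readback_eq]; simp [single]
    · rw [readback_free (a := b) (by rw [H.set_of_ne hye, hy])]; simp [single, hye]
  refine ⟨fun {l M} hM => ?_, fun {x b} hx => ?_, fun {l w} hl hf => ?_⟩
  · rw [LF.msubst_congr (θ₁ := single e N) fun x hx =>
      (hM.free_of_mem x hx).elim fun _ hx => (key hx).symm]
    exact Encodes.set_of_free he hN hM
  · obtain ⟨c, hbc, hf⟩ := h.free hx
    cases hbc
    rw [← key hf]
    by_cases hxe : x = e
    · subst hxe
      cases hf.symm.trans he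
      simpa [single] using hT.remove hN hv
    · simpa [single, hxe] using PTm.var (sg := sg) (Ctx.mem_remove.2 ⟨hx, hxe⟩)
  · rw [H.set_of_ne (by rintro rfl; cases hl.symm.trans he; exact hf a rfl), hl]

end Ext

/-! ### Well-typed heaps -/

section HeapInv

variable {k : ℕ} {sg : Sig} {Ξ : ℕ → Option (Ty k)} {Δ Δ₁ : Ctx} {H H₁ : Heap}
  {Ψ Ψ₁ : List (ℕ × Ty k)}

/-- The value at location `l` has type `τ`.  Locations of singleton type encode the term of the
type, which makes the part of the heap below them acyclic; no order is imposed on the heap type. -/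
inductive LocOk (sg : Sig) (Ξ : ℕ → Option (Ty k)) (Δ : Ctx) (H : Heap) (Ψ : List (ℕ × Ty k))
    (l : ℕ) : Ty k → Prop
  | sing {M a} : Encodes H l M → PTm sg Δ M a → LocOk sg Ξ Δ H Ψ l (.sing M a)
  | clos {w l₁ Ms τ As Γ} : H l = some (.clos w l₁ Ms) →
      WordTy sg Ξ Δ Ψ (w.msubst (readback H)) τ → τ.LC →
      WordTy sg Ξ Δ Ψ (((Word.cloc l₁).apps Ms).msubst (readback H))
        (.pis As (.neg (RTy.set Γ Reg.env τ))) →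
      LocOk sg Ξ Δ H Ψ l (.pis As (.neg Γ))
  | tup {ws τs} : H l = some (.tup ws) →
      List.Forall₂ (fun w τ => WordTy sg Ξ Δ Ψ (w.msubst (readback H)) τ) ws τs →
      LocOk sg Ξ Δ H Ψ l (.tup τs)

/-- All values on the heap that are mentioned in the heap type `Ψ` have their types. -/
def HeapInv (sg : Sig) (Ξ : ℕ → Option (Ty k)) (Δ : Ctx) (H : Heap) (Ψ : List (ℕ × Ty k)) : Prop :=
  ∀ l τ, (l, τ) ∈ Ψ → LocOk sg Ξ Δ H Ψ l τ

/-- Names in a well-typed word stand for terms on the heap. -/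
theorem WordTy.encodes_of_mem (hc : CtxOk sg Δ H) {w : Word} {τ : Ty k}
    (h : WordTy sg Ξ Δ Ψ (w.msubst (readback H)) τ) {x : ℕ} (hx : x ∈ w.fvs) :
    ∃ M, Encodes H x M := by
  by_contra hn
  have e : readback H x = .fv x := by rw [readback, dif_neg hn]
  obtain ⟨A, hA⟩ := h.scoped.1 x (Word.mem_fvs_msubst.2 ⟨x, hx, by simp [e, LF.fvs]⟩)
  obtain ⟨a, -, hf⟩ := hc.free hA
  exact hn ⟨_, .free hf⟩

theorem WordTy.mono (hc : CtxOk sg Δ H) (hH : H.Le H₁) (hΔ : Δ ⊆ Δ₁) (hΨ : Ψ ⊆ Ψ₁) {w : Word}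
    {τ : Ty k} (h : WordTy sg Ξ Δ Ψ (w.msubst (readback H)) τ) :
    WordTy sg Ξ Δ₁ Ψ₁ (w.msubst (readback H₁)) τ := by
  rw [Word.msubst_congr (θ₁ := readback H) fun x hx => ?_]
  · exact h.weaken hΔ hΨ
  · obtain ⟨M, hM⟩ := h.encodes_of_mem hc hx
    rw [hM.readback_eq, (hM.mono hH).readback_eq]

theorem LocOk.mono (hc : CtxOk sg Δ H) (hH : H.Le H₁) (hΔ : Δ ⊆ Δ₁) (hΨ : Ψ ⊆ Ψ₁) {l : ℕ}
    {τ : Ty k} (h : LocOk sg Ξ Δ H Ψ l τ) : LocOk sg Ξ Δ₁ H₁ Ψ₁ l τ := by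
  cases h with
  | sing h₁ h₂ => exact .sing (h₁.mono hH) (h₂.weaken hΔ)
  | clos h₁ h₂ h₃ h₄ =>
    exact .clos (hH _ _ h₁) (h₂.mono hc hH hΔ hΨ) h₃ (h₄.mono hc hH hΔ hΨ)
  | tup h₁ h₂ => exact .tup (hH _ _ h₁) (h₂.imp fun _ _ h => h.mono hc hH hΔ hΨ)

theorem HeapInv.mono (hc : CtxOk sg Δ H) (hH : H.Le H₁) (hΔ : Δ ⊆ Δ₁)
    (h : HeapInv sg Ξ Δ H Ψ) : HeapInv sg Ξ Δ₁ H₁ Ψ :=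
  fun l τ hl => (h l τ hl).mono hc hH hΔ (List.Subset.refl _)

theorem HeapInv.cons (hc : CtxOk sg Δ H) (h : HeapInv sg Ξ Δ H Ψ) {l : ℕ} {τ : Ty k}
    (hl : LocOk sg Ξ Δ H Ψ l τ) : HeapInv sg Ξ Δ H ((l, τ) :: Ψ) := by
  have mono : ∀ {l τ}, LocOk sg Ξ Δ H Ψ l τ → LocOk sg Ξ Δ H ((_, _) :: Ψ) l τ := fun h =>
    h.mono hc (fun _ _ h => h) (List.Subset.refl _) (List.subset_cons_self (l, τ) _)
  intro l₁ τ₁ h₁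
  rcases List.mem_cons.1 h₁ with e | h₁
  · cases e; exact mono hl
  · exact mono (h _ _ h₁)

/-- `[θ]Ψ` -/
def heapTyMsubst (Ψ : List (ℕ × Ty k)) (θ : ℕ → LF) : List (ℕ × Ty k) :=
  Ψ.map fun p => (p.1, p.2.msubst θ)

theorem WordTy.ext (hsg : sg.Valid) (hΞ : ∀ l τ, Ξ l = some τ → ∀ θ, τ.msubst θ = τ)
    (hc : CtxOk sg Δ H) (hE : Ext sg Δ H Δ₁ H₁) {w : Word} {τ : Ty k}
    (h : WordTy sg Ξ Δ Ψ (w.msubst (readback H)) τ) :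
    WordTy sg Ξ Δ₁ (heapTyMsubst Ψ (readback H₁)) (w.msubst (readback H₁))
      (τ.msubst (readback H₁)) := by
  have := h.msubst hsg hΞ (hE.subOk hc) (Ψ₁ := heapTyMsubst Ψ (readback H₁)) fun l τ hl =>
    List.mem_map.2 ⟨_, hl, rfl⟩
  rwa [Word.msubst_msubst, Word.msubst_congr (θ₁ := readback H₁) fun x hx => ?_] at this
  obtain ⟨M, hM⟩ := h.encodes_of_mem hc hx
  rw [hM.readback_eq, hE.msubst_readback hM]

theorem HeapInv.ext (hsg : sg.Valid) (hΞ : ∀ l τ, Ξ l = some τ → ∀ θ, τ.msubst θ = τ)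
    (hc : CtxOk sg Δ H) (hE : Ext sg Δ H Δ₁ H₁) (h : HeapInv sg Ξ Δ H Ψ) :
    HeapInv sg Ξ Δ₁ H₁ (heapTyMsubst Ψ (readback H₁)) := by
  intro l τ hl
  obtain ⟨⟨l, τ⟩, hl', e⟩ := List.mem_map.1 hl
  cases e
  cases h l τ hl' with
  | sing h₁ h₂ => exact .sing (hE.encodes h₁) (hE.pTm h₂)
  | clos h₁ h₂ h₃ h₄ =>
    have h₅ := h₄.ext hsg hΞ hc hE
    rw [Ty.msubst_pis] at h₅ ⊢
    refine .clos (hE.kept h₁ fun _ h => nomatch h) (h₂.ext hsg hΞ hc hE)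
      (h₃.msubst (readback_lc H₁)) ?_
    rwa [show Ty.msubst (.neg (RTy.set _ Reg.env _)) (readback H₁) = .neg _ from
      congrArg Ty.neg (RTy.msubst_set _ _ _ _)] at h₅
  | @tup ws τs h₁ h₂ =>
    change LocOk sg Ξ Δ₁ H₁ _ l (Ty.map _ 0 (.tup τs))
    rw [Ty.map_tup]
    refine .tup (hE.kept h₁ fun _ h => nomatch h) (List.forall₂_map_right_iff.2 ?_)
    exact h₂.imp fun _ _ h => h.ext hsg hΞ hc hE

end HeapInv

/-! ### Trails -/

/-- Every frame of the trail holds a well-typed failure continuation once the bindings are undone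
down to that frame. -/
inductive TrailInv {k : ℕ} (sg : Sig) (Ξ : ℕ → Option (Ty k)) : Ctx → Heap → Trail → Prop
  | nil {Δ H} : TrailInv sg Ξ Δ H []
  | cons {Δ H Δ₁ H₁ Ψ₁ τ F T} : Unwind H Δ F.bindings Δ₁ H₁ → TrailInv sg Ξ Δ₁ H₁ T →
      CtxOk sg Δ₁ H₁ → HeapInv sg Ξ Δ₁ H₁ Ψ₁ →
      WordTy sg Ξ Δ₁ Ψ₁ (F.env.msubst (readback H₁)) τ →
      WordTy sg Ξ Δ₁ Ψ₁ (((Word.cloc F.label).apps F.args).msubst (readback H₁))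
        (.neg (RTy.set (fun _ => none) Reg.env τ)) →
      TrailInv sg Ξ Δ H (F :: T)

section Trail

variable {k : ℕ} {sg : Sig} {Ξ : ℕ → Option (Ty k)} {Δ Δ₁ : Ctx} {H H₁ : Heap}

theorem CtxOk.perm (h : CtxOk sg Δ H) (hp : Δ.Perm Δ₁) : CtxOk sg Δ₁ H :=
  ⟨(hp.map _).nodup_iff.1 h.1, fun x A => hp.symm.mem_iff.trans (h.2.1 x A), h.2.2⟩

/-- Unwinding declares variables again at the front of the context, so contexts are determined only
up to the order of their declarations. -/
theorem Unwind.perm {t : List (ℕ × ℕ)} {Δ' : Ctx} (h : Unwind H Δ t Δ₁ H₁) (hp : Δ.Perm Δ') :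
    ∃ Δ₁', Unwind H Δ' t Δ₁' H₁ ∧ Δ₁.Perm Δ₁' := by
  induction h generalizing Δ' with
  | nil => exact ⟨_, .nil, hp⟩
  | cons hl _ ih =>
    obtain ⟨Δ₁', h₁, h₂⟩ := ih (hp.cons _)
    exact ⟨Δ₁', .cons hl h₁, h₂⟩

theorem Unwind.det {t : List (ℕ × ℕ)} {Δ₂ : Ctx} {H₂ : Heap} (h : Unwind H Δ t Δ₁ H₁)
    (h₂ : Unwind H Δ t Δ₂ H₂) : Δ₁ = Δ₂ ∧ H₁ = H₂ := by
  induction h with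
  | nil => cases h₂; exact ⟨rfl, rfl⟩
  | cons _ _ ih => cases h₂ with | cons _ h₂ => exact ih h₂

theorem TrailInv.perm {T : Trail} (h : TrailInv sg Ξ Δ H T) (hp : Δ.Perm Δ₁) :
    TrailInv sg Ξ Δ₁ H T := by
  induction h generalizing Δ₁ with
  | nil => exact .nil
  | cons hu _ hc hh hw hl ih =>
    obtain ⟨Δ₂, hu', hp'⟩ := hu.perm hp
    exact .cons hu' (ih hp') (hc.perm hp') (hh.mono hc (fun _ _ h => h) hp'.subset)
      (hw.weaken hp'.subset (List.Subset.refl _)) (hl.weaken hp'.subset (List.Subset.refl _))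

/-- Recording a binding on the trail compensates for it. -/
theorem TrailInv.set_bound {T : Trail} (h : TrailInv sg Ξ Δ H T) (hc : CtxOk sg Δ H) {e a : ℕ}
    (he : H e = some (.free a)) (v : HVal) :
    TrailInv sg Ξ (Δ.remove e) (H.set e v) (uptrail e a T) := by
  have hmem : (e, LF.fam a) ∈ Δ := (hc.2.1 _ _).2 ⟨a, rfl, he⟩
  have hp : Δ.Perm ((e, .fam a) :: Δ.remove e) := by
    have nd : Δ.Nodup := List.Nodup.of_map _ hc.1
    refine (List.perm_ext_iff_of_nodup nd (List.nodup_cons.2 ⟨?_, nd.filter _⟩)).2 ?_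
    · intro h; exact (Ctx.mem_remove.1 h).2 rfl
    · rintro ⟨x, A⟩
      rw [List.mem_cons]
      change _ ↔ _ ∨ (x, A) ∈ Ctx.remove Δ e
      rw [Ctx.mem_remove]
      by_cases hx : x = e
      · subst hx
        simp only [ne_eq, not_true, and_false, or_false, Prod.mk.injEq, true_and]
        refine ⟨fun h => ?_, fun h => h ▸ hmem⟩
        obtain ⟨b, rfl, hb⟩ := hc.free h
        cases hb.symm.trans he; rfl
      · simp [hx]
  have hH : Function.update (H.set e v) e (some (.free a)) = H := by
    simp [Heap.set, ← he]
  cases h.perm hp with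
  | nil => exact .nil
  | cons hu h₁ h₂ h₃ h₄ h₅ =>
    exact .cons (.cons (H.set_self e v) (by rw [hH]; exact hu)) h₁ h₂ h₃ h₄ h₅

/-- The context after the value `v` has been allocated at location `l`. -/
def allocCtx (l : ℕ) : HVal → Ctx → Ctx
  | .free a, Δ => (l, .fam a) :: Δ
  | _, Δ => Δ

theorem subset_allocCtx (l : ℕ) (v : HVal) (Δ : Ctx) : Δ ⊆ allocCtx l v Δ := by
  cases v <;> simp [allocCtx]

theorem CtxOk.alloc (h : CtxOk sg Δ H) {l : ℕ} (hl : H l = none) {v : HVal}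
    (hv : ∀ a, v = .free a → Decl.ptype a ∈ sg) : CtxOk sg (allocCtx l v Δ) (H.set l v) := by
  have hne : ∀ {x A}, (x, A) ∈ Δ → x ≠ l := by
    rintro x A hx rfl
    obtain ⟨a, -, ha⟩ := h.free hx
    cases hl.symm.trans ha
  refine ⟨?_, fun x A => ?_, fun x a hx => ?_⟩
  · cases v with
    | free a =>
      refine List.nodup_cons.2 ⟨fun hm => ?_, h.1⟩
      obtain ⟨⟨x, A⟩, hx, rfl⟩ := List.mem_map.1 hm
      exact hne hx rfl
    | _ => exact h.1
  · by_cases hx : x = l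
    · subst hx
      have hn : ∀ A, (x, A) ∉ Δ := fun A h => hne h rfl
      rw [Heap.set_self]
      cases v <;> simp [allocCtx, hn]
    · rw [H.set_of_ne hx, ← h.2.1]
      cases v <;> simp [allocCtx, hx]
  · by_cases hxl : x = l
    · subst hxl; rw [Heap.set_self] at hx; exact hv a (Option.some.inj hx)
    · rw [H.set_of_ne hxl] at hx; exact h.2.2 x a hx

/-- Allocation at a location that is not in use commutes with unwinding. -/
theorem Unwind.alloc {t : List (ℕ × ℕ)} {Δ' : Ctx} {l : ℕ} {v : HVal}
    (h : Unwind H Δ t Δ₁ H₁) (hl : H l = none) (hp : Δ'.Perm (allocCtx l v Δ)) :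
    ∃ Δ₁', Unwind (H.set l v) Δ' t Δ₁' (H₁.set l v) ∧ Δ₁'.Perm (allocCtx l v Δ₁) ∧
      H₁ l = none := by
  induction h generalizing Δ' with
  | nil => exact ⟨_, .nil, hp, hl⟩
  | @cons H Δ l₁ a t Δ₁ H₁ w hw _ ih =>
    have hne : l₁ ≠ l := by rintro rfl; cases hl.symm.trans hw
    have hp' : List.Perm ((l₁, LF.fam a) :: Δ') (allocCtx l v ((l₁, LF.fam a) :: Δ)) := by
      refine (hp.cons _).trans ?_
      cases v with
      | free b => exact List.Perm.swap ..
      | _ => exact List.Perm.refl _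
    obtain ⟨Δ₁', h₁, h₂, h₃⟩ := ih (by rw [Function.update_of_ne hne.symm, hl]) hp'
    refine ⟨Δ₁', .cons (v := w) (by rw [Heap.set_of_ne H hne, hw]) ?_, h₂, h₃⟩
    rwa [Heap.set, Function.update_comm hne.symm]

theorem TrailInv.alloc {T : Trail} {Δ' : Ctx} {l : ℕ} {v : HVal} (h : TrailInv sg Ξ Δ H T)
    (hl : H l = none) (hv : ∀ a, v = .free a → Decl.ptype a ∈ sg)
    (hp : Δ'.Perm (allocCtx l v Δ)) : TrailInv sg Ξ Δ' (H.set l v) T := by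
  induction h generalizing Δ' with
  | nil => exact .nil
  | cons hu _ hc hh hw hf ih =>
    obtain ⟨Δ₁', hu', hp', hl'⟩ := hu.alloc hl hp
    have hs := List.Subset.trans (subset_allocCtx l v _) hp'.symm.subset
    have hH := Heap.le_set hl' v
    exact .cons hu' (ih hl' hp') ((hc.alloc hl' hv).perm hp'.symm) (hh.mono hc hH hs)
      (hw.mono hc hH hs (List.Subset.refl _)) (hf.mono hc hH hs (List.Subset.refl _))

/-! ### Unification on the heap -/

/-- The conditions on the heap and the trail that do not refer to registers. -/
structure StoreInv (sg : Sig) (Ξ : ℕ → Option (Ty k)) (Δ : Ctx) (H : Heap) (T : Trail) : Prop where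
  ctx : CtxOk sg Δ H
  trail : TrailInv sg Ξ Δ H T

theorem StoreInv.set_bound {T : Trail} (h : StoreInv sg Ξ Δ H T) {e a : ℕ} {v : HVal} {N : LF}
    (he : H e = some (.free a)) (hv : ∀ b, v ≠ .free b) (hN : Encodes (H.set e v) e N)
    (hT : PTm sg Δ N a) : StoreInv sg Ξ (Δ.remove e) (H.set e v) (uptrail e a T) ∧
      Ext sg Δ H (Δ.remove e) (H.set e v) ∧
      (LF.fv e).msubst (readback (H.set e v)) = N.msubst (readback (H.set e v)) :=
  ⟨⟨h.ctx.set_bound he hv, h.trail.set_bound h.ctx he v⟩, .set_bound h.ctx he hv hN hT,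
    hN.readback_eq.trans hN.msubst_readback.symm⟩

theorem Encodes.free_inv {l a : ℕ} {M : LF} (h : Encodes H l M) (hl : H l = some (.free a)) :
    M = .fv l := h.det (.free hl)

theorem Encodes.str_inv {l c : ℕ} {ls : List ℕ} {M : LF} (h : Encodes H l M)
    (hl : H l = some (.str c ls)) : ∃ Ms, M = (LF.cst c).apps Ms ∧ EncodesList H ls Ms := by
  cases h with
  | free h => cases hl.symm.trans h
  | bound h => cases hl.symm.trans h
  | str h hM => cases hl.symm.trans h; exact ⟨_, rfl, hM⟩

theorem CtxOk.free_eq (h : CtxOk sg Δ H) {x a b : ℕ} (hx : PTm sg Δ (.fv x) a)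
    (hf : H x = some (.free b)) : b = a := by
  obtain ⟨c, e, hc⟩ := h.free hx.var_inv
  cases e; cases hc.symm.trans hf; rfl

mutual
  /-- Successful unification on the heap equates the terms encoded at the two locations. -/
  theorem Unify.sound (hsg : sg.Valid) {Δ : Ctx} {H : Heap} {T : Trail} {l₁ l₂ : ℕ}
      {res : Option (Ctx × Heap × Trail)} (h : Unify Δ H T l₁ l₂ res) :
      ∀ {Δ₁ H₁ T₁ M N a}, res = some (Δ₁, H₁, T₁) → StoreInv sg Ξ Δ H T → Encodes H l₁ M →
        Encodes H l₂ N → PTm sg Δ M a → PTm sg Δ N a →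
        StoreInv sg Ξ Δ₁ H₁ T₁ ∧ Ext sg Δ H Δ₁ H₁ ∧
          M.msubst (readback H₁) = N.msubst (readback H₁) :=
    match h with
    | .eq h₁ h₂ => fun e hs hM hN _ _ => by
        cases e
        refine ⟨hs, .refl hs.ctx, ?_⟩
        rw [(h₁.encodes hM).det (h₂.encodes hN)]
    | .freeR h₁ h₂ hf ho => fun e hs hM hN tM tN => by
        cases e
        cases (h₂.encodes hN).free_inv hf
        cases hs.ctx.free_eq tN hf
        obtain ⟨h₁, h₂, h₃⟩ := hs.set_bound hf (by rintro _ ⟨⟩)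
          (.bound (Heap.set_self ..) (hM.set_of_notOcc ho)) tM
        exact ⟨h₁, h₂, h₃.symm⟩
    | .freeL h₁ h₂ hf ho => fun e hs hM hN tM tN => by
        cases e
        cases (h₁.encodes hM).free_inv hf
        cases hs.ctx.free_eq tM hf
        exact hs.set_bound hf (by rintro _ ⟨⟩)
          (.bound (Heap.set_self ..) (hN.set_of_notOcc ho)) tN
    | .str h₁ h₂ _ hc₁ hc₂ h => fun e hs hM hN tM tN => by
        obtain ⟨Ms, rfl, hMs⟩ := (h₁.encodes hM).str_inv hc₁
        obtain ⟨Ns, rfl, hNs⟩ := (h₂.encodes hN).str_inv hc₂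
        obtain ⟨as, c₁, tMs⟩ := tM.str_inv
        obtain ⟨bs, c₂, tNs⟩ := tN.str_inv
        obtain ⟨rfl, -⟩ := c₁.unique hsg c₂
        obtain ⟨h₁, h₂, h₃⟩ := h.sound hsg e hs hMs hNs tMs tNs
        exact ⟨h₁, h₂, by rw [LF.msubst_apps, LF.msubst_apps, h₃]⟩
    | .occL _ _ _ _ _ => fun e => nomatch e
    | .occR _ _ _ _ _ => fun e => nomatch e
    | .clash _ _ _ _ _ => fun e => nomatch e
  theorem UnifyArgs.sound (hsg : sg.Valid) {Δ : Ctx} {H : Heap} {T : Trail} {ls₁ ls₂ : List ℕ}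
      {res : Option (Ctx × Heap × Trail)} (h : UnifyArgs Δ H T ls₁ ls₂ res) :
      ∀ {Δ₁ H₁ T₁ Ms Ns as}, res = some (Δ₁, H₁, T₁) → StoreInv sg Ξ Δ H T →
        EncodesList H ls₁ Ms → EncodesList H ls₂ Ns → PTms sg Δ Ms as → PTms sg Δ Ns as →
        StoreInv sg Ξ Δ₁ H₁ T₁ ∧ Ext sg Δ H Δ₁ H₁ ∧
          Ms.map (LF.msubst (readback H₁)) = Ns.map (LF.msubst (readback H₁)) :=
    match h with
    | .nil => fun e hs hM hN _ _ => by
        cases e; cases hM; cases hN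
        exact ⟨hs, .refl hs.ctx, rfl⟩
    | .cons h₁ h₂ => fun e hs hM hN tM tN => by
        cases hM with
        | cons hM hMs =>
        cases hN with
        | cons hN hNs =>
        cases tM with
        | cons tM tMs =>
        cases tN with
        | cons tN tNs =>
        obtain ⟨hs₁, hE₁, e₁⟩ := h₁.sound hsg rfl hs hM hN tM tN
        obtain ⟨hs₂, hE₂, e₂⟩ := h₂.sound hsg e hs₁ (hE₁.encodesList hMs) (hE₁.encodesList hNs)
          (hE₁.pTms tMs) (hE₁.pTms tNs)
        refine ⟨hs₂, hE₁.trans hs.ctx hE₂, ?_⟩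
        rw [hE₁.map_msubst_msubst hE₂ hMs, hE₁.map_msubst_msubst hE₂ hNs] at e₂
        rw [List.map_cons, List.map_cons, e₂, ← hE₁.msubst_msubst hE₂ hM,
          ← hE₁.msubst_msubst hE₂ hN, e₁]
    | .fail _ => fun e => nomatch e
end

end Trail

/-! ### The machine invariant -/

section Machine

variable {k : ℕ} {sg : Sig} {Ξ : ℕ → Option (Ty k)}

/-- The conditions common to all machine states, for a static context `Δ₀` and a static register
file type `Γ` that are read under the substitution `θ` for the names of `Δ₀`. -/
structure RegInv (sg : Sig) (Ξ : ℕ → Option (Ty k)) (Ψ : List (ℕ × Ty k)) (Δ₀ : Ctx) (Γ : RTy k)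
    (θ : ℕ → LF) (T : Trail) (Δ : Ctx) (H : Heap) (R : Reg k → Option Word) : Prop where
  store : StoreInv sg Ξ Δ H T
  heap : HeapInv sg Ξ Δ H Ψ
  sub : SubOk sg Δ₀ θ Δ
  regs : ∀ r τ, Γ r = some τ → ∃ w, R r = some w ∧
    WordTy sg Ξ Δ Ψ (w.msubst (readback H)) (τ.msubst θ)

/-- The invariant of the machine.  The static typing derivation of the current block is kept as it
is, and the state is an instance of it under a substitution `θ`. -/
inductive Inv (sg : Sig) (Ξ : ℕ → Option (Ty k)) : State k → Prop
  | run {m Ψ Δ₀ Γ θ I} : CodeSecOk sg m.code Ξ →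
      RegInv sg Ξ Ψ Δ₀ Γ θ m.trail m.ctx m.heap m.regs → InstrOk sg Ξ Δ₀ Γ I →
      I.msubst θ = m.instr → Inv sg Ξ (.run m)
  | read {m Ψ Δ₀ Γ θ I J ls c Ms Ns as} : CodeSecOk sg m.code Ξ →
      RegInv sg Ξ Ψ Δ₀ Γ θ m.trail m.ctx m.heap m.regs → SpineOk sg Ξ Δ₀ Γ I J →
      I.msubst θ = m.instr →
      Binding.msubst J θ = .str ((LF.cst c).apps (Ms ++ Ns)) c Ms as →
      EncodesList m.heap ls Ns → PTms sg m.ctx Ns as → Inv sg Ξ (.read m ls)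
  | write {m Ψ Δ₀ Γ θ I J c l ls x Ms as₁ as₂ a} : CodeSecOk sg m.code Ξ →
      RegInv sg Ξ Ψ Δ₀ Γ θ m.trail m.ctx m.heap m.regs → SpineOk sg Ξ Δ₀ Γ I J →
      I.msubst θ = m.instr → Binding.msubst J θ = .str (.fv x) c Ms as₂ →
      sg.Ctor c (as₁ ++ as₂) a → EncodesList m.heap ls Ms → PTms sg m.ctx Ms as₁ →
      Encodes m.heap l (.fv x) → PTm sg m.ctx (.fv x) a → Inv sg Ξ (.write m c l ls)
  | twrite {m Ψ Δ₀ Γ θ I r n ws τs₁ τs₂} : CodeSecOk sg m.code Ξ →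
      RegInv sg Ξ Ψ Δ₀ Γ θ m.trail m.ctx m.heap m.regs →
      TupleOk sg Ξ Δ₀ Γ I τs₂ r (.tup (τs₁ ++ τs₂)) → τs₂.length = n → I.msubst θ = m.instr →
      List.Forall₂ (fun w τ => WordTy sg Ξ m.ctx Ψ (w.msubst (readback m.heap)) (τ.msubst θ))
        ws τs₁ → Inv sg Ξ (.twrite m r n ws)

/-! ### Well-typed states satisfy the invariant -/

theorem LocOk.sing_inv {Δ : Ctx} {H : Heap} {Ψ : List (ℕ × Ty k)} {l : ℕ} {M : LF} {a : ℕ}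
    (h : LocOk sg Ξ Δ H Ψ l (.sing M a)) : Encodes H l M ∧ PTm sg Δ M a := by
  generalize e : Ty.sing M a = τ at h
  cases h with
  | sing h₁ h₂ => cases e; exact ⟨h₁, h₂⟩
  | @clos _ _ _ _ As => cases As <;> cases e
  | tup => cases e

theorem LocOk.tup_inv {Δ : Ctx} {H : Heap} {Ψ : List (ℕ × Ty k)} {l : ℕ} {τs : List (Ty k)}
    (h : LocOk sg Ξ Δ H Ψ l (.tup τs)) : ∃ ws, H l = some (.tup ws) ∧
      List.Forall₂ (fun w τ => WordTy sg Ξ Δ Ψ (w.msubst (readback H)) τ) ws τs := by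
  generalize e : Ty.tup τs = τ at h
  cases h with
  | sing => cases e
  | @clos _ _ _ _ As => cases As <;> cases e
  | tup h₁ h₂ => cases e; exact ⟨_, h₁, h₂⟩

theorem LocsTy.encodes {Δ : Ctx} {H : Heap} {Ψ : List (ℕ × Ty k)} (hH : HeapInv sg Ξ Δ H Ψ)
    {ls : List ℕ} {Ms : List LF} {as : List ℕ} (h : LocsTy Ψ ls Ms as) :
    EncodesList H ls Ms ∧ PTms sg Δ Ms as := by
  induction h with
  | nil => exact ⟨.nil, .nil⟩
  | cons hl _ ih =>
    obtain ⟨h₁, h₂⟩ := (hH _ _ hl).sing_inv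
    exact ⟨.cons h₁ ih.1, .cons h₂ ih.2⟩

theorem HeapOk.heapInv {Δ : Ctx} {H : Heap} {Ψ : List (ℕ × Ty k)} (hc : CtxOk sg Δ H)
    (h : HeapOk sg Ξ Δ H Ψ) : HeapInv sg Ξ Δ H Ψ := by
  induction h with
  | nil => exact fun _ _ h => nomatch h
  | @cons Ψ l v τ _ hl hv _ ih =>
    refine ih.cons hc ?_
    generalize e : v.msubst (readback H) = u at hv
    cases hv with
    | @clos w l₁ Ms τ As Γ h₁ _ h₂ h₃ =>
      cases v with
      | clos w' l' Ms' =>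
        cases e
        refine .clos hl h₁ h₂ ?_
        rw [Word.msubst_apps]; exact h₃
      | _ => cases e
    | tup h =>
      cases v with
      | tup ws =>
        cases e
        exact .tup hl ((List.forall₂_map_left_iff.1 h).imp fun _ _ h => h.1)
      | _ => cases e
    | free h =>
      cases v with
      | free a => cases e; exact .sing (.free hl) (.var h)
      | _ => cases e
    | bound h =>
      cases v with
      | bound l₁ =>
        cases e
        obtain ⟨h₁, h₂⟩ := (ih _ _ h).sing_inv
        exact .sing (.bound hl h₁) h₂
      | _ => cases e
    | str hct h =>
      cases v with
      | str c ls =>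
        cases e
        obtain ⟨h₁, h₂⟩ := h.encodes ih
        exact .sing (.str hl h₁) (.str hct h₂)
      | _ => cases e

theorem TrailOk.trailInv {Δ : Ctx} {H : Heap} {T : Trail} (h : TrailOk sg Ξ Δ H T) :
    TrailInv sg Ξ Δ H T := by
  induction h with
  | nil => exact .nil
  | cons hu _ hc hh hw _ hl ih => exact .cons hu ih hc (hh.heapInv hc) hw hl

theorem ConfOk.regInv {Ψ : List (ℕ × Ty k)} {Γ : RTy k} {m : Conf k} (h : ConfOk sg Ξ Ψ Γ m) :
    RegInv sg Ξ Ψ m.ctx Γ .fv m.trail m.ctx m.heap m.regs := by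
  obtain ⟨_, h₂, h₃, h₄, h₅⟩ := h
  refine ⟨⟨h₃, h₄.trailInv⟩, h₂.heapInv h₃, .id sg (List.Subset.refl _), fun r τ hr => ?_⟩
  have := h₅ r
  rw [hr] at this
  cases e : m.regs r with
  | none => rw [e] at this; cases this
  | some w =>
    rw [e] at this
    cases this with
    | some h => exact ⟨w, rfl, by rw [Ty.msubst_fv]; exact h.1⟩

theorem Instr.msubst_fv (I : Instr k) : I.msubst .fv = I := Binding.msubst_fv I

theorem MachineOk.inv {s : State k} (h : MachineOk sg Ξ s) : Inv sg Ξ s := by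
  cases h with
  | run hc hI => exact .run hc.1 hc.regInv hI (Instr.msubst_fv _)
  | read hc hI hJ =>
    cases hJ with
    | intro L hl _ =>
      obtain ⟨h₁, h₂⟩ := hl.encodes hc.regInv.heap
      exact .read hc.1 hc.regInv hI (Instr.msubst_fv _) (Binding.msubst_fv _) h₁ h₂
  | write hc hI hJ =>
    cases hJ with
    | intro hct hl hx =>
      obtain ⟨h₁, h₂⟩ := hl.encodes hc.regInv.heap
      obtain ⟨h₃, h₄⟩ := (hc.regInv.heap _ _ hx).sing_inv
      exact .write hc.1 hc.regInv hI (Instr.msubst_fv _) (Binding.msubst_fv _) hct h₁ h₂ h₃ h₄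
  | twrite hc hI hn hw =>
    exact .twrite hc.1 hc.regInv hI hn (Instr.msubst_fv _)
      (hw.imp fun _ _ h => by rw [Ty.msubst_fv]; exact h.1)

/-! ### Changes of the store and the registers -/

theorem CodeSecOk.closed {C : ℕ → Option (Code k)} (h : CodeSecOk sg C Ξ) :
    ∀ l τ, Ξ l = some τ → ∀ θ, τ.msubst θ = τ := by
  intro l τ hl θ
  rw [h.1] at hl
  obtain ⟨v, hv, rfl⟩ := Option.map_eq_some_iff.1 hl
  exact (Code.ty_map _ _ v).symm.trans (congrArg Code.ty ((h.2 l v hv).1.1 θ))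

variable {Ψ : List (ℕ × Ty k)} {Δ₀ Δ Δ₁ : Ctx} {Γ : RTy k} {θ : ℕ → LF} {T T₁ : Trail}
  {H H₁ : Heap} {R : Reg k → Option Word}

theorem RegInv.set (h : RegInv sg Ξ Ψ Δ₀ Γ θ T Δ H R) (r : Reg k) {τ : Ty k} {w : Word}
    (hw : WordTy sg Ξ Δ Ψ (w.msubst (readback H)) (τ.msubst θ)) :
    RegInv sg Ξ Ψ Δ₀ (Γ.set r τ) θ T Δ H (setReg R r w) := by
  refine ⟨h.store, h.heap, h.sub, fun s τ' hs => ?_⟩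
  by_cases e : s = r
  · subst e
    simp only [RTy.set, Function.update_self, Option.some.injEq] at hs
    subst hs
    exact ⟨w, by simp [setReg], hw⟩
  · simp only [RTy.set, Function.update_of_ne e] at hs
    simpa [setReg, Function.update_of_ne e] using h.regs s τ' hs

theorem RegInv.ext (hsg : sg.Valid) (hΞ : ∀ l τ, Ξ l = some τ → ∀ θ, τ.msubst θ = τ)
    (h : RegInv sg Ξ Ψ Δ₀ Γ θ T Δ H R) (hs : StoreInv sg Ξ Δ₁ H₁ T₁) (hE : Ext sg Δ H Δ₁ H₁) :
    RegInv sg Ξ (heapTyMsubst Ψ (readback H₁)) Δ₀ Γ (fun x => (θ x).msubst (readback H₁))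
      T₁ Δ₁ H₁ R :=
  ⟨hs, h.heap.ext hsg hΞ h.store.ctx hE, h.sub.comp hsg (hE.subOk h.store.ctx), fun r τ hr => by
    obtain ⟨w, h₁, h₂⟩ := h.regs r τ hr
    exact ⟨w, h₁, by rw [← Ty.msubst_msubst]; exact h₂.ext hsg hΞ h.store.ctx hE⟩⟩

theorem RegInv.of_factor (h : RegInv sg Ξ Ψ Δ₀ Γ θ T Δ H R) {σ : Subst}
    (hσ : ∀ y, (σ.fn y).msubst θ = θ y) :
    RegInv sg Ξ Ψ (σ.ctx Δ₀) (Γ.msubst σ.fn) θ T Δ H R := by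
  refine ⟨h.store, h.heap, h.sub.of_factor hσ, fun r τ hr => ?_⟩
  rw [RTy.msubst_apply] at hr
  obtain ⟨τ', hr', rfl⟩ := Option.map_eq_some_iff.1 hr
  rw [Ty.msubst_msubst]
  simp only [hσ]
  exact h.regs r τ' hr'

theorem RegInv.alloc (h : RegInv sg Ξ Ψ Δ₀ Γ θ T Δ H R) {l : ℕ} (hl : H l = none) {v : HVal}
    (hv : ∀ a, v = .free a → Decl.ptype a ∈ sg) :
    RegInv sg Ξ Ψ Δ₀ Γ θ T (allocCtx l v Δ) (H.set l v) R :=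
  have hs := subset_allocCtx l v Δ
  have hH := Heap.le_set hl v
  ⟨⟨h.store.ctx.alloc hl hv, h.store.trail.alloc hl hv (List.Perm.refl _)⟩,
    h.heap.mono h.store.ctx hH hs, ⟨h.sub.lc, fun hx => (h.sub.hasType hx).weaken hs⟩,
    fun r τ hr => (h.regs r τ hr).imp fun _ hw =>
      ⟨hw.1, hw.2.mono h.store.ctx hH hs (List.Subset.refl _)⟩⟩

theorem RegInv.cons (h : RegInv sg Ξ Ψ Δ₀ Γ θ T Δ H R) {l : ℕ} {τ : Ty k}
    (hl : LocOk sg Ξ Δ H Ψ l τ) : RegInv sg Ξ ((l, τ) :: Ψ) Δ₀ Γ θ T Δ H R :=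
  ⟨h.store, h.heap.cons h.store.ctx hl, h.sub, fun r τ hr => (h.regs r τ hr).imp fun _ hw =>
    ⟨hw.1, hw.2.weaken (List.Subset.refl _) (List.subset_cons_self _ _)⟩⟩

/-- Storing a location of type `τ` in a register. -/
theorem RegInv.set_loc (h : RegInv sg Ξ Ψ Δ₀ Γ θ T Δ H R) (r : Reg k) {l : ℕ} {τ : Ty k}
    (hl : LocOk sg Ξ Δ H Ψ l (τ.msubst θ)) :
    RegInv sg Ξ ((l, τ.msubst θ) :: Ψ) Δ₀ (Γ.set r τ) θ T Δ H (setReg R r (.hloc l)) :=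
  (h.cons hl).set r (.hloc (List.mem_cons_self ..))

/-- The static variable `x` is read as the term encoded at a location held by the register `r`. -/
theorem RegInv.open (h : RegInv sg Ξ Ψ Δ₀ Γ θ T Δ H R) (r : Reg k) {l x a : ℕ} {N : LF}
    (hN : Encodes H l N) (tN : PTm sg Δ N a) (hx : x ∉ Ctx.names Δ₀)
    (hxΓ : x ∉ Binding.supp (Ty.neg Γ)) :
    ∃ Ψ₁, RegInv sg Ξ Ψ₁ ((x, .fam a) :: Δ₀) (Γ.set r (.sing (.fv x) a))
      (Function.update θ x N) T Δ H (setReg R r (.hloc l)) := by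
  have h' : RegInv sg Ξ Ψ ((x, .fam a) :: Δ₀) Γ (Function.update θ x N) T Δ H R :=
    ⟨h.store, h.heap, h.sub.extend hx (by simp [LF.fvs]) (List.Subset.refl _) tN.hasType,
      fun r τ hr => by rw [Ty.msubst_update_of_mem hr hxΓ]; exact h.regs r τ hr⟩
  refine ⟨_, h'.set_loc r (l := l) (.sing (M := (LF.fv x).msubst _) ?_ ?_)⟩ <;>
    simpa [LF.msubst]

theorem RegInv.sing (h : RegInv sg Ξ Ψ Δ₀ Γ θ T Δ H R) {r : Reg k} {M : LF} {a l : ℕ}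
    (hr : Γ r = some (.sing M a)) (hl : R r = some (.hloc l)) :
    Encodes H l (M.msubst θ) ∧ PTm sg Δ (M.msubst θ) a := by
  obtain ⟨w, h₁, h₂⟩ := h.regs r _ hr
  cases h₁.symm.trans hl
  cases h₂ with
  | hloc h₂ => exact (h.heap _ _ h₂).sing_inv

theorem OpTy.eval (hsg : sg.Valid) (hΞ : ∀ l τ, Ξ l = some τ → ∀ θ, τ.msubst θ = τ)
    (h : RegInv sg Ξ Ψ Δ₀ Γ θ T Δ H R) {op : Op k} {τ : Ty k} (hop : OpTy sg Ξ Δ₀ Γ op τ) {w : Word}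
    (hw : OpEval R (op.map (fun _ M => M.msubst θ) 0) w) :
    WordTy sg Ξ Δ Ψ (w.msubst (readback H)) (τ.msubst θ) := by
  obtain ⟨w₁, h₁, h₂⟩ := hw
  exact (hop.resolve hsg hΞ h.sub (readback_lc H) (fun x A hx => h.store.ctx.readback_eq hx)
    h.regs h₁).eval hsg hΞ (h₂.msubst (readback_lc H))

theorem Op.map_call (f : ℕ → LF → LF) (d l : ℕ) (Ms : List LF) :
    (Op.call (k := k) l Ms).map f d = .call l (Ms.map (f d)) := by
  induction Ms using List.reverseRecOn with
  | nil => rfl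
  | append_singleton Ms M ih => simp_all [Op.call, Op.map]

theorem OpResolve.call (l : ℕ) (Ms : List LF) :
    OpResolve R (.call l Ms) ((Word.cloc l).apps Ms) := by
  induction Ms using List.reverseRecOn with
  | nil => exact .cloc
  | append_singleton Ms M ih =>
    simp only [Op.call, Word.apps, List.foldl_append, List.foldl_cons, List.foldl_nil] at ih ⊢
    exact .app ih

theorem OpTy.call (hsg : sg.Valid) (hΞ : ∀ l τ, Ξ l = some τ → ∀ θ, τ.msubst θ = τ)
    (h : RegInv sg Ξ Ψ Δ₀ Γ θ T Δ H R) {l : ℕ} {Ms : List LF} {τ : Ty k}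
    (hop : OpTy sg Ξ Δ₀ Γ (.call l Ms) τ) :
    WordTy sg Ξ Δ Ψ (((Word.cloc l).apps (Ms.map (LF.msubst θ))).msubst (readback H))
      (τ.msubst θ) := by
  refine hop.resolve hsg hΞ h.sub (readback_lc H) (fun x A hx => h.store.ctx.readback_eq hx)
    h.regs ?_
  rw [Op.map_call]
  exact .call l _

/-- Entering a code block with a register file of the declared type. -/
theorem Inv.enter {C : ℕ → Option (Code k)} (hC : CodeSecOk sg C Ξ) {l : ℕ} {v : Code k}
    {Ms : List LF} {I : Instr k} {τ₀ : Ty k} {Γ₁ : RTy k} (hs : StoreInv sg Ξ Δ H T)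
    (hH : HeapInv sg Ξ Δ H Ψ) (hv : C l = some v) (hI : v.instantiate Ms = some I)
    (hl : WordTy sg Ξ Δ Ψ (.cloc l) τ₀)
    (happ : AppTy sg Δ τ₀ (Ms.map (LF.msubst (readback H))) (.neg Γ₁))
    (hR : ∀ r τ, Γ₁ r = some τ → ∃ w, R r = some w ∧
      WordTy sg Ξ Δ Ψ (w.msubst (readback H)) τ) :
    Inv sg Ξ (.run ⟨T, Δ, C, H, R, I.msubst (readback H)⟩) := by
  obtain ⟨hclosed, hok⟩ := hC.2 l v hv
  cases hl with
  | cloc hl =>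
    rw [hC.1, hv] at hl
    cases hl
    have hI' := Code.instantiate_msubst (readback_lc H) hI
    rw [hclosed.1] at hI'
    obtain ⟨Δ₂, Γ₂, I₂, θ₂, h₁, h₂, h₃, h₄⟩ := hok.enter (θ := .fv)
      (SubOk.id sg (List.nil_subset Δ)) (by rw [hclosed.1]; exact happ) (by rw [hclosed.1]; exact hI')
    refine .run hC ⟨hs, hH, h₂, fun r τ hr => ?_⟩ h₁ h₃.symm
    exact hR r _ (by rw [h₄, RTy.msubst_apply, hr]; rfl)

theorem Backtrack.inv {m : Conf k} {s : State k} (hb : Backtrack m s) (hC : CodeSecOk sg m.code Ξ)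
    (hs : StoreInv sg Ξ m.ctx m.heap m.trail) : Inv sg Ξ s := by
  cases hb with
  | intro hT hu hv hI =>
    have ht := hs.trail
    rw [hT] at ht
    cases ht with
    | cons hu' ht hc hh hw hf =>
      obtain ⟨rfl, rfl⟩ := hu.det hu'
      rw [Word.msubst_apps] at hf
      obtain ⟨τ₀, h₁, h₂⟩ := hf.apps_inv
      refine Inv.enter hC ⟨hc, ht⟩ hh hv hI h₁ h₂ fun r τ hr => ?_
      by_cases e : r = Reg.env
      · subst e
        simp only [RTy.set, Function.update_self, Option.some.injEq] at hr
        subst hr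
        exact ⟨_, by simp [onlyEnv], hw⟩
      · simp [RTy.set, Function.update_of_ne e] at hr

end Machine

/-! ### Types of spines -/

section SpineTypes

theorem Spine.map_foldr (f : ℕ → LF → LF) (d : ℕ) (as : List ℕ) (J : Spine) :
    (as.foldr Spine.pi J).map f d = as.foldr Spine.pi (J.map f (d + as.length)) := by
  induction as generalizing d with
  | nil => rfl
  | cons a as ih =>
    refine congrArg (Spine.pi a) ((ih (d + 1)).trans ?_)
    rw [List.length_cons, Nat.add_right_comm, Nat.add_assoc]

theorem Spine.msubst_str (M : LF) (c : ℕ) (Ns : List LF) (as : List ℕ) (θ : ℕ → LF) :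
    Binding.msubst (Spine.str M c Ns as) θ =
      .str (M.msubst θ) c (Ns.map (LF.msubst θ)) as := by
  refine (Spine.map_foldr _ _ _ _).trans (congrArg (fun J => as.foldr Spine.pi J) ?_)
  change Spine.unif _ (((LF.cst c).apps _).msubst θ) = _
  rw [LF.msubst_apps, List.map_append, List.map_map]
  rfl

theorem Spine.str_nil (M : LF) (c : ℕ) (Ns : List LF) :
    Spine.str M c Ns [] = .unif M ((LF.cst c).apps Ns) := by
  simp [Spine.str]

/-- The type of a spine with a parameter; instantiating the parameter appends it to the arguments,
and instantiates the index that stands for it in the other terms, if it occurs there. -/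
theorem Spine.str_cons (M : LF) (c : ℕ) (Ns : List LF) (a : ℕ) (as : List ℕ) :
    ∃ B, Spine.str M c Ns (a :: as) = .pi a B ∧ ∀ N, B.inst 0 N =
      .str (M.inst as.length N) c (Ns.map (fun P => P.inst as.length N) ++ [N]) as := by
  refine ⟨_, rfl, fun N => ?_⟩
  refine (Spine.map_foldr _ _ _ _).trans (congrArg (fun J => as.foldr Spine.pi J) ?_)
  change Spine.unif _ (((LF.cst c).apps _).inst (0 + as.length) N) = _
  rw [LF.inst_apps, Nat.zero_add]
  refine congrArg₂ _ rfl (congrArg _ ?_)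
  rw [List.length_cons, List.range_succ, List.reverse_append, List.map_append, List.map_append,
    List.map_append, List.append_assoc]
  refine congrArg₂ _ rfl (congrArg₂ _ (by simp [LF.inst]) ?_)
  rw [List.map_map]
  refine List.map_congr_left fun i hi => ?_
  have : i ≠ as.length := (List.mem_range.1 (List.mem_reverse.1 hi)).ne
  simp [LF.inst, this]

theorem LF.map_inst_of_lc {Ms : List LF} (h : ∀ M ∈ Ms, M.LC) (d : ℕ) (u : LF) :
    (Ms.map fun M => M.inst d u) = Ms :=
  (List.map_congr_left fun M hM => h M hM d u).trans (List.map_id _)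

theorem Spine.str_cons_of_lc {M : LF} {Ns : List LF} (hM : M.LC) (hNs : ∀ N ∈ Ns, N.LC) (c a : ℕ)
    (as : List ℕ) : ∃ B, Spine.str M c Ns (a :: as) = .pi a B ∧
      ∀ N, B.inst 0 N = .str M c (Ns ++ [N]) as := by
  obtain ⟨B, h₁, h₂⟩ := Spine.str_cons M c Ns a as
  exact ⟨B, h₁, fun N => by rw [h₂, hM, LF.map_inst_of_lc hNs]⟩

/-- Reading the next argument of a structure whose remaining arguments are `Ns`. -/
theorem Spine.str_cons_read {Ns : List LF} (hNs : ∀ N ∈ Ns, N.LC) (Ms : List LF) (c a : ℕ)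
    (as : List ℕ) : ∃ B, Spine.str ((LF.cst c).apps (Ms ++ Ns)) c Ms (a :: as) = .pi a B ∧
      ∀ N, ∃ Ms₁, B.inst 0 N = .str ((LF.cst c).apps (Ms₁ ++ Ns)) c (Ms₁ ++ [N]) as := by
  obtain ⟨B, h₁, h₂⟩ := Spine.str_cons ((LF.cst c).apps (Ms ++ Ns)) c Ms a as
  refine ⟨B, h₁, fun N => ⟨Ms.map fun P => P.inst as.length N, ?_⟩⟩
  rw [h₂, LF.inst_apps, List.map_append, LF.map_inst_of_lc hNs]
  rfl

/-- Substitution does not change the shape of the type of a spine. -/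
theorem Spine.msubst_eq_pi {J B : Spine} {θ : ℕ → LF} {a : ℕ}
    (h : Binding.msubst J θ = .pi a B) : ∃ J₀, J = .pi a J₀ ∧ Binding.msubst J₀ θ = B := by
  cases J with
  | unif => cases h
  | pi b J₀ =>
    injection h with h₁ h₂
    exact ⟨J₀, by rw [h₁], (Binding.map_const (LF.msubst θ) 0 1 J₀).trans h₂⟩

theorem Spine.msubst_eq_unif {J : Spine} {θ : ℕ → LF} {M N : LF}
    (h : Binding.msubst J θ = .unif M N) :
    ∃ M₀ N₀, J = .unif M₀ N₀ ∧ M₀.msubst θ = M ∧ N₀.msubst θ = N := by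
  cases J with
  | pi => cases h
  | unif M₀ N₀ =>
    injection h with h₁ h₂
    exact ⟨M₀, N₀, rfl, h₁, h₂⟩

end SpineTypes

/-! ### Preservation of the invariant -/

section Preservation

variable {k : ℕ} {sg : Sig} {Ξ : ℕ → Option (Ty k)} {Ψ : List (ℕ × Ty k)} {Δ₀ Δ Δ₁ : Ctx}
  {Γ : RTy k} {θ : ℕ → LF} {T T₁ : Trail} {H H₁ : Heap} {R : Reg k → Option Word}

theorem Instr.msubst_msubst (I : Instr k) (θ θ₁ : ℕ → LF) :
    (I.msubst θ).msubst θ₁ = I.msubst fun x => (θ x).msubst θ₁ := Binding.msubst_msubst I θ θ₁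

theorem Instr.map_succ (I : Instr k) (θ : ℕ → LF) :
    I.map (fun _ M => M.msubst θ) (0 + 1) = I.msubst θ := Binding.map_const (LF.msubst θ) 1 0 I

theorem Instr.open_msubst {θ : ℕ → LF} (hθ : ∀ x, LF.LC (θ x)) {I : Instr k} {x : ℕ}
    (hx : x ∉ Binding.supp I) (u : LF) :
    (I.inst 0 (.fv x)).msubst (Function.update θ x u) = (I.msubst θ).inst 0 u :=
  Binding.open_msubst hθ hx 0 u

/-- At the end of a spine whose type has become an equation between identical terms, the remaining
instructions are typed under the most general unifier of the static terms, which the substitution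
of the state absorbs. -/
theorem SpineOk.unif (hR : RegInv sg Ξ Ψ Δ₀ Γ θ T Δ H R) {I : Instr k} {J : Spine} {N : LF}
    (h : SpineOk sg Ξ Δ₀ Γ I J) (hJ : Binding.msubst J θ = .unif N N) :
    ∃ Δ₁ Γ₁ I₁, InstrOk sg Ξ Δ₁ Γ₁ I₁ ∧ RegInv sg Ξ Ψ Δ₁ Γ₁ θ T Δ H R ∧
      I₁.msubst θ = I.msubst θ := by
  obtain ⟨M₁, M₂, rfl, h₁, h₂⟩ := Spine.msubst_eq_unif hJ
  cases h with
  | endS hu hI =>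
    have f := hu.factor (h₁.trans h₂.symm)
    refine ⟨_, _, _, hI, hR.of_factor f, ?_⟩
    rw [Instr.msubst_msubst]
    simp only [f]
  | endF hf => exact absurd (h₁.trans h₂.symm) hf.msubst_ne

theorem forall₂_getElem? {α β : Type} {P : α → β → Prop} {as : List α} {bs : List β}
    (h : List.Forall₂ P as bs) {i : ℕ} {a : α} {b : β} (ha : as[i]? = some a)
    (hb : bs[i]? = some b) : P a b := by
  induction h generalizing i with
  | nil => cases ha
  | cons h _ ih =>
    cases i with
    | zero => cases ha; cases hb; exact h
    | succ i => exact ih ha hb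

theorem RegInv.regs_of_le (h : RegInv sg Ξ Ψ Δ₀ Γ θ T Δ H R) {Γ₁ : RTy k} (hle : Γ₁.Le Γ)
    {r : Reg k} {τ : Ty k} (hr : Γ₁.msubst θ r = some τ) : ∃ w, R r = some w ∧
      WordTy sg Ξ Δ Ψ (w.msubst (readback H)) τ := by
  rw [RTy.msubst_apply] at hr
  obtain ⟨τ', hr', rfl⟩ := Option.map_eq_some_iff.1 hr
  exact h.regs r τ' (hle r τ' hr')

/-- A name for opening the static instructions and the type of their spine. -/
theorem exists_fresh (L : Finset ℕ) (Δ₀ : Ctx) (Γ : RTy k) (I : Instr k) (J : Spine) :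
    ∃ x, x ∉ L ∧ x ∉ Ctx.names Δ₀ ∧ x ∉ Binding.supp (Ty.neg Γ) ∧ x ∉ Binding.supp I ∧
      x ∉ Binding.supp J := by
  obtain ⟨x, hx⟩ := Infinite.exists_notMem_finset
    (L ∪ (Ctx.names Δ₀ ∪ (Binding.supp (Ty.neg Γ) ∪ (Binding.supp I ∪ Binding.supp J))))
  simp only [Finset.mem_union, not_or] at hx
  exact ⟨x, hx⟩

theorem Inv.jmpCode (hsg : sg.Valid) {m : Conf k} (h : Inv sg Ξ (.run m)) {op : Op k}
    {I I₁ : Instr k} {l : ℕ} {Ms : List LF} {v : Code k} (hi : m.instr = .jmp op I)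
    (hw : OpEval m.regs op ((Word.cloc l).apps Ms)) (hv : m.code l = some v)
    (hI₁ : v.instantiate Ms = some I₁) :
    Inv sg Ξ (.run { m with instr := I₁.msubst (readback m.heap) }) := by
  cases h with
  | run hC hR hI e =>
    rw [hi] at e
    cases hI with
    | jmp hop hle =>
      cases e
      have ht := hop.eval hsg hC.closed hR hw
      rw [Word.msubst_apps] at ht
      obtain ⟨τ₀, h₁, h₂⟩ := ht.apps_inv
      exact Inv.enter hC hR.store hR.heap hv hI₁ h₁ h₂ fun r τ hr => hR.regs_of_le hle hr
    | _ => cases e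

theorem Inv.jmpClos (hsg : sg.Valid) {m : Conf k} (h : Inv sg Ξ (.run m)) {op : Op k}
    {I I₁ : Instr k} {l lc : ℕ} {Ms Ns : List LF} {w : Word} {v : Code k}
    (hi : m.instr = .jmp op I) (hw : OpEval m.regs op ((Word.hloc l).apps Ms))
    (hl : m.heap l = some (.clos w lc Ns)) (hv : m.code lc = some v)
    (hI₁ : v.instantiate (Ns ++ Ms) = some I₁) :
    Inv sg Ξ (.run { m with
      regs := setReg m.regs Reg.env w, instr := I₁.msubst (readback m.heap) }) := by
  cases h with
  | run hC hR hI e =>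
    rw [hi] at e
    cases hI with
    | jmp hop hle =>
      cases e
      have ht := hop.eval hsg hC.closed hR hw
      rw [Word.msubst_apps] at ht
      obtain ⟨τ₀, h₁, h₂⟩ := ht.apps_inv
      cases h₁ with
      | hloc h₁ =>
        have hloc := hR.heap _ _ h₁
        cases hloc with
        | sing => generalize Ms.map _ = Ns' at h₂; cases h₂
        | tup => generalize Ms.map _ = Ns' at h₂; cases h₂
        | clos hl' hw' hτ hcl =>
          cases hl.symm.trans hl'
          rw [Word.msubst_apps] at hcl
          obtain ⟨τ₁, h₃, h₄⟩ := hcl.apps_inv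
          -- The closure supplies the first arguments, and the type of the environment register.
          have happ := h₄.append (h₂.set_env hτ)
          rw [← List.map_append] at happ
          refine Inv.enter hC hR.store hR.heap hv hI₁ h₃ happ fun r τ hr => ?_
          by_cases e : r = Reg.env
          · subst e
            simp only [RTy.set, Function.update_self, Option.some.injEq] at hr
            subst hr
            exact ⟨w, by simp [setReg], hw'⟩
          · simp only [RTy.set, Function.update_of_ne e] at hr
            simpa [setReg, Function.update_of_ne e] using hR.regs_of_le hle hr
    | _ => cases e

theorem Inv.close (hsg : sg.Valid) {m : Conf k} (h : Inv sg Ξ (.run m)) {rd re : Reg k} {lc l : ℕ}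
    {Ms : List LF} {I : Instr k} {w : Word} (hi : m.instr = .close rd re lc Ms I)
    (hw : m.regs re = some w) (hl : m.heap l = none) :
    Inv sg Ξ (.run { m with
      heap := m.heap.set l (.clos w lc Ms), regs := setReg m.regs rd (.hloc l), instr := I }) := by
  cases h with
  | @run _ _ _ _ θ _ hC hR hI e =>
    rw [hi] at e
    cases hI with
    | @close _ _ Γ₁ _ _ _ Ms₀ _ τ As hre hτ hop hI =>
      cases e
      have hR' := hR.alloc hl (v := .clos w lc (Ms₀.map (LF.msubst θ))) fun _ h => nomatch h
      obtain ⟨w', h₁, h₂⟩ := hR'.regs _ _ hre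
      cases hw.symm.trans h₁
      have h₃ := hop.call hsg hC.closed hR'
      rw [Ty.msubst_pis] at h₃
      rw [show Ty.msubst (.neg (RTy.set _ Reg.env _)) _ = .neg _ from
        congrArg Ty.neg (RTy.msubst_set _ _ _ _)] at h₃
      refine .run hC (hR'.set_loc rd ?_) hI rfl
      rw [Ty.msubst_pis]
      exact .clos (Heap.set_self ..) h₂ (hτ.msubst hR.sub.lc) h₃
    | _ => cases e

theorem Inv.pushBt (hsg : sg.Valid) {m : Conf k} (h : Inv sg Ξ (.run m)) {re : Reg k} {lc : ℕ}
    {Ms : List LF} {I : Instr k} {w : Word} (hi : m.instr = .pushBt re lc Ms I)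
    (hw : m.regs re = some w) :
    Inv sg Ξ (.run { m with trail := ⟨[], w, lc, Ms⟩ :: m.trail, instr := I }) := by
  cases h with
  | run hC hR hI e =>
    rw [hi] at e
    cases hI with
    | pushBt hI hre hop =>
      cases e
      obtain ⟨w', h₁, h₂⟩ := hR.regs _ _ hre
      cases hw.symm.trans h₁
      have h₃ := hop.call hsg hC.closed hR
      rw [show Ty.msubst (.neg (RTy.set _ Reg.env _)) _ = .neg _ from
        congrArg Ty.neg (RTy.msubst_set _ _ _ _)] at h₃
      exact .run hC ⟨⟨hR.store.ctx, .cons .nil hR.store.trail hR.store.ctx hR.heap h₂ h₃⟩,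
        hR.heap, hR.sub, hR.regs⟩ hI rfl
    | _ => cases e

theorem Inv.setVal {m : Conf k} {rd rs : Reg k} {n : ℕ} {ws : List Word} {I : Instr k} {w : Word}
    (h : Inv sg Ξ (.twrite m rd (n + 1) ws)) (hi : m.instr = .setVal rs I)
    (hw : m.regs rs = some w) :
    Inv sg Ξ (.twrite { m with instr := I } rd n (ws ++ [w])) := by
  cases h with
  | @twrite _ _ _ _ _ _ _ _ _ τs₁ _ hC hR hI hn e hws =>
    rw [hi] at e
    cases hI with
    | @setVal _ _ _ _ τ τs _ _ hrs hI =>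
      cases e
      obtain ⟨w', h₁, h₂⟩ := hR.regs _ _ hrs
      cases hw.symm.trans h₁
      refine .twrite (τs₁ := τs₁ ++ [τ]) hC hR (by simpa using hI) (by simpa using hn) rfl ?_
      exact List.rel_append hws (.cons h₂ .nil)
    | done => cases hn

theorem Inv.tupleEnd {m : Conf k} {rd : Reg k} {ws : List Word} {l : ℕ}
    (h : Inv sg Ξ (.twrite m rd 0 ws)) (hl : m.heap l = none) :
    Inv sg Ξ (.run { m with
      heap := m.heap.set l (.tup ws), regs := setReg m.regs rd (.hloc l) }) := by
  cases h with
  | @twrite _ _ _ _ _ _ _ _ _ τs₁ _ hC hR hI hn e hws =>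
    cases hI with
    | setVal => cases hn
    | done hI =>
      have hR' := hR.alloc hl (v := .tup ws) fun _ h => nomatch h
      rw [List.append_nil] at hI
      refine .run hC (hR'.set_loc rd ?_) hI e
      rw [show Ty.msubst (.tup τs₁) _ = .tup _ from Ty.map_tup _ _ _]
      refine .tup (Heap.set_self ..) (List.forall₂_map_right_iff.2 (hws.imp fun _ _ h => ?_))
      exact h.mono hR.store.ctx (Heap.le_set hl _) (List.Subset.refl _) (List.Subset.refl _)

theorem Inv.proj {m : Conf k} (h : Inv sg Ξ (.run m)) {rd rs : Reg k} {i l : ℕ} {I : Instr k}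
    {ws : List Word} {w : Word} (hi : m.instr = .proj rd rs i I)
    (hrs : m.regs rs = some (.hloc l)) (hl : m.heap l = some (.tup ws)) (hw : ws[i]? = some w) :
    Inv sg Ξ (.run { m with regs := setReg m.regs rd w, instr := I }) := by
  cases h with
  | run hC hR hI e =>
    rw [hi] at e
    cases hI with
    | @proj _ _ _ _ _ _ τs τ hτs hτ hI =>
      cases e
      obtain ⟨w', h₁, h₂⟩ := hR.regs _ _ hτs
      cases hrs.symm.trans h₁
      rw [show Ty.msubst (.tup τs) _ = .tup _ from Ty.map_tup _ _ _] at h₂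
      cases h₂ with
      | hloc h₂ =>
        obtain ⟨ws', h₃, h₄⟩ := (hR.heap _ _ h₂).tup_inv
        cases hl.symm.trans h₃
        exact .run hC (hR.set rd (forall₂_getElem? h₄ hw (by rw [List.getElem?_map, hτ]; rfl)))
          hI rfl
    | _ => cases e

theorem Inv.getVal (hsg : sg.Valid) {m : Conf k} (h : Inv sg Ξ (.run m)) {r₁ r₂ : Reg k}
    {I : Instr k} {l₁ l₂ : ℕ} (hi : m.instr = .getVal r₁ r₂ I)
    (h₁ : m.regs r₁ = some (.hloc l₁)) (h₂ : m.regs r₂ = some (.hloc l₂))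
    (hu : Unify m.ctx m.heap m.trail l₁ l₂ (some (Δ₁, H₁, T₁))) :
    Inv sg Ξ (.run { m with
      trail := T₁, ctx := Δ₁, heap := H₁, instr := I.msubst (readback H₁) }) := by
  cases h with
  | run hC hR hI e =>
    rw [hi] at e
    cases hI with
    | getValS hr₁ hr₂ hσ hI =>
      cases e
      obtain ⟨hs, hE, he⟩ := hu.sound hsg rfl hR.store (hR.sing hr₁ h₁).1 (hR.sing hr₂ h₂).1
        (hR.sing hr₁ h₁).2 (hR.sing hr₂ h₂).2
      rw [LF.msubst_msubst, LF.msubst_msubst] at he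
      -- The composite with the new readback unifies the static terms, hence absorbs `σ`.
      have f := hσ.factor he
      refine .run hC ((hR.ext hsg hC.closed hs hE).of_factor f) hI ?_
      rw [Instr.msubst_msubst]
      simp only [f]
      exact (Instr.msubst_msubst _ _ _).symm
    | getValF hr₁ hr₂ hf =>
      cases e
      obtain ⟨-, -, he⟩ := hu.sound hsg rfl hR.store (hR.sing hr₁ h₁).1 (hR.sing hr₂ h₂).1
        (hR.sing hr₁ h₁).2 (hR.sing hr₂ h₂).2
      rw [LF.msubst_msubst, LF.msubst_msubst] at he
      exact absurd he hf.msubst_ne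
    | _ => cases e

theorem Inv.putVar {m : Conf k} (h : Inv sg Ξ (.run m)) {r : Reg k} {a l : ℕ} {I : Instr k}
    (hi : m.instr = .putVar r a I) (hl : m.heap l = none) :
    Inv sg Ξ (.run { m with
      ctx := (l, .fam a) :: m.ctx, heap := m.heap.set l (.free a),
      regs := setReg m.regs r (.hloc l), instr := I.inst 0 (.fv l) }) := by
  cases h with
  | @run _ Ψ Δ₀ Γ θ _ hC hR hI e =>
    rw [hi] at e
    cases hI with
    | @putVar _ _ _ _ I₀ L ha hI =>
      cases e
      obtain ⟨x, hL, hΔ, hΓ, hx, -⟩ := exists_fresh L Δ₀ Γ I₀ (.unif .typ .typ)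
      obtain ⟨Ψ₁, hR'⟩ := (hR.alloc hl (v := .free a) fun _ h => by cases h; exact ha).open r
        (.free (Heap.set_self ..)) (.var (List.mem_cons_self ..)) hΔ hΓ
      refine .run hC hR' (hI x hL) ?_
      rw [Instr.open_msubst hR.sub.lc hx, ← Instr.map_succ]
    | _ => cases e

theorem Inv.putStr (hsg : sg.Valid) {m : Conf k} (h : Inv sg Ξ (.run m)) {c : ℕ} {r : Reg k}
    {a l : ℕ} {as : List ℕ} {I : Instr k} (hi : m.instr = .putStr c r I) (hc : sg.Ctor c as a)
    (hl : m.heap l = none) :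
    Inv sg Ξ (.write { m with
      ctx := (l, .fam a) :: m.ctx, heap := m.heap.set l (.free a),
      regs := setReg m.regs r (.hloc l), instr := I } c l []) := by
  cases h with
  | @run _ Ψ Δ₀ Γ θ _ hC hR hI e =>
    rw [hi] at e
    cases hI with
    | @putStr _ _ _ _ I₀ as' a' L hc' hI =>
      cases e
      obtain ⟨rfl, rfl⟩ := hc.unique hsg hc'
      obtain ⟨x, hL, hΔ, hΓ, hx, -⟩ := exists_fresh L Δ₀ Γ I₀ (.unif .typ .typ)
      have hf : Heap.set m.heap l (.free a) l = some (.free a) := Heap.set_self ..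
      obtain ⟨Ψ₁, hR'⟩ := (hR.alloc hl (v := .free a) fun _ h => by cases h; exact hc.2.2).open r
        (.free hf) (.var (List.mem_cons_self ..)) hΔ hΓ
      refine .write (as₁ := []) (x := l) hC hR' (hI x hL) ?_ ?_ hc .nil .nil (.free hf)
        (.var (List.mem_cons_self ..))
      · exact Binding.msubst_update hx _ _
      · rw [Spine.msubst_str]; simp [LF.msubst]
    | _ => cases e

theorem Inv.unifyVarW (hsg : sg.Valid) {m : Conf k} {c ld : ℕ} {ls : List ℕ}
    (h : Inv sg Ξ (.write m c ld ls)) {r : Reg k} {a l b : ℕ} {as : List ℕ} {I : Instr k}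
    (hi : m.instr = .unifyVar r a I) (hc : sg.Ctor c as b) (hlen : ls.length < as.length)
    (hl : m.heap l = none) :
    Inv sg Ξ (.write { m with
      ctx := (l, .fam a) :: m.ctx, heap := m.heap.set l (.free a),
      regs := setReg m.regs r (.hloc l), instr := I.inst 0 (.fv l) } c ld (ls ++ [l])) := by
  cases h with
  | @write _ Ψ Δ₀ Γ θ I₀ J _ _ _ x Ms as₁ as₂ a' hC hR hI e hJ hc' hMs tMs hx tx =>
    obtain ⟨rfl, rfl⟩ := hc.unique hsg hc'
    rw [List.length_append, hMs.length_eq, tMs.length_eq] at hlen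
    cases as₂ with
    | nil => exact absurd hlen (by simp)
    | cons b' as₂ =>
      obtain ⟨B, hB, hB'⟩ := Spine.str_cons_of_lc (LF.lc_fv x) hMs.lc c b' as₂
      obtain ⟨J₀, rfl, hJ₀⟩ := Spine.msubst_eq_pi (hJ.trans hB)
      rw [hi] at e
      cases hI with
      | unifyVal => cases e
      | @unifyVar _ _ _ _ I₀ _ L hI =>
        cases e
        obtain ⟨y, hL, hΔ, hΓ, hy, hyJ⟩ := exists_fresh L Δ₀ Γ I₀ J₀
        have hf : Heap.set m.heap l (.free a) l = some (.free a) := Heap.set_self ..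
        have hH := Heap.le_set hl (.free a)
        obtain ⟨Ψ₁, hR'⟩ := (hR.alloc hl (v := .free a) fun _ h => by
          cases h; exact hc.2.1 a (by simp)).open r
          (.free hf) (.var (List.mem_cons_self ..)) hΔ hΓ
        have hs : m.ctx ⊆ (l, .fam a) :: m.ctx := List.subset_cons_self _ _
        refine .write (as₁ := as₁ ++ [a]) hC hR' (hI y hL) ?_
          ((Binding.open_msubst hR.sub.lc hyJ 0 _).trans ?_)
          (by simpa using hc) ((hMs.mono hH).append (.cons (.free hf) .nil))
          ((tMs.weaken hs).append (.cons (.var (List.mem_cons_self ..)) .nil)) (hx.mono hH)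
          (tx.weaken hs)
        · rw [Instr.open_msubst hR.sub.lc hy, ← Instr.map_succ]
        · rw [hJ₀]; exact hB' _

theorem Inv.unifyValW (hsg : sg.Valid) {m : Conf k} {c ld : ℕ} {ls : List ℕ}
    (h : Inv sg Ξ (.write m c ld ls)) {r : Reg k} {a l b : ℕ} {as : List ℕ} {I : Instr k}
    (hi : m.instr = .unifyVal r a I) (hc : sg.Ctor c as b) (hlen : ls.length < as.length)
    (hr : m.regs r = some (.hloc l)) :
    Inv sg Ξ (.write { m with instr := I.inst 0 (readback m.heap l) } c ld (ls ++ [l])) := by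
  cases h with
  | @write _ Ψ Δ₀ Γ θ I₀ J _ _ _ x Ms as₁ as₂ a' hC hR hI e hJ hc' hMs tMs hx tx =>
    obtain ⟨rfl, rfl⟩ := hc.unique hsg hc'
    rw [List.length_append, hMs.length_eq, tMs.length_eq] at hlen
    cases as₂ with
    | nil => exact absurd hlen (by simp)
    | cons b' as₂ =>
      obtain ⟨B, hB, hB'⟩ := Spine.str_cons_of_lc (LF.lc_fv x) hMs.lc c b' as₂
      obtain ⟨J₀, rfl, hJ₀⟩ := Spine.msubst_eq_pi (hJ.trans hB)
      rw [hi] at e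
      cases hI with
      | unifyVar => cases e
      | @unifyVal _ _ _ _ I₀ _ M hrM hI =>
        cases e
        obtain ⟨hM, tM⟩ := hR.sing hrM hr
        refine .write (as₁ := as₁ ++ [a]) hC hR hI ?_
          ((Binding.inst_msubst hR.sub.lc J₀ 0 M).trans ?_)
          (by simpa using hc) (hMs.append (.cons hM .nil)) (tMs.append (.cons tM .nil)) hx tx
        · rw [hM.readback_eq]
          exact (Binding.inst_msubst hR.sub.lc I₀ 0 M).trans
            (congrArg (fun I => Instr.inst I 0 (M.msubst θ)) (Instr.map_succ I₀ θ).symm)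
        · rw [hJ₀]; exact hB' _

theorem Inv.writeEnd (hsg : sg.Valid) {m : Conf k} {c ld : ℕ} {ls : List ℕ}
    (h : Inv sg Ξ (.write m c ld ls)) {as : List ℕ} {b e a : ℕ} (hc : sg.Ctor c as b)
    (hlen : ls.length = as.length) (he : End m.heap ld e) (hf : m.heap e = some (.free a))
    (ho : ∀ l ∈ ls, NotOcc m.heap e l) :
    Inv sg Ξ (.run { m with
      trail := uptrail e a m.trail, ctx := m.ctx.remove e, heap := m.heap.set e (.str c ls),
      instr := m.instr.msubst (readback (m.heap.set e (.str c ls))) }) := by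
  cases h with
  | @write _ Ψ Δ₀ Γ θ I₀ J _ _ _ x Ms as₁ as₂ a' hC hR hI hi hJ hc' hMs tMs hx tx =>
    obtain ⟨rfl, rfl⟩ := hc.unique hsg hc'
    rw [List.length_append, hMs.length_eq, tMs.length_eq] at hlen
    obtain rfl : as₂ = [] := List.length_eq_zero_iff.1 (by omega)
    rw [List.append_nil] at hc
    cases (he.encodes hx).free_inv hf
    cases hR.store.ctx.free_eq tx hf
    have hMs' := hMs.set_of_notOcc ho (v := .str c ls)
    obtain ⟨hs, hE, heq⟩ := hR.store.set_bound hf (by rintro _ ⟨⟩)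
      (.str (Heap.set_self ..) hMs') (.str hc tMs)
    have hR' := hR.ext hsg hC.closed hs hE
    rw [Spine.str_nil] at hJ
    -- The end of the spine equates the variable with the structure it has just been bound to.
    obtain ⟨Δ₁, Γ₁, I₁, hI₁, hR₁, hi₁⟩ := hI.unif hR'
      (N := ((LF.cst c).apps Ms).msubst (readback (m.heap.set e (.str c ls)))) (by
        rw [← Binding.msubst_msubst, hJ]
        exact congrArg₂ Spine.unif heq rfl)
    refine .run hC hR₁ hI₁ (hi₁.trans ?_)
    rw [← Instr.msubst_msubst, hi]

theorem Inv.getStrW {m : Conf k} (h : Inv sg Ξ (.run m)) {c : ℕ} {r : Reg k} {I : Instr k}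
    {l e a : ℕ} (hi : m.instr = .getStr c r I) (hr : m.regs r = some (.hloc l))
    (he : End m.heap l e) (hf : m.heap e = some (.free a)) :
    Inv sg Ξ (.write { m with instr := I } c e []) := by
  cases h with
  | run hC hR hI hi' =>
    rw [hi] at hi'
    cases hI with
    | getStr hc hrM hI =>
      cases hi'
      obtain ⟨hM, tM⟩ := hR.sing hrM hr
      have h₁ := (he.encodes hM).free_inv hf
      rw [h₁] at tM
      refine .write (as₁ := []) (x := e) hC hR hI rfl ?_ hc .nil .nil (.free hf) tM
      rw [Spine.msubst_str, h₁]; rfl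
    | _ => cases hi'

theorem Inv.getStrR (hsg : sg.Valid) {m : Conf k} (h : Inv sg Ξ (.run m)) {c : ℕ} {r : Reg k}
    {I : Instr k} {l e : ℕ} {ls : List ℕ} (hi : m.instr = .getStr c r I)
    (hr : m.regs r = some (.hloc l)) (he : End m.heap l e) (hf : m.heap e = some (.str c ls)) :
    Inv sg Ξ (.read { m with instr := I } ls) := by
  cases h with
  | run hC hR hI hi' =>
    rw [hi] at hi'
    cases hI with
    | getStr hc hrM hI =>
      cases hi'
      obtain ⟨hM, tM⟩ := hR.sing hrM hr
      obtain ⟨Ms, h₁, hMs⟩ := (he.encodes hM).str_inv hf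
      rw [h₁] at tM
      obtain ⟨as, hc', tMs⟩ := tM.str_inv
      obtain ⟨rfl, -⟩ := hc.unique hsg hc'
      refine .read (c := c) (Ms := []) (Ns := Ms) hC hR hI rfl ?_ hMs tMs
      rw [Spine.msubst_str, h₁]; rfl
    | _ => cases hi'

theorem Inv.unifyVarR {m : Conf k} {l : ℕ} {ls : List ℕ} (h : Inv sg Ξ (.read m (l :: ls)))
    {r : Reg k} {a : ℕ} {I : Instr k} (hi : m.instr = .unifyVar r a I) :
    Inv sg Ξ (.read { m with
      regs := setReg m.regs r (.hloc l), instr := I.inst 0 (readback m.heap l) } ls) := by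
  cases h with
  | @read _ Ψ Δ₀ Γ θ I₀ J _ c Ms _ _ hC hR hI e hJ hNs tNs =>
    have hlc := hNs.lc
    cases hNs with
    | @cons _ _ N Ns hN hNs =>
    cases tNs with
    | @cons _ b _ as tN tNs =>
      obtain ⟨B, hB, hB'⟩ := Spine.str_cons_read hlc Ms c b as
      obtain ⟨J₀, rfl, hJ₀⟩ := Spine.msubst_eq_pi (hJ.trans hB)
      obtain ⟨Ms₁, hMs₁⟩ := hB' N
      rw [hi] at e
      cases hI with
      | unifyVal => cases e
      | @unifyVar _ _ _ _ I₀ _ L hI =>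
        cases e
        obtain ⟨x, hL, hΔ, hΓ, hx, hxJ⟩ := exists_fresh L Δ₀ Γ I₀ J₀
        obtain ⟨Ψ₁, hR'⟩ := hR.open r hN tN hΔ hΓ
        refine .read (c := c) (Ms := Ms₁ ++ [N]) (Ns := Ns) hC hR' (hI x hL) ?_
          ((Binding.open_msubst hR.sub.lc hxJ 0 _).trans ?_) hNs tNs
        · rw [Instr.open_msubst hR.sub.lc hx, ← Instr.map_succ, hN.readback_eq]
        · rw [hJ₀, List.append_assoc]; exact hMs₁

theorem Inv.unifyValR (hsg : sg.Valid) {m : Conf k} {l l₁ : ℕ} {ls : List ℕ}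
    (h : Inv sg Ξ (.read m (l :: ls))) {r : Reg k} {a : ℕ} {I : Instr k}
    (hi : m.instr = .unifyVal r a I) (hr : m.regs r = some (.hloc l₁))
    (hu : Unify m.ctx m.heap m.trail l l₁ (some (Δ₁, H₁, T₁))) :
    Inv sg Ξ (.read { m with
      trail := T₁, ctx := Δ₁, heap := H₁,
      instr := (I.inst 0 (readback m.heap l₁)).msubst (readback H₁) } ls) := by
  cases h with
  | @read _ Ψ Δ₀ Γ θ I₀ J _ c Ms _ _ hC hR hI e hJ hNs tNs =>
    have hlc := hNs.lc
    cases hNs with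
    | @cons _ _ N Ns hN hNs =>
    cases tNs with
    | @cons _ b _ as tN tNs =>
      obtain ⟨B, hB, hB'⟩ := Spine.str_cons_read hlc Ms c b as
      obtain ⟨J₀, rfl, hJ₀⟩ := Spine.msubst_eq_pi (hJ.trans hB)
      rw [hi] at e
      cases hI with
      | unifyVar => cases e
      | @unifyVal _ _ _ _ I₀ _ M hrM hI =>
        cases e
        obtain ⟨hM, tM⟩ := hR.sing hrM hr
        obtain ⟨Ms₁, hMs₁⟩ := hB' (M.msubst θ)
        obtain ⟨hs, hE, heq⟩ := hu.sound hsg rfl hR.store hN hM tN tM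
        refine .read (c := c) (Ms := Ms₁.map (LF.msubst (readback H₁)) ++ [N.msubst (readback H₁)])
          (Ns := Ns.map (LF.msubst (readback H₁))) hC (hR.ext hsg hC.closed hs hE) hI ?_ ?_
          (hE.encodesList hNs) (hE.pTms tNs)
        · rw [← Instr.msubst_msubst, hM.readback_eq]
          refine congrArg (fun I => Instr.msubst I (readback H₁)) ?_
          exact (Binding.inst_msubst hR.sub.lc I₀ 0 M).trans
            (congrArg (fun I => Instr.inst I 0 (M.msubst θ)) (Instr.map_succ I₀ θ).symm)
        · rw [← Binding.msubst_msubst]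
          have h₁ : Binding.msubst (J₀.inst 0 M) θ =
              Spine.str ((LF.cst c).apps (Ms₁ ++ N :: Ns)) c (Ms₁ ++ [M.msubst θ]) as :=
            (Binding.inst_msubst hR.sub.lc J₀ 0 M).trans (by rw [hJ₀]; exact hMs₁)
          rw [h₁, Spine.msubst_str, LF.msubst_apps]
          simp [heq, LF.msubst]

theorem Inv.readEnd {m : Conf k} (h : Inv sg Ξ (.read m [])) : Inv sg Ξ (.run m) := by
  cases h with
  | read hC hR hI e hJ hNs tNs =>
    cases hNs
    cases tNs
    rw [Spine.str_nil, List.append_nil] at hJ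
    obtain ⟨Δ₁, Γ₁, I₁, hI₁, hR₁, hi₁⟩ := hI.unif hR hJ
    exact .run hC hR₁ hI₁ (hi₁.trans e)

theorem Inv.backtrack {m : Conf k} {s : State k}
    (h : Inv sg Ξ (.run m) ∨ (∃ ls, Inv sg Ξ (.read m ls)) ∨ ∃ c l ls, Inv sg Ξ (.write m c l ls))
    (hb : Backtrack m s) : Inv sg Ξ s := by
  rcases h with h | ⟨_, h⟩ | ⟨_, _, _, h⟩
  · cases h with | run hC hR => exact hb.inv hC hR.store
  · cases h with | read hC hR => exact hb.inv hC hR.store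
  · cases h with | write hC hR => exact hb.inv hC hR.store

theorem Inv.step (hsg : sg.Valid) {s s₁ : State k} (h : Inv sg Ξ s) (hs : Step sg s s₁) :
    Inv sg Ξ s₁ := by
  cases hs with
  | mov hi hw =>
    cases h with
    | run hC hR hI e =>
      rw [hi] at e
      cases hI with
      | mov hop hI =>
        cases e
        exact .run hC (hR.set _ (hop.eval hsg hC.closed hR hw)) hI rfl
      | _ => cases e
  | jmpCode hi hw hv hI => exact h.jmpCode hsg hi hw hv hI
  | jmpClos hi hw hl hv hI => exact h.jmpClos hsg hi hw hl hv hI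
  | close hi hw hl => exact h.close hsg hi hw hl
  | pushBt hi hw => exact h.pushBt hsg hi hw
  | putTuple hi =>
    cases h with
    | run hC hR hI e =>
      rw [hi] at e
      cases hI with
      | putTuple hn hI =>
        cases e
        exact .twrite (τs₁ := []) hC hR hI hn rfl .nil
      | _ => cases e
  | setVal hi hw => exact h.setVal hi hw
  | tupleEnd hl => exact h.tupleEnd hl
  | proj hi hr hl hw => exact h.proj hi hr hl hw
  | getVal hi h₁ h₂ hu => exact h.getVal hsg hi h₁ h₂ hu
  | getValBt _ _ _ _ hb => exact .backtrack (.inl h) hb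
  | putVar hi hl => exact h.putVar hi hl
  | putStr hi hc hl => exact h.putStr hsg hi hc hl
  | unifyVarW hi hc hlen hl => exact h.unifyVarW hsg hi hc hlen hl
  | unifyValW hi hc hlen hr => exact h.unifyValW hsg hi hc hlen hr
  | writeEnd hc hlen he hf ho => exact h.writeEnd hsg hc hlen he hf ho
  | writeBt _ _ _ _ _ _ hb => exact .backtrack (.inr (.inr ⟨_, _, _, h⟩)) hb
  | getStrW hi hr he hf => exact h.getStrW hi hr he hf
  | getStrR hi hr he hf => exact h.getStrR hsg hi hr he hf
  | getStrBt _ _ _ _ _ hb => exact .backtrack (.inl h) hb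
  | unifyVarR hi => exact h.unifyVarR hi
  | unifyValR hi hr hu => exact h.unifyValR hsg hi hr hu
  | unifyValBt _ _ _ hb => exact .backtrack (.inr (.inl ⟨_, h⟩)) hb
  | readEnd => exact h.readEnd

theorem Inv.steps (hsg : sg.Valid) {s s₁ : State k} (h : Inv sg Ξ s)
    (hs : Relation.ReflTransGen (Step sg) s s₁) : Inv sg Ξ s₁ := by
  induction hs with
  | refl => exact h
  | tail _ hs ih => exact ih.step hsg hs

/-- The static proof term of a `succeed` instruction, read under the substitution of the state, is
an LF proof over the variables that are free on the heap. -/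
theorem Inv.succeed (hsg : sg.Valid) {m : Conf k} (h : Inv sg Ξ (.run m)) {M A : LF} {I : Instr k}
    (hi : m.instr = .succeed M A I) :
    (∀ x B, (x, B) ∈ m.ctx → ∃ a, B = .fam a ∧ Decl.ptype a ∈ sg) ∧ HasType sg m.ctx M A := by
  cases h with
  | run hC hR hI e =>
    rw [hi] at e
    cases hI with
    | succeed hM =>
      cases e
      refine ⟨fun x B hx => ?_, hM.msubst hsg hR.sub⟩
      obtain ⟨a, rfl, hf⟩ := hR.store.ctx.free hx
      exact ⟨a, rfl, hR.store.ctx.2.2 x a hf⟩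
    | _ => cases e

end Preservation

end TWAM

theorem mainTheorem1 {k : ℕ} (sg : TWAM.Sig) (hsg : sg.Valid) (Ξ : ℕ → Option (TWAM.Ty k))
    (m m' : TWAM.State k) (hok : TWAM.MachineOk sg Ξ m)
    (hsteps : Relation.ReflTransGen (TWAM.Step sg) m m') (hdone : m'.Done) :
    ∃ (T : TWAM.Trail) (Δ : TWAM.Ctx) (C : ℕ → Option (TWAM.Code k)) (H : TWAM.Heap)
      (R : TWAM.Reg k → Option TWAM.Word) (M A : TWAM.LF) (I : TWAM.Instr k),
      m' = .run ⟨T, Δ, C, H, R, .succeed M A I⟩ ∧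
      (∀ x B, (x, B) ∈ Δ → ∃ a, B = .fam a ∧ TWAM.Decl.ptype a ∈ sg) ∧
      TWAM.HasType sg Δ M A := by
  have h := hok.inv.steps hsg hsteps
  cases hdone with
  | @intro m₁ M A I hi =>
    obtain ⟨T, Δ, C, H, R, J⟩ := m₁
    obtain ⟨hΔ, hM⟩ := h.succeed hsg hi
    cases hi
    exact ⟨T, Δ, C, H, R, M, A, I, rfl, hΔ, hM⟩
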